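/- Let $N,M\ge 0$, $\epsilon\in\{1,-1\}$, and let the indices $a=1,\dots,N+M$ carry degrees $[a]\in\mathbb Z/2$, with $N$ even and $M$ odd indices. Let $\varepsilon_{ab}\in\mathbb C$ be a super-metric: an invertible matrix with $\varepsilon_{ab}=\epsilon(-1)^{[a][b]}\varepsilon_{ba}$ and $\varepsilon_{ab}=0$ unless $[a]=[b]$. Let $\varepsilon^{ab}$ be its inverse matrix, raise indices by $z^a=\varepsilon^{ab}z_b$, and put $\omega=\epsilon(N-M)$. Summation over repeated indices is understood. Let $\mathcal A$ be the unital associative $\mathbb C$-algebra generated by $c^a$ with relations $c^ac^b+\epsilon(-1)^{[a][b]}c^bc^a=\varepsilon^{ab}$, $\mathbb Z/2$-graded by $\mathrm{grad}(c^a)=[a]$. Let $$c^{(a_1\dots a_k)}=c^{(a_1}\cdots c^{a_k)}=\frac1{k!}\sum_{\sigma\in S_k}s_\sigma\,c^{a_{\sigma(1)}}\cdots c^{a_{\sigma(k)}},$$ where $s_\sigma$ is the product of $-\epsilon(-1)^{[a_{\sigma(i)}][a_{\sigma(j)}]}$ over the inversions $i<j$, $\sigma(i)>\sigma(j)$. Put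 $F^{ab}=\epsilon(-1)^{[b]}c^{(a}c^{b)}$. Let $\mathcal Y$ be a $\mathbb Z/2$-graded unital associative $\mathbb C$-algebra with elements $G_{ab}$ that are generators of $osp$, i.e. $G_{ab}$ is homogeneous of degree $[a]+[b]$, $G_{ab}=-\epsilon(-1)^{[a][b]+[a]+[b]}G_{ba}$, and $$(-1)^{[c_1]([a_2]+[c_2])}[G^{a_1}{}_{c_1},G^{a_2}{}_{c_2}]_\pm=\epsilon(-1)^{[c_1][c_2]}\delta^{a_2}_{c_1}G^{a_1}{}_{c_2}-\epsilon(-1)^{[a_1][a_2]}\delta^{a_1}_{c_2}G^{a_2}{}_{c_1}+\epsilon(-1)^{[c_2]}\varepsilon^{a_1a_2}G_{c_2c_1}-\epsilon(-1)^{[a_2]}\varepsilon_{c_1c_2}G^{a_1a_2},$$ where $[X,Z]_\pm=XZ-(-1)^{\mathrm{grad}X\,\mathrm{grad}Z}ZX$. Suppose in addition that $$\{G_{(bc},G_{d)a}\}_\mp=0\quad\text{for all }a,b,c,d,$$ where $\{X,Z\}_\mp=XZ+(-1)^{\mathrm{grad}X\,\mathrm{grad}Z}ZX$ and $(bcd)$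 denotes super-symmetrisation over $b,c,d$ as above, but with the factor $-\epsilon(-1)^{[p][q]+[p]+[q]}$ for each inversion of indices $p,q$. In the graded tensor product $\mathcal A\otimes\mathcal A\otimes\mathcal Y$, with $c_1^a,F_1^{ab}$ in the first and $c_2^a,F_2^{ab}$ in the second factor, put $L_i(u)=u-\tfrac12F_i^{ab}\otimes G_{ba}$. For a complex sequence $(r_k)_{k\ge0}$ let $\check{\mathcal R}$ be the formal series $$\check{\mathcal R}=\sum_{k\ge0}\frac{r_k}{k!}\,\varepsilon_{a_1b_1}\cdots\varepsilon_{a_kb_k}\,c_1^{(a_1\dots a_k)}c_2^{(b_k\dots b_1)}$$ in the completion in which convergence means coefficientwise convergence with respect to the super-symmetrised monomials: a sequence tends to $0$ if, for every $d$, it eventually lies in the span of the elements $c_1^{(a_1\dots a_k)}c_2^{(b_1\dots b_l)}\otimes y$ with $k+l\ge d$. (Multiplication by elements of $\mathcal A\otimes\mathcal A\otimes\mathcal Y$ extends to such series.) Then: 1. Let $A,B$ be functions $\mathbb C\to\mathbb C$ and $$r_{2m}(u)=(-4)^m\frac{\Gamma(m-\frac u2)}{\Gamma(m+1+\frac{u-\omega}2)}A(u),\qquad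 r_{2m+1}(u)=(-4)^m\frac{\Gamma(m-\frac{u-1}2)}{\Gamma(m+1+\frac{u-\omega+1}2)}B(u),$$ where $1/\Gamma$ is the entire function. Let $u\in\mathbb C$ be such that $u\notin\{0,2,4,\dots\}$ or $A(u)=0$ (in which case $r_{2m}(u)$ means $0$ for all $m$), and $u\notin\{1,3,5,\dots\}$ or $B(u)=0$ (in which case $r_{2m+1}(u)$ means $0$ for all $m$). Then $$(k+2+u-\omega)\,r_{k+2}(u)=4(u-k)\,r_k(u)\qquad(k\ge0),$$ and, with $r_k=r_k(u)$ and $\check{\mathcal R}(u)=\check{\mathcal R}$, for all $v\in\mathbb C$ $$\check{\mathcal R}(u)L_1(u+v)L_2(v)=L_1(v)L_2(u+v)\check{\mathcal R}(u).$$ 2. More generally, for every $u\in\mathbb C$ and every sequence $(r_k)$ with $(k+2+u-\omega)r_{k+2}=4(u-k)r_k$ for all $k\ge0$, the series $\check{\mathcal R}(u)=\check{\mathcal R}$ satisfies the same relation for all $v\in\mathbb C$. 3. If $u\in\mathbb C$ is not a non-negative integer, a sequence satisfies this recurrence if and only if it is of the form in 1 for some values $A(u),B(u)\in\mathbb C$.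 -/

import Mathlib

open scoped TensorProduct

noncomputable section

namespace OSp

/-! ### Super-algebras: a parity involution and its eigenspaces -/

/-- The sign `(-1)^x` of a parity `x ∈ ℤ/2`, as a complex number. -/
def sgn (x : ZMod 2) : ℂ := if x = 0 then 1 else -1

theorem sgn_zero : sgn 0 = 1 := by simp [sgn]

theorem sgn_one : sgn 1 = -1 := by simp [sgn]

theorem zmod_two_cases (x : ZMod 2) : x = 0 ∨ x = 1 := by
  revert x
  decide

theorem sgn_add (x y : ZMod 2) : sgn (x + y) = sgn x * sgn y := by
  have h : (1 + 1 : ZMod 2) = 0 := rfl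
  rcases zmod_two_cases x with rfl | rfl <;> rcases zmod_two_cases y with rfl | rfl <;>
    simp [sgn_zero, sgn_one, h]

theorem sgn_mul_self (x : ZMod 2) : sgn x * sgn x = 1 := by
  rcases zmod_two_cases x with rfl | rfl <;> simp [sgn_zero, sgn_one]

/-- The `ℤ/2`-grading of an algebra attached to a parity automorphism `σ`: the elements of
degree `i` are those with `σ x = (-1)^i x`. -/
def parityGrading {A : Type*} [Ring A] [Algebra ℂ A] (σ : A →ₐ[ℂ] A) (i : ZMod 2) :
    Submodule ℂ A :=
  LinearMap.ker (σ.toLinearMap - sgn i • LinearMap.id)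

theorem mem_parityGrading {A : Type*} [Ring A] [Algebra ℂ A] (σ : A →ₐ[ℂ] A) (i : ZMod 2)
    (x : A) : x ∈ parityGrading σ i ↔ σ x = sgn i • x := by
  simp [parityGrading, sub_eq_zero]

theorem parityGrading_gradedMonoid {A : Type*} [Ring A] [Algebra ℂ A] (σ : A →ₐ[ℂ] A) :
    SetLike.GradedMonoid (parityGrading σ) where
  one_mem := by simp [mem_parityGrading, sgn_zero]
  mul_mem := by
    intro i j x y hx hy
    rw [mem_parityGrading] at *
    rw [map_mul, hx, hy, sgn_add, smul_mul_smul_comm]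

/-- The projection `x ↦ ½ (x + (-1)^i σ x)` onto the part of degree `i`. -/
def parityProj {A : Type*} [Ring A] [Algebra ℂ A] (σ : A →ₐ[ℂ] A)
    (hσ : ∀ x, σ (σ x) = x) (i : ZMod 2) : A →ₗ[ℂ] parityGrading σ i :=
  LinearMap.codRestrict (parityGrading σ i)
    ((1 / 2 : ℂ) • (LinearMap.id + sgn i • σ.toLinearMap)) (by
      intro x
      have h : sgn i • sgn i • σ x = σ x := by rw [smul_smul, sgn_mul_self, one_smul]
      simp only [mem_parityGrading, LinearMap.smul_apply, LinearMap.add_apply, LinearMap.id_apply,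
        AlgHom.toLinearMap_apply, map_smul, map_add, hσ]
      rw [smul_comm (sgn i), smul_add (sgn i), h, add_comm])

theorem coe_parityProj {A : Type*} [Ring A] [Algebra ℂ A] (σ : A →ₐ[ℂ] A)
    (hσ : ∀ x, σ (σ x) = x) (i : ZMod 2) (x : A) :
    (parityProj σ hσ i x : A) = (1 / 2 : ℂ) • (x + sgn i • σ x) := rfl

/-- An involutive automorphism makes an algebra `ℤ/2`-graded. -/
@[reducible]
def parityGradedAlgebra {A : Type*} [Ring A] [Algebra ℂ A] (σ : A →ₐ[ℂ] A)
    (hσ : ∀ x, σ (σ x) = x) : GradedAlgebra (parityGrading σ) :=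
  { parityGrading_gradedMonoid σ,
    DirectSum.Decomposition.ofLinearMap (parityGrading σ)
      (DirectSum.lof ℂ _ (fun i => parityGrading σ i) 0 ∘ₗ parityProj σ hσ 0 +
        DirectSum.lof ℂ _ (fun i => parityGrading σ i) 1 ∘ₗ parityProj σ hσ 1)
      (by
        ext x
        simp only [LinearMap.comp_apply, LinearMap.add_apply, map_add, LinearMap.id_apply,
          DirectSum.coeLinearMap_lof, coe_parityProj, sgn_zero, sgn_one]
        module)
      (by
        ext i y : 2
        obtain ⟨y, hy⟩ := y
        have hy' := (mem_parityGrading σ i y).1 hy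
        simp only [LinearMap.comp_apply, LinearMap.add_apply, LinearMap.id_apply,
          DirectSum.coeLinearMap_lof]
        rcases zmod_two_cases i with rfl | rfl
        · have h0 : parityProj σ hσ 0 y = ⟨y, hy⟩ := by
            ext
            rw [coe_parityProj, hy', sgn_zero]
            module
          have h1 : parityProj σ hσ 1 y = 0 := by
            ext
            rw [coe_parityProj, hy', sgn_zero, sgn_one, Submodule.coe_zero]
            module
          rw [h0, h1, map_zero, add_zero]
        · have h0 : parityProj σ hσ 1 y = ⟨y, hy⟩ := by
            ext
            rw [coe_parityProj, hy', sgn_one]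
            module
          have h1 : parityProj σ hσ 0 y = 0 := by
            ext
            rw [coe_parityProj, hy', sgn_zero, sgn_one, Submodule.coe_zero]
            module
          rw [h0, h1, map_zero, zero_add]) with }

/-- The total parity automorphism `σ ⊗ τ` of a graded tensor product of two super-algebras. -/
def tensorParity {A B : Type*} [Ring A] [Algebra ℂ A] [Ring B] [Algebra ℂ B]
    (σ : A →ₐ[ℂ] A) (τ : B →ₐ[ℂ] B)
    [GradedAlgebra (parityGrading σ)] [GradedAlgebra (parityGrading τ)] :
    (parityGrading σ ᵍ⊗[ℂ] parityGrading τ) →ₐ[ℂ] (parityGrading σ ᵍ⊗[ℂ] parityGrading τ) :=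
  GradedTensorProduct.lift (parityGrading σ) (parityGrading τ)
    ((GradedTensorProduct.includeLeft _ _).comp σ)
    ((GradedTensorProduct.includeRight _ _).comp τ) (by
      intro i j a b
      have ha := (mem_parityGrading σ i a).1 a.2
      have hb := (mem_parityGrading τ j b).1 b.2
      simp only [AlgHom.comp_apply, ha, hb, map_smul, smul_mul_smul_comm,
        GradedTensorProduct.includeLeft_apply, GradedTensorProduct.includeRight_apply]
      rw [GradedTensorProduct.tmul_one_mul_one_tmul,
        GradedTensorProduct.tmul_coe_mul_coe_tmul, smul_comm, smul_smul, Int.units_mul_self,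
        one_smul, one_mul, mul_one, mul_comm (sgn i)])

theorem tensorParity_tmul {A B : Type*} [Ring A] [Algebra ℂ A] [Ring B] [Algebra ℂ B]
    (σ : A →ₐ[ℂ] A) (τ : B →ₐ[ℂ] B)
    [GradedAlgebra (parityGrading σ)] [GradedAlgebra (parityGrading τ)] (a : A) (b : B) :
    tensorParity σ τ (a ᵍ⊗ₜ[ℂ] b) = (σ a) ᵍ⊗ₜ[ℂ] (τ b) := by
  simp [tensorParity, GradedTensorProduct.tmul_one_mul_one_tmul]

theorem tensorParity_invol {A B : Type*} [Ring A] [Algebra ℂ A] [Ring B] [Algebra ℂ B]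
    (σ : A →ₐ[ℂ] A) (τ : B →ₐ[ℂ] B)
    [GradedAlgebra (parityGrading σ)] [GradedAlgebra (parityGrading τ)]
    (hσ : ∀ x, σ (σ x) = x) (hτ : ∀ x, τ (τ x) = x)
    (x : parityGrading σ ᵍ⊗[ℂ] parityGrading τ) : tensorParity σ τ (tensorParity σ τ x) = x := by
  have h : (tensorParity σ τ).comp (tensorParity σ τ) = AlgHom.id ℂ _ := by
    ext y
    · simp [tensorParity_tmul, hσ]
    · simp [tensorParity_tmul, hτ]
  exact congrArg (fun f => f x) h

/-! ### The super-metric -/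

/-- The indices of the superspace with `N` even and `M` odd coordinates. -/
abbrev Idx (N M : ℕ) : Type := Fin N ⊕ Fin M

/-- The degree `[a]` of an index. -/
def deg {N M : ℕ} : Idx N M → ZMod 2 := Sum.elim (fun _ => 0) (fun _ => 1)

/-- A super-metric `ε_{ab}` with `ε_{ab} = ϵ (-1)^{[a][b]} ε_{ba}`, which is even and
non-degenerate. -/
structure SuperMetric (N M : ℕ) (ϵ : ℤˣ) where
  /-- the metric `ε_{ab}` with lower indices -/
  low : Matrix (Idx N M) (Idx N M) ℂ
  symm : ∀ a b, low a b = ((ϵ : ℤ) : ℂ) * sgn (deg a * deg b) * low b a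
  even : ∀ a b, deg a ≠ deg b → low a b = 0
  nondeg : IsUnit low.det

namespace SuperMetric

variable {N M : ℕ} {ϵ : ℤˣ} (E : SuperMetric N M ϵ)

/-- The sign `ϵ = ±1` as a complex number. -/
def eps (_E : SuperMetric N M ϵ) : ℂ := ((ϵ : ℤ) : ℂ)

/-- `ε^{ab}`: the inverse matrix of the metric. -/
def up : Matrix (Idx N M) (Idx N M) ℂ := E.low⁻¹

/-- `ω = ϵ (N - M)`. -/
def omega (_E : SuperMetric N M ϵ) : ℂ := ((ϵ : ℤ) : ℂ) * ((N : ℂ) - (M : ℂ))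

theorem up_even (a b : Idx N M) (h : deg a ≠ deg b) : E.up a b = 0 := by
  have hu := E.nondeg
  let D : Matrix (Idx N M) (Idx N M) ℂ := Matrix.diagonal fun a => sgn (deg a)
  have hDD : D * D = 1 := by
    simp only [D, Matrix.diagonal_mul_diagonal, sgn_mul_self, Matrix.diagonal_one]
  have hD : D⁻¹ = D := Matrix.inv_eq_left_inv hDD
  have hl : D * E.low * D = E.low := by
    ext i j
    simp only [D, Matrix.diagonal_mul, Matrix.mul_diagonal]
    by_cases hij : deg i = deg j
    · rw [hij, mul_right_comm, sgn_mul_self, one_mul]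
    · rw [E.even i j hij]; simp
  have hup : D * E.up * D = E.up := by
    conv_rhs => rw [up, ← hl, Matrix.mul_inv_rev, Matrix.mul_inv_rev, hD, ← Matrix.mul_assoc]
    rfl
  have := congrFun (congrFun hup a) b
  simp only [D, Matrix.diagonal_mul, Matrix.mul_diagonal] at this
  rw [mul_right_comm, ← sgn_add] at this
  have h1 : deg a + deg b = 1 := by
    revert h
    generalize deg a = x
    generalize deg b = y
    revert x y
    decide
  rw [h1, sgn_one] at this
  linear_combination (-1 / 2 : ℂ) * this

/-! ### The algebra of super-oscillators -/

/-- The defining relations `c^a c^b + ϵ (-1)^{[a][b]} c^b c^a = ε^{ab}`. -/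
inductive OscRel : FreeAlgebra ℂ (Idx N M) → FreeAlgebra ℂ (Idx N M) → Prop
  | rel (a b : Idx N M) :
      OscRel
        (FreeAlgebra.ι ℂ a * FreeAlgebra.ι ℂ b +
          (E.eps * sgn (deg a * deg b)) • (FreeAlgebra.ι ℂ b * FreeAlgebra.ι ℂ a))
        (algebraMap ℂ _ (E.up a b))

/-- The super-oscillator algebra `𝒜`. -/
def Osc : Type := RingQuot E.OscRel

instance : Ring E.Osc := inferInstanceAs (Ring (RingQuot E.OscRel))

instance : Algebra ℂ E.Osc := inferInstanceAs (Algebra ℂ (RingQuot E.OscRel))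

/-- The super-oscillators `c^a`. -/
def c (a : Idx N M) : E.Osc := RingQuot.mkAlgHom ℂ E.OscRel (FreeAlgebra.ι ℂ a)

theorem c_rel (a b : Idx N M) :
    E.c a * E.c b + (E.eps * sgn (deg a * deg b)) • (E.c b * E.c a) =
      algebraMap ℂ E.Osc (E.up a b) := by
  have h := RingQuot.mkAlgHom_rel ℂ (OscRel.rel (E := E) a b)
  rw [map_add, map_mul, map_smul, map_mul, AlgHom.commutes] at h
  exact h

/-- The parity automorphism `c^a ↦ (-1)^{[a]} c^a` of `𝒜`. -/
def oscParity : E.Osc →ₐ[ℂ] E.Osc :=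
  RingQuot.liftAlgHom ℂ (s := E.OscRel)
    ⟨FreeAlgebra.lift ℂ fun a => sgn (deg a) • E.c a, by
      rintro _ _ ⟨a, b⟩
      simp only [map_add, map_mul, map_smul, FreeAlgebra.lift_ι_apply, AlgHom.commutes,
        smul_mul_smul_comm]
      rw [mul_comm (sgn (deg b)), smul_comm _ (sgn (deg a) * sgn (deg b)), ← smul_add, c_rel,
        ← sgn_add]
      by_cases h : deg a = deg b
      · rw [h, sgn_add, sgn_mul_self, one_smul]
      · rw [E.up_even a b h, map_zero, smul_zero]⟩

theorem oscParity_c (a : Idx N M) : E.oscParity (E.c a) = sgn (deg a) • E.c a := by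
  rw [oscParity, c]
  erw [RingQuot.liftAlgHom_mkAlgHom_apply]
  rw [FreeAlgebra.lift_ι_apply]
  rfl

theorem oscParity_invol (x : E.Osc) : E.oscParity (E.oscParity x) = x := by
  have h : E.oscParity.comp E.oscParity = AlgHom.id ℂ E.Osc := by
    apply RingQuot.ringQuot_ext' (S := ℂ) (s := E.OscRel)
    apply FreeAlgebra.hom_ext
    funext a
    change E.oscParity (E.oscParity (E.c a)) = E.c a
    rw [oscParity_c, map_smul, oscParity_c, smul_smul, sgn_mul_self, one_smul]
  exact congrArg (fun f => f x) h

/-- The `ℤ/2`-grading of `𝒜` in which `c^a` has degree `[a]`. -/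
abbrev oscGrading : ZMod 2 → Submodule ℂ E.Osc := parityGrading E.oscParity

instance : GradedAlgebra E.oscGrading := parityGradedAlgebra _ E.oscParity_invol

/-- The graded tensor product `𝒜 ⊗ 𝒜`. -/
abbrev Osc2 : Type := E.oscGrading ᵍ⊗[ℂ] E.oscGrading

/-- The total `ℤ/2`-grading of `𝒜 ⊗ 𝒜`. -/
abbrev osc2Grading : ZMod 2 → Submodule ℂ E.Osc2 :=
  parityGrading (tensorParity E.oscParity E.oscParity)

instance : GradedAlgebra E.osc2Grading :=
  parityGradedAlgebra _ (tensorParity_invol _ _ E.oscParity_invol E.oscParity_invol)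

/-- The two embeddings `x ↦ x ⊗ e` and `x ↦ e ⊗ x` of `𝒜` into `𝒜 ⊗ 𝒜`. -/
def leg (i : Fin 2) : E.Osc →ₐ[ℂ] E.Osc2 :=
  if i = 0 then GradedTensorProduct.includeLeft E.oscGrading E.oscGrading
  else GradedTensorProduct.includeRight E.oscGrading E.oscGrading

/-! ### Super-symmetrised products and the `osp` generators in `𝒜` -/

/-- The sign produced by reordering `c^{a_1} ⋯ c^{a_k}` into `c^{a_{σ(1)}} ⋯ c^{a_{σ(k)}}`: each
inversion of `σ` contributes `-ϵ (-1)^{[a][b]}`, with `a`, `b` the two indices involved. -/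
def reorderSign {k : ℕ} (a : Fin k → Idx N M) (σ : Equiv.Perm (Fin k)) : ℂ :=
  ∏ i : Fin k, ∏ j : Fin k,
    if i < j ∧ σ j < σ i then -E.eps * sgn (deg (a (σ i)) * deg (a (σ j))) else 1

/-- The super-symmetrised product `c^{(a_1} ⋯ c^{a_k)}`. -/
def symProd {k : ℕ} (a : Fin k → Idx N M) : E.Osc :=
  (1 / (k.factorial : ℂ)) •
    ∑ σ : Equiv.Perm (Fin k), E.reorderSign a σ • (List.ofFn fun i => E.c (a (σ i))).prod

/-- `F^{ab} = ϵ (-1)^{[b]} c^{(a} c^{b)}`. -/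
def F (a b : Idx N M) : E.Osc := (E.eps * sgn (deg b)) • E.symProd ![a, b]

/-- The invariants `ε_{a_1 b_1} ⋯ ε_{a_k b_k} c_1^{(a_1} ⋯ c_1^{a_k)} c_2^{(b_k} ⋯ c_2^{b_1)}`. -/
def invariant (k : ℕ) : E.Osc2 :=
  ∑ a : Fin k → Idx N M, ∑ b : Fin k → Idx N M,
    (∏ i, E.low (a i) (b i)) •
      (E.leg 0 (E.symProd a) * E.leg 1 (E.symProd fun i => b (Fin.rev i)))

/-! ### The generators `G` -/

variable {Y : Type*} [Ring Y] [Algebra ℂ Y]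

/-- `G^a_b = ε^{ac} G_{cb}`. -/
def raiseFst (G : Idx N M → Idx N M → Y) (a b : Idx N M) : Y := ∑ d, E.up a d • G d b

/-- `G^{ab} = ε^{ac} ε^{bd} G_{cd}`. -/
def raiseBoth (G : Idx N M → Idx N M → Y) (a b : Idx N M) : Y :=
  ∑ d, E.up b d • E.raiseFst G a d

/-- The family `G_{ab}` of elements of a super-algebra consists of generators of the Lie
superalgebra `osp`: `G_{ab}` has degree `[a]+[b]`, has the symmetry of an element of `osp`, and the
`G^a_b` satisfy the `osp` supercommutation relations. -/
structure IsOspGenerators (𝒴 : ZMod 2 → Submodule ℂ Y) (G : Idx N M → Idx N M → Y) : Prop where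
  homogeneous : ∀ a b, G a b ∈ 𝒴 (deg a + deg b)
  symmetry : ∀ a b,
    G a b + (E.eps * sgn (deg a * deg b + deg a + deg b)) • G b a = 0
  supercomm : ∀ a₁ c₁ a₂ c₂ : Idx N M,
    sgn (deg c₁ * (deg a₂ + deg c₂)) •
        (E.raiseFst G a₁ c₁ * E.raiseFst G a₂ c₂ -
          sgn ((deg a₁ + deg c₁) * (deg a₂ + deg c₂)) •
            (E.raiseFst G a₂ c₂ * E.raiseFst G a₁ c₁)) =
      (E.eps * sgn (deg c₁ * deg c₂) * (if a₂ = c₁ then 1 else 0)) • E.raiseFst G a₁ c₂ -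
      (E.eps * sgn (deg a₁ * deg a₂) * (if a₁ = c₂ then 1 else 0)) • E.raiseFst G a₂ c₁ +
      (E.eps * sgn (deg c₂) * E.up a₁ a₂) • G c₂ c₁ -
      (E.eps * sgn (deg a₂) * E.low c₁ c₂) • E.raiseBoth G a₁ a₂

/-- The super-anticommutator `{G_{ab}, G_{cd}}_∓`. -/
def superAnticomm (G : Idx N M → Idx N M → Y) (a b p q : Idx N M) : Y :=
  G a b * G p q + sgn ((deg a + deg b) * (deg p + deg q)) • (G p q * G a b)

/-- The sign of a reordering of the indices of `G`: each inversion contributes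
`-ϵ (-1)^{[a][b]+[a]+[b]}`. -/
def reorderSignG {k : ℕ} (a : Fin k → Idx N M) (σ : Equiv.Perm (Fin k)) : ℂ :=
  ∏ i : Fin k, ∏ j : Fin k,
    if i < j ∧ σ j < σ i then
      -E.eps * sgn (deg (a (σ i)) * deg (a (σ j)) + deg (a (σ i)) + deg (a (σ j)))
    else 1

/-- The constraint `{G_{(bc}, G_{d)a}}_∓ = 0`; the three super-symmetrised indices are
`b = x 0`, `c = x 1`, `d = x 2`. -/
def SymAnticommVanishes (G : Idx N M → Idx N M → Y) : Prop :=
  ∀ (x : Fin 3 → Idx N M) (a : Idx N M),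
    (1 / ((3).factorial : ℂ)) • ∑ σ : Equiv.Perm (Fin 3),
      E.reorderSignG x σ • superAnticomm G (x (σ 0)) (x (σ 1)) (x (σ 2)) a = 0

/-! ### The `L`-operators, the `R`-operator and the spinorial `RLL`-relation -/

variable (𝒴 : ZMod 2 → Submodule ℂ Y) [GradedAlgebra 𝒴]

/-- The graded tensor product `𝒜 ⊗ 𝒜 ⊗ Y`. -/
abbrev Osc2Y : Type _ := E.osc2Grading ᵍ⊗[ℂ] 𝒴

/-- `L_i(u) = u - ½ F_i^{ab} ⊗ G_{ba}`, where `i = 0` and `i = 1` stand for the first and the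
second factor `𝒜`. -/
def L (G : Idx N M → Idx N M → Y) (i : Fin 2) (u : ℂ) : E.Osc2Y 𝒴 :=
  u • (1 : E.Osc2Y 𝒴) -
    (1 / 2 : ℂ) • ∑ a : Idx N M, ∑ b : Idx N M,
      ((E.leg i (E.F a b)) ᵍ⊗ₜ[ℂ] (G b a) : E.Osc2Y 𝒴)

/-- The partial sums `∑_{k < K} (r_k / k!) ε_{a,b} c_1^{(a_1…a_k)} c_2^{(b_k…b_1)}` of the formal
series defining the `R`-operator. -/
def Rsum (r : ℕ → ℂ) (K : ℕ) : E.Osc2 :=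
  ∑ k ∈ Finset.range K, (r k / (k.factorial : ℂ)) • E.invariant k

/-- The span of the `c_1^{(a_1} ⋯ c_1^{a_k)} c_2^{(b_1} ⋯ c_2^{b_l)} ⊗ y` with `k + l ≥ d`. The
super-symmetrised monomials span `𝒜 ⊗ 𝒜` and, apart from the symmetries under permutations of the
indices, are linearly independent, so this is a separated decreasing filtration of `𝒜 ⊗ 𝒜 ⊗ Y`.
A formal series `∑ x_k` of super-symmetrised monomials of growing degrees is an element of the
completion. -/
def filtration (d : ℕ) : Submodule ℂ (E.Osc2Y 𝒴) :=
  Submodule.span ℂ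
    {z | ∃ (k l : ℕ) (a : Fin k → Idx N M) (b : Fin l → Idx N M) (y : Y), d ≤ k + l ∧
      z = ((E.leg 0 (E.symProd a) * E.leg 1 (E.symProd b)) ᵍ⊗ₜ[ℂ] y : E.Osc2Y 𝒴)}

/-- Convergence to zero of a sequence in `𝒜 ⊗ 𝒜 ⊗ Y`, coefficientwise with respect to the
super-symmetrised monomials: it eventually enters each step of the filtration. -/
def TendsToZero (x : ℕ → E.Osc2Y 𝒴) : Prop :=
  ∀ d : ℕ, ∃ K₀ : ℕ, ∀ K ≥ K₀, x K ∈ E.filtration 𝒴 d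

/-- The spinorial relation `R(u) L_1(u+v) L_2(v) = L_1(v) L_2(u+v) R(u)` for the formal series
`R(u) = ∑_k (r_k / k!) ε_{a,b} c_1^{(a_1…a_k)} c_2^{(b_k…b_1)}`. Multiplication by an element of
`𝒜 ⊗ 𝒜 ⊗ Y` on either side lowers the filtration by a bounded amount, hence both sides are the
limits of the corresponding expressions for the partial sums; when all products
`c^{(a_1} ⋯ c^{a_k)}` of large order vanish this is an identity in `𝒜 ⊗ 𝒜 ⊗ Y`. -/
def SpinorialRLL (G : Idx N M → Idx N M → Y) (r : ℕ → ℂ) (u v : ℂ) : Prop :=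
  E.TendsToZero 𝒴 fun K =>
    ((E.Rsum r K) ᵍ⊗ₜ[ℂ] (1 : Y) : E.Osc2Y 𝒴) * E.L 𝒴 G 0 (u + v) * E.L 𝒴 G 1 v -
      E.L 𝒴 G 0 v * E.L 𝒴 G 1 (u + v) * ((E.Rsum r K) ᵍ⊗ₜ[ℂ] (1 : Y) : E.Osc2Y 𝒴)

end SuperMetric

/-- The recurrence `r_{k+2} = 4 (u - k) / (k + 2 + u - ω) r_k`, with the denominator cleared. -/
def Recurrence (ω u : ℂ) (r : ℕ → ℂ) : Prop :=
  ∀ k : ℕ, ((k : ℂ) + 2 + u - ω) * r (k + 2) = 4 * (u - k) * r k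

/-- The coefficients
`r_{2m} = (-4)^m Γ(m - u/2) / Γ(m + 1 + (u-ω)/2) α` and
`r_{2m+1} = (-4)^m Γ(m - (u-1)/2) / Γ(m + 1 + (u-ω+1)/2) β`. (A pole of the denominator
gives the value `0`, in agreement with the entire function `1/Γ`.) -/
def gammaCoeff (ω u α β : ℂ) (k : ℕ) : ℂ :=
  if Even k then
    (-4) ^ (k / 2) *
      (Complex.Gamma (((k / 2 : ℕ) : ℂ) - u / 2) /
        Complex.Gamma (((k / 2 : ℕ) : ℂ) + 1 + (u - ω) / 2)) * α
  else
    (-4) ^ (k / 2) *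
      (Complex.Gamma (((k / 2 : ℕ) : ℂ) - (u - 1) / 2) /
        Complex.Gamma (((k / 2 : ℕ) : ℂ) + 1 + (u - ω + 1) / 2)) * β

end OSp

end

/-!
Write `s = ε_{ab} c_1^a c_2^b` for the first invariant and `X_i = F_i^{ab} G_{ba}`. Up to a sign the
`k`-th invariant is a polynomial `J_k` in `s`, where `J_{k+1} = s J_k - κ_k J_{k-1}` and
`κ_k = ¼ ϵ k (ω - k + 1)`; the lower-order term comes from symmetrising the new oscillators.

Since `s` commutes with `X_1 + X_2`, the spectral parameter `v` drops out of the `RLL`-relation, and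
what remains to be shown for the series `Z` of invariants is `[Z, X_1 X_2] = u (Z H + H Z)` with
`H = X_2 - X_1`. The constraint on the generators enters only through `[s, X_1 X_2] = s H + H s`.
Together with `W = [s, H]` and `[s, W] = 4 ϵ H` it yields
`[J_k, X_1 X_2] - u (J_k H + H J_k) = -2 (u - k) T_k - ½ ϵ k (k - 1) (k + u - ω) T_{k-2}`,
where `T_k` is a contraction of `G` with products super-symmetrised in their `2 k + 2` oscillators.
The recurrence for `r_k` is precisely what makes the sum over `k` telescope, so the partial sums
satisfy the relation up to two terms of arbitrarily high filtration degree.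

The recurrence splits into two-term recurrences for the even and the odd coefficients. If `u` is not
a non-negative integer then no coefficient `u - k` vanishes, so a solution of either is determined
by any one entry of sufficiently large index, downwards as well as upwards.
-/

noncomputable section

namespace OSp

/-! ### Twisted symmetrised products and commutators -/

section Twisted

variable {𝕜 R : Type*} [Field 𝕜] [Ring R] [Algebra 𝕜 R]

/-- Multiplication by `x`, symmetrised with a sign `χ`: `z ↦ ½ (x z + χ z x)`. -/
def symMul (χ : 𝕜) (x : R) : R →ₗ[𝕜] R :=
  (1 / 2 : 𝕜) • (LinearMap.mulLeft 𝕜 x + χ • LinearMap.mulRight 𝕜 x)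

/-- The commutator with `x`, twisted by a sign `χ`: `z ↦ x z - χ z x`. -/
def twistedComm (χ : 𝕜) (x : R) : R →ₗ[𝕜] R :=
  LinearMap.mulLeft 𝕜 x - χ • LinearMap.mulRight 𝕜 x

theorem symMul_apply (χ : 𝕜) (x z : R) :
    symMul χ x z = (1 / 2 : 𝕜) • (x * z + χ • (z * x)) := rfl

theorem twistedComm_apply (χ : 𝕜) (x z : R) : twistedComm χ x z = x * z - χ • (z * x) := rfl

theorem map_symMul {S : Type*} [Ring S] [Algebra 𝕜 S] (φ : R →ₐ[𝕜] S) (χ : 𝕜) (x z : R) :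
    φ (symMul χ x z) = symMul χ (φ x) (φ z) := by
  simp only [symMul_apply, map_smul, map_add, map_mul]

theorem symMul_smul_left (χ m : 𝕜) (x z : R) : symMul χ (m • x) z = m • symMul χ x z := by
  simp only [symMul_apply, smul_mul_assoc, mul_smul_comm]
  module

theorem twistedComm_smul_left (χ m : 𝕜) (x z : R) :
    twistedComm χ (m • x) z = m • twistedComm χ x z := by
  simp only [twistedComm_apply, smul_mul_assoc, mul_smul_comm]
  module

variable [CharZero 𝕜]

theorem symMul_one_of_commute {x z : R} (h : Commute x z) : symMul (1 : 𝕜) x z = x * z := by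
  rw [symMul_apply, ← h.eq]
  module

variable {q χ χ' : 𝕜} {x y w : R}

theorem twistedComm_symMul (hq : q * q = 1) (h : x * y = q • (y * x) + w) (z : R) :
    twistedComm (q * χ) x (symMul χ' y z) =
      symMul (χ * χ') w z + q • symMul (q * χ') y (twistedComm χ x z) := by
  have hl : x * (y * z) = q • (y * (x * z)) + w * z := by
    rw [← mul_assoc, h, add_mul, smul_mul_assoc, mul_assoc]
  have hr : z * (x * y) = q • (z * (y * x)) + z * w := by rw [h, mul_add, mul_smul_comm]
  simp only [twistedComm_apply, symMul_apply, mul_smul_comm, smul_mul_assoc, mul_add, add_mul,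
    mul_sub, sub_mul, mul_assoc, hl, hr]
  match_scalars <;> grind

theorem symMul_symMul (hq : q * q = 1) (h : x * y = q • (y * x) + w) (z : R) :
    symMul (q * χ) x (symMul χ' y z) =
      q • symMul (q * χ') y (symMul χ x z) + (1 / 4 : 𝕜) • twistedComm (χ * χ') w z := by
  have hl : x * (y * z) = q • (y * (x * z)) + w * z := by
    rw [← mul_assoc, h, add_mul, smul_mul_assoc, mul_assoc]
  have hr : z * (x * y) = q • (z * (y * x)) + z * w := by rw [h, mul_add, mul_smul_comm]
  simp only [twistedComm_apply, symMul_apply, mul_smul_comm, smul_mul_assoc, mul_add, add_mul,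
    mul_assoc, hl, hr]
  match_scalars <;> grind

theorem mul_symMul (hq : q * q = 1) (h : x * y = q • (y * x) + w) (z : R) :
    q • (y * symMul (q * χ) x z) = symMul χ x (y * z) - (1 / 2 : 𝕜) • (w * z) := by
  have hl : x * (y * z) = q • (y * (x * z)) + w * z := by
    rw [← mul_assoc, h, add_mul, smul_mul_assoc, mul_assoc]
  simp only [symMul_apply, mul_smul_comm, mul_add, mul_assoc, hl]
  match_scalars <;> grind

theorem mul_mul_add_smul_mul_mul (hχ : χ * χ = 1) (q : 𝕜) (x y z : R) :
    x * y * z + q • (z * (y * x)) =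
      (2 : 𝕜) • symMul (q * χ) x (symMul χ y z) +
        (1 / 2 : 𝕜) • twistedComm (q * χ) x (twistedComm χ y z) := by
  simp only [symMul_apply, twistedComm_apply, mul_add, mul_sub, add_mul, sub_mul, mul_smul_comm,
    smul_mul_assoc, mul_assoc]
  match_scalars <;> grind

end Twisted

/-! ### Signs and the inverse metric -/

/-- The sign `(-1)^{[a][b]}` of exchanging two indices. -/
def koszulSign {N M : ℕ} (a b : Idx N M) : ℂ := sgn (deg a * deg b)

section KoszulSign

variable {N M : ℕ} {a b : Idx N M}

theorem koszulSign_comm (a b : Idx N M) : koszulSign a b = koszulSign b a := by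
  rw [koszulSign, koszulSign, mul_comm]

theorem koszulSign_mul_self (a b : Idx N M) : koszulSign a b * koszulSign a b = 1 :=
  sgn_mul_self _

theorem koszulSign_self (a : Idx N M) : koszulSign a a = sgn (deg a) := by
  rcases zmod_two_cases (deg a) with h | h <;> simp [koszulSign, h]

theorem koszulSign_congr_left (h : deg a = deg b) (c : Idx N M) :
    koszulSign a c = koszulSign b c := by
  rw [koszulSign, koszulSign, h]

theorem koszulSign_congr_right (h : deg a = deg b) (c : Idx N M) :
    koszulSign c a = koszulSign c b := by
  rw [koszulSign, koszulSign, h]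

end KoszulSign

namespace SuperMetric

variable {N M : ℕ} {ϵ : ℤˣ} (E : SuperMetric N M ϵ)

theorem eps_mul_self : E.eps * E.eps = 1 := by
  rw [eps, ← Int.cast_mul, Int.units_coe_mul_self, Int.cast_one]

/-- The sign `-ϵ (-1)^{[a][b]}` of exchanging two super-symmetrised indices. -/
def swapSign (a b : Idx N M) : ℂ := -E.eps * koszulSign a b

theorem swapSign_comm (a b : Idx N M) : E.swapSign a b = E.swapSign b a := by
  rw [swapSign, swapSign, koszulSign_comm]

theorem swapSign_mul_self (a b : Idx N M) : E.swapSign a b * E.swapSign a b = 1 := by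
  rw [swapSign, mul_mul_mul_comm, neg_mul_neg, eps_mul_self, koszulSign_mul_self, mul_one]

theorem swapSign_congr_left {a b : Idx N M} (h : deg a = deg b) (c : Idx N M) :
    E.swapSign a c = E.swapSign b c := by
  rw [swapSign, swapSign, koszulSign_congr_left h]

theorem swapSign_congr_right {a b : Idx N M} (h : deg a = deg b) (c : Idx N M) :
    E.swapSign c a = E.swapSign c b := by
  rw [swapSign, swapSign, koszulSign_congr_right h]

theorem low_eq_zero_or (a b : Idx N M) : E.low a b = 0 ∨ deg a = deg b :=
  or_iff_not_imp_right.2 (E.even a b)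

theorem up_eq_zero_or (a b : Idx N M) : E.up a b = 0 ∨ deg a = deg b :=
  or_iff_not_imp_right.2 (E.up_even a b)

theorem low_symm (a b : Idx N M) : E.low a b = E.eps * koszulSign a b * E.low b a :=
  E.symm a b

theorem low_mul_up : E.low * E.up = 1 := Matrix.mul_nonsing_inv _ E.nondeg

theorem up_mul_low : E.up * E.low = 1 := Matrix.nonsing_inv_mul _ E.nondeg

theorem sum_low_up (a c : Idx N M) :
    ∑ b, E.low a b * E.up b c = if a = c then 1 else 0 := by
  rw [← Matrix.mul_apply, low_mul_up, Matrix.one_apply]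

theorem sum_up_low (a c : Idx N M) :
    ∑ b, E.up a b * E.low b c = if a = c then 1 else 0 := by
  rw [← Matrix.mul_apply, up_mul_low, Matrix.one_apply]

theorem up_symm (a b : Idx N M) : E.up a b = E.eps * koszulSign a b * E.up b a := by
  let D : Matrix (Idx N M) (Idx N M) ℂ := Matrix.diagonal fun a => sgn (deg a)
  have hDD : D * D = 1 := by
    simp only [D, Matrix.diagonal_mul_diagonal, sgn_mul_self, Matrix.diagonal_one]
  have hlow : E.low.transpose = E.eps • (D * E.low) := by
    ext a b
    rw [Matrix.transpose_apply, Matrix.smul_apply, Matrix.diagonal_mul, smul_eq_mul, low_symm]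
    rcases E.low_eq_zero_or a b with h | h
    · rw [h, mul_zero, mul_zero, mul_zero]
    · rw [koszulSign_congr_left h.symm, koszulSign_self, mul_assoc]
  have hup : E.up.transpose = E.eps • (E.up * D) := by
    rw [up, Matrix.transpose_nonsing_inv, hlow]
    refine Matrix.inv_eq_left_inv ?_
    rw [Matrix.smul_mul, Matrix.mul_smul, smul_smul, eps_mul_self, one_smul,
      Matrix.mul_assoc, ← Matrix.mul_assoc D, hDD, Matrix.one_mul]
    exact E.up_mul_low
  have h := congrFun (congrFun hup b) a
  rw [Matrix.transpose_apply, Matrix.smul_apply, Matrix.mul_diagonal, smul_eq_mul] at h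
  rw [h]
  rcases E.up_eq_zero_or b a with h' | h'
  · rw [h', zero_mul, mul_zero, mul_zero]
  · rw [koszulSign_congr_right h', koszulSign_self, mul_assoc, mul_comm (E.up b a)]

end SuperMetric

/-! ### Super-symmetrised products -/

theorem removeNth_succ_cons {α : Type*} (x : α) {k : ℕ} (a : Fin (k + 1) → α)
    (j : Fin (k + 1)) :
    Fin.removeNth j.succ (Fin.cons x a : Fin (k + 2) → α) =
      (Fin.cons x (Fin.removeNth j a) : Fin (k + 1) → α) := by
  funext l
  refine Fin.cases ?_ (fun l => ?_) l <;> simp [Fin.removeNth_apply]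

/-- The permutation with first value `p` and the remaining values ordered as by `τ`. -/
def consPerm {k : ℕ} (p : Fin (k + 1)) (τ : Equiv.Perm (Fin k)) : Equiv.Perm (Fin (k + 1)) :=
  (finSuccEquiv' 0).trans (τ.optionCongr.trans (finSuccEquiv' p).symm)

theorem consPerm_zero {k : ℕ} (p : Fin (k + 1)) (τ : Equiv.Perm (Fin k)) :
    consPerm p τ 0 = p := by
  simp [consPerm]

theorem consPerm_succ {k : ℕ} (p : Fin (k + 1)) (τ : Equiv.Perm (Fin k)) (i : Fin k) :
    consPerm p τ i.succ = p.succAbove (τ i) := by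
  simp [consPerm, finSuccEquiv'_zero]

theorem consPerm_bijective (k : ℕ) :
    Function.Bijective fun x : Fin (k + 1) × Equiv.Perm (Fin k) => consPerm x.1 x.2 := by
  rw [Fintype.bijective_iff_injective_and_card]
  constructor
  · rintro ⟨p, τ⟩ ⟨p', τ'⟩ h
    obtain rfl : p = p' := by
      simpa only [consPerm_zero] using DFunLike.congr_fun h 0
    obtain rfl : τ = τ' := by
      ext1 i
      simpa only [consPerm_succ, Fin.succAbove_right_inj] using DFunLike.congr_fun h i.succ
    rfl
  · rw [Fintype.card_prod, Fintype.card_perm, Fintype.card_perm, Fintype.card_fin,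
      Fintype.card_fin, Nat.factorial_succ]

namespace SuperMetric

variable {N M : ℕ} {ϵ : ℤˣ} (E : SuperMetric N M ϵ)

/-- The sign of moving an index past a family of super-symmetrised indices. -/
def moveSign (e : Idx N M) {k : ℕ} (a : Fin k → Idx N M) : ℂ := ∏ i, E.swapSign e (a i)

/-- The sign of moving the index number `p` of a super-symmetrised family to the front. -/
def frontSign {k : ℕ} (a : Fin (k + 1) → Idx N M) (p : Fin (k + 1)) : ℂ :=
  ∏ l, if p.succAbove l < p then E.swapSign (a p) (a (p.succAbove l)) else 1

theorem moveSign_mul_self (e : Idx N M) {k : ℕ} (a : Fin k → Idx N M) :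
    E.moveSign e a * E.moveSign e a = 1 := by
  simp only [moveSign, ← Finset.prod_mul_distrib, swapSign_mul_self, Finset.prod_const_one]

theorem moveSign_congr {e f : Idx N M} (h : deg e = deg f) {k : ℕ} (a : Fin k → Idx N M) :
    E.moveSign e a = E.moveSign f a := by
  simp only [moveSign, E.swapSign_congr_left h]

theorem moveSign_fin_zero (e : Idx N M) (a : Fin 0 → Idx N M) : E.moveSign e a = 1 :=
  Fin.prod_univ_zero _

theorem moveSign_cons (e f : Idx N M) {k : ℕ} (a : Fin k → Idx N M) :
    E.moveSign e (Fin.cons f a : Fin (k + 1) → Idx N M) =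
      E.swapSign e f * E.moveSign e a := by
  simp [moveSign, Fin.prod_univ_succ]

theorem moveSign_snoc (e f : Idx N M) {k : ℕ} (a : Fin k → Idx N M) :
    E.moveSign e (Fin.snoc a f : Fin (k + 1) → Idx N M) =
      E.swapSign e f * E.moveSign e a := by
  simp [moveSign, Fin.prod_univ_castSucc, mul_comm]

theorem moveSign_removeNth (e : Idx N M) {k : ℕ} (a : Fin (k + 1) → Idx N M)
    (p : Fin (k + 1)) :
    E.moveSign e (Fin.removeNth p a) = E.swapSign e (a p) * E.moveSign e a := by
  rw [moveSign, moveSign, Fin.prod_univ_succAbove _ p, ← mul_assoc, swapSign_mul_self, one_mul]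
  rfl

theorem frontSign_zero {k : ℕ} (a : Fin (k + 1) → Idx N M) : E.frontSign a 0 = 1 := by
  simp [frontSign]

theorem frontSign_cons_succ (e : Idx N M) {k : ℕ} (a : Fin (k + 1) → Idx N M)
    (j : Fin (k + 1)) :
    E.frontSign (Fin.cons e a : Fin (k + 2) → Idx N M) j.succ =
      E.swapSign e (a j) * E.frontSign a j := by
  rw [frontSign, Fin.prod_univ_succ, swapSign_comm]
  simp [frontSign]

theorem c_mul_c (a b : Idx N M) :
    E.c a * E.c b = E.swapSign a b • (E.c b * E.c a) + E.up a b • (1 : E.Osc) := by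
  rw [← Algebra.algebraMap_eq_smul_one, ← c_rel, swapSign, koszulSign]
  module

/-- The product obtained from `1` by symmetrised multiplication with one generator at a time. It
turns out to be the super-symmetrised product. -/
def nestedSymProd : (k : ℕ) → (Fin k → Idx N M) → E.Osc
  | 0, _ => 1
  | k + 1, a => symMul (E.moveSign (a 0) (Fin.tail a)) (E.c (a 0)) (nestedSymProd k (Fin.tail a))

theorem nestedSymProd_cons (e : Idx N M) {k : ℕ} (a : Fin k → Idx N M) :
    E.nestedSymProd (k + 1) (Fin.cons e a) =
      symMul (E.moveSign e a) (E.c e) (E.nestedSymProd k a) := by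
  rw [nestedSymProd, Fin.cons_zero, Fin.tail_cons]

theorem up_mul_moveSign_mul_moveSign (e f : Idx N M) {k : ℕ} (a : Fin k → Idx N M) :
    E.up e f * (E.moveSign e a * E.moveSign f a) = E.up e f := by
  rcases E.up_eq_zero_or e f with h | h
  · rw [h, zero_mul]
  · rw [E.moveSign_congr h, moveSign_mul_self, mul_one]

theorem twistedComm_nestedSymProd_cons (e f : Idx N M) {k : ℕ} (a : Fin k → Idx N M) :
    twistedComm (E.moveSign e (Fin.cons f a : Fin (k + 1) → Idx N M)) (E.c e)
        (E.nestedSymProd (k + 1) (Fin.cons f a)) =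
      E.up e f • E.nestedSymProd k a +
        E.swapSign e f • symMul (E.swapSign e f * E.moveSign f a) (E.c f)
          (twistedComm (E.moveSign e a) (E.c e) (E.nestedSymProd k a)) := by
  rw [moveSign_cons, nestedSymProd_cons,
    twistedComm_symMul (E.swapSign_mul_self e f) (E.c_mul_c e f), symMul_smul_left]
  have h := E.up_mul_moveSign_mul_moveSign e f a
  congr 1
  rw [symMul_apply, one_mul, mul_one]
  match_scalars
  linear_combination (1 / 2) * h

theorem twistedComm_nestedSymProd (e : Idx N M) {k : ℕ} (a : Fin (k + 1) → Idx N M) :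
    twistedComm (E.moveSign e a) (E.c e) (E.nestedSymProd (k + 1) a) =
      ∑ j, (E.frontSign a j * E.up e (a j)) • E.nestedSymProd k (Fin.removeNth j a) := by
  induction k with
  | zero =>
    induction a using Fin.consCases with | _ f a
    rw [twistedComm_nestedSymProd_cons, Fin.sum_univ_one, frontSign_zero]
    simp [nestedSymProd, moveSign_fin_zero, twistedComm_apply]
  | succ k ih =>
    induction a using Fin.consCases with | _ f a
    rw [twistedComm_nestedSymProd_cons, ih, Fin.sum_univ_succ (n := k + 1), frontSign_zero, one_mul,
      Fin.cons_zero, Fin.removeNth_zero, Fin.tail_cons, map_sum, Finset.smul_sum]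
    refine congrArg _ (Finset.sum_congr rfl fun j _ => ?_)
    rw [frontSign_cons_succ, removeNth_succ_cons, Fin.cons_succ, nestedSymProd_cons,
      moveSign_removeNth, map_smul]
    rcases E.up_eq_zero_or e (a j) with h | h
    · simp [h]
    · rw [← E.swapSign_congr_right h f, E.swapSign_comm e f, smul_smul, mul_assoc]

theorem sum_frontSign_c_mul_nestedSymProd {k : ℕ} (a : Fin (k + 1) → Idx N M) :
    ∑ p, E.frontSign a p • (E.c (a p) * E.nestedSymProd k (Fin.removeNth p a)) =
      ((k : ℂ) + 1) • E.nestedSymProd (k + 1) a := by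
  induction k with
  | zero =>
    induction a using Fin.consCases with | _ f a
    rw [nestedSymProd_cons, Fin.sum_univ_one, frontSign_zero, moveSign_fin_zero]
    simp [nestedSymProd, symMul_one_of_commute]
  | succ k ih =>
    induction a using Fin.consCases with | _ e a
    have hterm (j : Fin (k + 1)) : (E.swapSign e (a j) * E.frontSign a j) •
          (E.c (a j) * symMul (E.moveSign e (Fin.removeNth j a)) (E.c e)
            (E.nestedSymProd k (Fin.removeNth j a))) =
        symMul (E.moveSign e a) (E.c e)
            (E.frontSign a j • (E.c (a j) * E.nestedSymProd k (Fin.removeNth j a))) -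
          (1 / 2 : ℂ) • ((E.frontSign a j * E.up e (a j)) •
            E.nestedSymProd k (Fin.removeNth j a)) := by
      rw [moveSign_removeNth, mul_comm, mul_smul,
        mul_symMul (E.swapSign_mul_self e (a j)) (E.c_mul_c e (a j)), map_smul, smul_one_mul]
      module
    simp only [Fin.sum_univ_succ (n := k + 1), frontSign_zero, frontSign_cons_succ, Fin.cons_zero,
      Fin.cons_succ, Fin.removeNth_zero, Fin.tail_cons, removeNth_succ_cons, nestedSymProd_cons,
      hterm, Finset.sum_sub_distrib, one_smul]
    rw [← map_sum, ih, ← Finset.smul_sum, ← twistedComm_nestedSymProd, map_smul,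
      twistedComm_apply, symMul_apply]
    push_cast
    module

theorem reorderSign_consPerm {k : ℕ} (a : Fin (k + 1) → Idx N M) (p : Fin (k + 1))
    (τ : Equiv.Perm (Fin k)) :
    E.reorderSign a (consPerm p τ) =
      E.frontSign a p * E.reorderSign (Fin.removeNth p a) τ := by
  rw [reorderSign, Fin.prod_univ_succ]
  congr 1
  · rw [Fin.prod_univ_succ, frontSign]
    refine Eq.trans ?_ (Equiv.prod_comp τ _)
    simp [consPerm_zero, consPerm_succ, swapSign, koszulSign]
  · simp [reorderSign, Fin.prod_univ_succ, consPerm_succ, Fin.removeNth_apply]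

theorem sum_reorderSign_prod {k : ℕ} (a : Fin k → Idx N M) :
    ∑ σ : Equiv.Perm (Fin k), E.reorderSign a σ • (List.ofFn fun i => E.c (a (σ i))).prod =
      (k.factorial : ℂ) • E.nestedSymProd k a := by
  induction k with
  | zero => simp [nestedSymProd, reorderSign]
  | succ k ih =>
    have hfront (p : Fin (k + 1)) : ∑ τ : Equiv.Perm (Fin k), E.reorderSign a (consPerm p τ) •
          (List.ofFn fun i => E.c (a (consPerm p τ i))).prod =
        (k.factorial : ℂ) • E.frontSign a p •
          (E.c (a p) * E.nestedSymProd k (Fin.removeNth p a)) := by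
      rw [smul_comm, ← mul_smul_comm, ← ih, Finset.mul_sum, Finset.smul_sum]
      refine Finset.sum_congr rfl fun τ _ => ?_
      simp only [reorderSign_consPerm, List.ofFn_succ, List.prod_cons, consPerm_zero,
        consPerm_succ, Fin.removeNth_apply, mul_smul, mul_smul_comm]
    rw [← (consPerm_bijective k).sum_comp, Fintype.sum_prod_type,
      Finset.sum_congr rfl fun p _ => hfront p, ← Finset.smul_sum,
      sum_frontSign_c_mul_nestedSymProd, smul_smul, Nat.factorial_succ]
    push_cast
    rw [mul_comm]

theorem symProd_eq_nestedSymProd {k : ℕ} (a : Fin k → Idx N M) :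
    E.symProd a = E.nestedSymProd k a := by
  rw [symProd, sum_reorderSign_prod, smul_smul,
    one_div_mul_cancel (Nat.cast_ne_zero.2 k.factorial_ne_zero), one_smul]

theorem symProd_fin_zero (a : Fin 0 → Idx N M) : E.symProd a = 1 :=
  E.symProd_eq_nestedSymProd a

theorem symProd_cons (e : Idx N M) {k : ℕ} (a : Fin k → Idx N M) :
    E.symProd (Fin.cons e a : Fin (k + 1) → Idx N M) =
      symMul (E.moveSign e a) (E.c e) (E.symProd a) := by
  simp only [symProd_eq_nestedSymProd, nestedSymProd_cons]

theorem symProd_snoc (e : Idx N M) {k : ℕ} (a : Fin k → Idx N M) :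
    E.symProd (Fin.snoc a e : Fin (k + 1) → Idx N M) =
      E.moveSign e a • symMul (E.moveSign e a) (E.c e) (E.symProd a) := by
  induction k with
  | zero =>
    have h : (Fin.snoc a e : Fin 1 → Idx N M) = Fin.cons e a := by
      funext i
      rw [Fin.fin_one_eq_zero i, Fin.cons_zero, Fin.snoc_zero]
    rw [h, symProd_cons, moveSign_fin_zero, one_smul]
  | succ k ih =>
    induction a using Fin.consCases with | _ f b
    have hw : twistedComm (E.moveSign f b * E.moveSign e b) (E.up f e • (1 : E.Osc))
        (E.symProd b) = 0 := by
      rw [twistedComm_apply, smul_one_mul, mul_smul_comm, mul_one, smul_smul, mul_comm,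
        up_mul_moveSign_mul_moveSign, sub_self]
    rw [← Fin.cons_snoc_eq_snoc_cons, symProd_cons, ih, symProd_cons, moveSign_snoc, moveSign_cons,
      map_smul, symMul_symMul (E.swapSign_mul_self f e) (E.c_mul_c f e), hw, E.swapSign_comm e f,
      smul_zero, add_zero, smul_smul, mul_comm (E.moveSign e b)]

end SuperMetric

/-! ### Three-term recurrences -/

section Recurrences

variable {𝕜 : Type*} [Field 𝕜]

/-- The coefficient `κ_k = ¼ ϵ k (ω - k + 1)` of the three-term recurrence satisfied by the
normalised invariants. -/
def recCoeff (e ω : 𝕜) (k : ℕ) : 𝕜 := 1 / 4 * e * k * (ω - k + 1)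

theorem recCoeff_zero (e ω : 𝕜) : recCoeff e ω 0 = 0 := by
  rw [recCoeff, Nat.cast_zero, mul_zero, zero_mul]

theorem recCoeff_mul_pow_succ {q : 𝕜} (hq : q * q = 1) (e ω : 𝕜) (k : ℕ) :
    recCoeff e ω k * q ^ (k + 1) = recCoeff e ω k * q ^ (k - 1) := by
  rcases k with _ | k
  · rw [recCoeff_zero, zero_mul, zero_mul]
  · rw [Nat.add_sub_cancel, pow_succ, pow_succ, mul_assoc _ q, hq, mul_one]

theorem natCast_mul_natCast_pred (k : ℕ) : (k : 𝕜) * ((k - 1 : ℕ) : 𝕜) = k * (k - 1) := by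
  rcases k with _ | k
  · rw [Nat.cast_zero, zero_mul, zero_mul]
  · rw [Nat.add_sub_cancel, Nat.cast_add_one, add_sub_cancel_right]

variable {V : Type*} [AddCommGroup V] [Module 𝕜 V] [CharZero 𝕜] {e ω : 𝕜} {σ : V →ₗ[𝕜] V}

theorem eq_smul_pred_of_recurrence {D A : ℕ → V} (h0 : D 0 = 0)
    (hD : ∀ k, D (k + 1) = σ (D k) + A k - recCoeff e ω k • D (k - 1))
    (hA : ∀ k, A (k + 1) = σ (A k) + (e / 4) • D k - recCoeff e ω k • A (k - 1)) (k : ℕ) :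
    D k = (k : 𝕜) • A (k - 1) := by
  suffices h : D k = (k : 𝕜) • A (k - 1) ∧ D (k + 1) = ((k + 1 : ℕ) : 𝕜) • A k from h.1
  induction k with
  | zero => simp [h0, hD, recCoeff_zero]
  | succ k ih =>
    have hσ : σ (A k) = A (k + 1) - (e / 4) • D k + recCoeff e ω k • A (k - 1) := by
      rw [hA]
      module
    refine ⟨ih.2, ?_⟩
    rw [hD, ih.2, map_smul, hσ, Nat.add_sub_cancel, ih.1]
    simp only [recCoeff]
    push_cast
    module

section Quadratic

variable {D A T : ℕ → V}

theorem smul_pred_succ_of_recurrence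
    (hD : ∀ k, D (k + 1) = σ (D k) + (4 * e) • A k - recCoeff e ω k • D (k - 1))
    (hT : ∀ k, A k = T k + (1 / 4 * e * k * (k - 1)) • T (k - 2)) {k : ℕ}
    (ihD : ∀ j ≤ k, D j = (4 * e * j) • T (j - 1))
    (ihσ : ∀ j < k, σ (T j) = T (j + 1) + (1 / 4 * e * j * (ω - 1 - j)) • T (j - 1)) :
    D (k + 1) = (4 * e * (k + 1)) • T k := by
  have hσ : (k : 𝕜) • σ (T (k - 1)) =
      (k : 𝕜) • (T k + (1 / 4 * e * (k - 1) * (ω - k)) • T (k - 2)) := by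
    rcases k with _ | k
    · simp
    · rw [Nat.add_sub_cancel, ihσ k (by lia), show k + 1 - 2 = k - 1 by lia]
      push_cast
      module
  have hk := natCast_mul_natCast_pred (𝕜 := 𝕜) k
  rw [hD, ihD k le_rfl, ihD (k - 1) (by lia), hT, map_smul, mul_smul _ (k : 𝕜), hσ,
    Nat.sub_sub, recCoeff]
  match_scalars
  · ring
  · linear_combination (-(e * e) * (ω - k + 1)) * hk

theorem map_of_recurrence
    (hA : ∀ k, A (k + 1) = σ (A k) + (1 / 4 : 𝕜) • D k - recCoeff e ω k • A (k - 1))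
    (hT : ∀ k, A k = T k + (1 / 4 * e * k * (k - 1)) • T (k - 2)) {k : ℕ}
    (ihD : D k = (4 * e * k) • T (k - 1))
    (ihσ : ∀ j < k, σ (T j) = T (j + 1) + (1 / 4 * e * j * (ω - 1 - j)) • T (j - 1)) :
    σ (T k) = T (k + 1) + (1 / 4 * e * k * (ω - 1 - k)) • T (k - 1) := by
  have hσ : (1 / 4 * e * k * (k - 1)) • σ (T (k - 2)) = (1 / 4 * e * k * (k - 1)) •
      (T (k - 1) + (1 / 4 * e * (k - 2) * (ω + 1 - k)) • T (k - 3)) := by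
    rcases k with _ | _ | k
    · simp
    · simp
    · rw [show k + 1 + 1 - 2 = k by lia, ihσ k (by lia), show k + 1 + 1 - 3 = k - 1 by lia,
        show k + 1 + 1 - 1 = k + 1 by lia]
      push_cast
      module
  have hA' : recCoeff e ω k • A (k - 1) = recCoeff e ω k •
      (T (k - 1) + (1 / 4 * e * (k - 1) * (k - 2)) • T (k - 3)) := by
    rcases k with _ | k
    · rw [recCoeff_zero, zero_smul, zero_smul]
    · rw [hT, Nat.add_sub_cancel, show k + 1 - 3 = k - 2 by lia]
      push_cast
      module
  have h : σ (T k) = A (k + 1) - (1 / 4 * e * k * (k - 1)) • σ (T (k - 2)) -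
      (1 / 4 : 𝕜) • D k + recCoeff e ω k • A (k - 1) := by
    rw [hA, hT k, map_add, map_smul]
    module
  rw [h, hσ, hA', hT, ihD, show k + 1 - 2 = k - 1 by lia, recCoeff]
  push_cast
  module

theorem smul_pred_and_map_of_recurrence (h0 : D 0 = 0)
    (hD : ∀ k, D (k + 1) = σ (D k) + (4 * e) • A k - recCoeff e ω k • D (k - 1))
    (hA : ∀ k, A (k + 1) = σ (A k) + (1 / 4 : 𝕜) • D k - recCoeff e ω k • A (k - 1))
    (hT : ∀ k, A k = T k + (1 / 4 * e * k * (k - 1)) • T (k - 2)) (k : ℕ) :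
    D k = (4 * e * k) • T (k - 1) ∧
      σ (T k) = T (k + 1) + (1 / 4 * e * k * (ω - 1 - k)) • T (k - 1) := by
  induction k using Nat.strong_induction_on with | _ k ih
  have hDk : D k = (4 * e * k) • T (k - 1) := by
    rcases k with _ | k
    · simp [h0]
    · rw [smul_pred_succ_of_recurrence hD hT (fun j hj => (ih j (by lia)).1)
        fun j hj => (ih j (by lia)).2, Nat.add_sub_cancel, Nat.cast_add_one]
  exact ⟨hDk, map_of_recurrence hA hT hDk fun j hj => (ih j hj).2⟩

end Quadratic

end Recurrences

section InvPoly

variable {𝕜 R : Type*} [Field 𝕜] [Ring R] [Algebra 𝕜 R]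

/-- The polynomials in `s` defined by the recurrence `J_{k+1} = s J_k - κ_k J_{k-1}`. -/
def invPoly (e ω : 𝕜) (s : R) : ℕ → R
  | 0 => 1
  | 1 => s
  | k + 2 => s * invPoly e ω s (k + 1) - recCoeff e ω (k + 1) • invPoly e ω s k

theorem invPoly_zero (e ω : 𝕜) (s : R) : invPoly e ω s 0 = 1 := rfl

theorem invPoly_one (e ω : 𝕜) (s : R) : invPoly e ω s 1 = s := rfl

theorem invPoly_succ (e ω : 𝕜) (s : R) (k : ℕ) :
    invPoly e ω s (k + 1) =
      s * invPoly e ω s k - recCoeff e ω k • invPoly e ω s (k - 1) := by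
  rcases k with _ | k
  · simp [invPoly, recCoeff_zero]
  · rfl

theorem commute_invPoly (e ω : 𝕜) {s z : R} (h : Commute z s) (k : ℕ) :
    Commute z (invPoly e ω s k) := by
  induction k using Nat.twoStepInduction with
  | zero => exact Commute.one_right z
  | one => exact h
  | more k ih ih' => exact (h.mul_right ih').sub_right (ih.smul_right _)

theorem invPoly_smul (e ω : 𝕜) {m : 𝕜} (hm : m * m = 1) (s : R) (k : ℕ) :
    invPoly e ω (m • s) k = m ^ k • invPoly e ω s k := by
  induction k using Nat.twoStepInduction with
  | zero => rw [pow_zero, one_smul, invPoly_zero, invPoly_zero]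
  | one => rw [pow_one, invPoly_one, invPoly_one]
  | more k ih ih' =>
    have hpow : m ^ (k + 2) = m ^ k := by rw [pow_add, sq, hm, mul_one]
    rw [invPoly, invPoly, ih, ih', smul_mul_smul_comm, ← pow_succ', smul_sub, hpow, smul_comm]

theorem map_invPoly {S : Type*} [Ring S] [Algebra 𝕜 S] (φ : R →ₐ[𝕜] S) (e ω : 𝕜) (s : R)
    (k : ℕ) : φ (invPoly e ω s k) = invPoly e ω (φ s) k := by
  induction k using Nat.twoStepInduction with
  | zero => exact map_one φ
  | one => rfl
  | more k ih ih' => rw [invPoly, invPoly, map_sub, map_mul, map_smul, ih, ih']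

variable [CharZero 𝕜] {e : 𝕜} {s x y : R}

theorem symMul_one_invPoly (e ω : 𝕜) (s : R) (k : ℕ) :
    symMul (1 : 𝕜) s (invPoly e ω s k) = s * invPoly e ω s k :=
  symMul_one_of_commute (commute_invPoly e ω (Commute.refl s) k)

theorem twistedComm_invPoly_succ (he : e * e = 1) (h : x * s = (-e) • (s * x) + y) (ω : 𝕜)
    (k : ℕ) :
    twistedComm ((-e) ^ (k + 1)) x (invPoly e ω s (k + 1)) =
      (-e) • symMul (-e) s (twistedComm ((-e) ^ k) x (invPoly e ω s k)) +
        symMul ((-e) ^ k) y (invPoly e ω s k) -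
        recCoeff e ω k • twistedComm ((-e) ^ (k - 1)) x (invPoly e ω s (k - 1)) := by
  have hs : twistedComm ((-e) ^ (k + 1)) x (s * invPoly e ω s k) =
      symMul ((-e) ^ k) y (invPoly e ω s k) +
        (-e) • symMul (-e) s (twistedComm ((-e) ^ k) x (invPoly e ω s k)) := by
    rw [← symMul_one_invPoly, pow_succ', twistedComm_symMul (by rw [neg_mul_neg, he]) h, mul_one,
      mul_one]
  have hκ : recCoeff e ω k • twistedComm ((-e) ^ (k + 1)) x (invPoly e ω s (k - 1)) =
      recCoeff e ω k • twistedComm ((-e) ^ (k - 1)) x (invPoly e ω s (k - 1)) := by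
    simp only [twistedComm_apply, smul_sub, smul_smul,
      recCoeff_mul_pow_succ (q := -e) (by rw [neg_mul_neg, he])]
  rw [invPoly_succ, map_sub, map_smul, hs, hκ]
  abel

theorem symMul_invPoly_succ (he : e * e = 1) (h : x * s = (-e) • (s * x) + y) (ω : 𝕜) (k : ℕ) :
    symMul ((-e) ^ (k + 1)) x (invPoly e ω s (k + 1)) =
      (-e) • symMul (-e) s (symMul ((-e) ^ k) x (invPoly e ω s k)) +
        (1 / 4 : 𝕜) • twistedComm ((-e) ^ k) y (invPoly e ω s k) -
        recCoeff e ω k • symMul ((-e) ^ (k - 1)) x (invPoly e ω s (k - 1)) := by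
  have hs : symMul ((-e) ^ (k + 1)) x (s * invPoly e ω s k) =
      (-e) • symMul (-e) s (symMul ((-e) ^ k) x (invPoly e ω s k)) +
        (1 / 4 : 𝕜) • twistedComm ((-e) ^ k) y (invPoly e ω s k) := by
    rw [← symMul_one_invPoly, pow_succ', symMul_symMul (by rw [neg_mul_neg, he]) h, mul_one,
      mul_one]
  have hκ : recCoeff e ω k • symMul ((-e) ^ (k + 1)) x (invPoly e ω s (k - 1)) =
      recCoeff e ω k • symMul ((-e) ^ (k - 1)) x (invPoly e ω s (k - 1)) := by
    rw [symMul_apply, symMul_apply, smul_comm, smul_add, smul_smul (recCoeff e ω k),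
      recCoeff_mul_pow_succ (by rw [neg_mul_neg, he]), ← smul_smul (recCoeff e ω k), ← smul_add,
      smul_comm]
  rw [invPoly_succ, map_sub, map_smul, hs, hκ]

theorem twistedComm_invPoly (he : e * e = 1) (hx : x * s = (-e) • (s * x) + y)
    (hy : y * s = (-e) • (s * y) + e • x) (ω : 𝕜) (k : ℕ) :
    twistedComm ((-e) ^ k) x (invPoly e ω s k) =
      (k : 𝕜) • symMul ((-e) ^ (k - 1)) y (invPoly e ω s (k - 1)) := by
  refine eq_smul_pred_of_recurrence (e := e) (ω := ω) (σ := (-e) • symMul (-e) s)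
    (D := fun k => twistedComm ((-e) ^ k) x (invPoly e ω s k))
    (A := fun k => symMul ((-e) ^ k) y (invPoly e ω s k)) ?_
    (twistedComm_invPoly_succ he hx ω) (fun k => ?_) k
  · simp [invPoly_zero, twistedComm_apply]
  · rw [symMul_invPoly_succ he hy, twistedComm_smul_left]
    simp only [LinearMap.smul_apply]
    module

end InvPoly

/-! ### Pairs of oscillator families -/

namespace SuperMetric

variable {N M : ℕ} {ϵ : ℤˣ} (E : SuperMetric N M ϵ)

theorem low_mul_swapSign_mul_koszulSign (a b d : Idx N M) :
    E.low a b * E.swapSign d a * koszulSign d b = -E.eps * E.low a b := by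
  rcases E.low_eq_zero_or a b with h | h
  · rw [h, zero_mul, zero_mul, mul_zero]
  · rw [← koszulSign_congr_right h, swapSign, mul_assoc, mul_assoc, koszulSign_mul_self]
    ring

theorem low_mul_koszulSign (a b : Idx N M) :
    E.low a b * koszulSign a b = E.eps * E.low b a := by
  rw [E.low_symm a b]
  linear_combination (E.eps * E.low b a) * koszulSign_mul_self a b

theorem low_mul_swapSign (a b : Idx N M) : E.low a b * E.swapSign a b = -E.low b a := by
  rw [swapSign]
  linear_combination (-E.eps) * E.low_mul_koszulSign a b - E.low b a * E.eps_mul_self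

theorem sum_sum_up_mul_low_smul {V : Type*} [AddCommGroup V] [Module ℂ V] (d : Idx N M)
    (v : Idx N M → V) : ∑ a, ∑ b, (E.up d a * E.low a b) • v b = v d := by
  rw [Finset.sum_comm]
  simp only [← Finset.sum_smul, sum_up_low, ite_smul, one_smul, zero_smul, Finset.sum_ite_eq,
    Finset.mem_univ, if_true]

theorem sum_low_mul_up : ∑ a, ∑ b, E.low a b * E.up a b = E.omega := by
  have h : ∀ a b, E.low a b * E.up a b = E.eps * sgn (deg a) * (E.low a b * E.up b a) := by
    intro a b
    rcases E.low_eq_zero_or a b with h | h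
    · rw [h, zero_mul, zero_mul, mul_zero]
    · rw [E.up_symm a b, ← koszulSign_congr_right h a, koszulSign_self]
      ring
  calc ∑ a, ∑ b, E.low a b * E.up a b = E.eps * ∑ a : Idx N M, sgn (deg a) := by
        simp only [h, ← Finset.mul_sum, sum_low_up, if_true, mul_one]
    _ = E.eps * ((N : ℂ) - M) := by
        simp only [Fintype.sum_sum_type, deg, Sum.elim_inl, Sum.elim_inr, sgn_zero, sgn_one,
          Finset.sum_const, Finset.card_univ, Fintype.card_fin, nsmul_eq_mul]
        ring

theorem neg_eps_pow_mul_self (k : ℕ) : (-E.eps) ^ k * (-E.eps) ^ k = 1 := by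
  rw [← mul_pow, neg_mul_neg, eps_mul_self, one_pow]

variable {R : Type*} [Ring R] [Algebra ℂ R]

/-- The linear map `z ↦ ε_{ab} x^a z y^b`. -/
def sandwich (x y : Idx N M → R) : R →ₗ[ℂ] R :=
  ∑ a, ∑ b, E.low a b • (LinearMap.mulRight ℂ (y b) ∘ₗ LinearMap.mulLeft ℂ (x a))

/-- The contraction `ε_{ab} x^a y^b`. -/
def contract (x y : Idx N M → R) : R := ∑ a, ∑ b, E.low a b • (x a * y b)

theorem sandwich_apply (x y : Idx N M → R) (z : R) :
    E.sandwich x y z = ∑ a, ∑ b, E.low a b • (x a * z * y b) := by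
  simp only [sandwich, LinearMap.sum_apply, LinearMap.smul_apply, LinearMap.comp_apply,
    LinearMap.mulLeft_apply, LinearMap.mulRight_apply]

theorem map_contract {S : Type*} [Ring S] [Algebra ℂ S] (φ : R →ₐ[ℂ] S) (x y : Idx N M → R) :
    φ (E.contract x y) = E.contract (fun a => φ (x a)) fun a => φ (y a) := by
  simp only [contract, map_sum, map_smul, map_mul]

theorem smul_sandwich_of_twistedComm {χ χ' : ℂ} {u v : Idx N M → R} {z z' : R}
    (h : ∀ b, twistedComm χ (u b) z = symMul χ' (v b) z') (x : Idx N M → R) :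
    χ • E.sandwich x u z = E.contract x u * z -
      (1 / 2 : ℂ) • (E.contract x v * z' + χ' • E.sandwich x v z') := by
  simp only [sandwich_apply, contract, Finset.sum_mul, Finset.smul_sum, smul_add,
    ← Finset.sum_add_distrib, ← Finset.sum_sub_distrib]
  refine Finset.sum_congr rfl fun a _ => Finset.sum_congr rfl fun b _ => ?_
  have hb : χ • (z * u b) = u b * z - symMul χ' (v b) z' := by
    rw [← h, twistedComm_apply, sub_sub_cancel]
  rw [smul_comm χ, mul_assoc, ← mul_smul_comm, hb, symMul_apply]
  simp only [mul_sub, mul_add, mul_smul_comm, smul_mul_assoc, mul_assoc]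
  module

/-- A family of elements satisfying the defining relations of the super-oscillators. -/
def IsOsc (x : Idx N M → R) : Prop :=
  ∀ a b, x a * x b = E.swapSign a b • (x b * x a) + E.up a b • (1 : R)

theorem IsOsc.contract_self {E : SuperMetric N M ϵ} {x : Idx N M → R} (h : E.IsOsc x) :
    E.contract x x = (E.omega / 2) • (1 : R) := by
  have hterm : ∀ a b, E.low a b • (x a * x b) =
      (E.low a b * E.up a b) • (1 : R) - E.low b a • (x b * x a) := by
    intro a b
    rw [h, smul_add, smul_smul, low_mul_swapSign]
    module
  have hself : E.contract x x = E.omega • (1 : R) - E.contract x x :=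
    calc E.contract x x = ∑ a, ∑ b, ((E.low a b * E.up a b) • (1 : R) - E.low b a • (x b * x a)) :=
          Finset.sum_congr rfl fun a _ => Finset.sum_congr rfl fun b _ => hterm a b
      _ = E.omega • (1 : R) - E.contract x x := by
          simp only [Finset.sum_sub_distrib, ← Finset.sum_smul, sum_low_mul_up]
          rw [Finset.sum_comm (f := fun a b => E.low b a • (x b * x a)), contract]
  rw [eq_sub_iff_add_eq, ← two_smul ℂ] at hself
  rw [div_eq_inv_mul, mul_smul, ← hself, smul_smul]
  norm_num

/-- Two families of super-oscillators which supercommute with each other. -/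
structure IsOscPair (x y : Idx N M → R) : Prop where
  left : E.IsOsc x
  right : E.IsOsc y
  cross : ∀ a b, y b * x a = koszulSign a b • (x a * y b)

namespace IsOscPair

variable {E} {x y : Idx N M → R}

theorem map {S : Type*} [Ring S] [Algebra ℂ S] (h : E.IsOscPair x y) (φ : R →ₐ[ℂ] S) :
    E.IsOscPair (fun a => φ (x a)) fun a => φ (y a) where
  left a b := by
    simpa only [map_add, map_mul, map_smul, map_one] using congrArg φ (h.left a b)
  right a b := by
    simpa only [map_add, map_mul, map_smul, map_one] using congrArg φ (h.right a b)
  cross a b := by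
    simpa only [map_mul, map_smul] using congrArg φ (h.cross a b)

theorem left_mul_right (h : E.IsOscPair x y) (a b : Idx N M) :
    x a * y b = koszulSign a b • (y b * x a) := by
  rw [h.cross, smul_smul, koszulSign_mul_self, one_smul]

theorem symm (h : E.IsOscPair x y) : E.IsOscPair y x where
  left := h.right
  right := h.left
  cross a b := by rw [h.left_mul_right, koszulSign_comm]

theorem contract_swap (h : E.IsOscPair x y) : E.contract y x = E.eps • E.contract x y := by
  rw [contract, Finset.sum_comm, contract, Finset.smul_sum]
  refine Finset.sum_congr rfl fun a _ => ?_
  rw [Finset.smul_sum]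
  refine Finset.sum_congr rfl fun b _ => ?_
  rw [h.cross, smul_smul, smul_smul, koszulSign_comm, low_mul_koszulSign]

theorem left_mul_contract (h : E.IsOscPair x y) (d : Idx N M) :
    x d * E.contract x y = (-E.eps) • (E.contract x y * x d) + y d := by
  have hterm : ∀ a b, x d * E.low a b • (x a * y b) =
      (-E.eps) • (E.low a b • (x a * y b) * x d) + (E.up d a * E.low a b) • y b := by
    intro a b
    rw [mul_smul_comm, ← mul_assoc, h.left, add_mul, smul_mul_assoc, smul_mul_assoc, one_mul,
      mul_assoc, h.left_mul_right, mul_smul_comm, smul_mul_assoc, ← mul_assoc, smul_add, smul_smul,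
      smul_smul, smul_smul, low_mul_swapSign_mul_koszulSign]
    module
  simp only [contract, Finset.mul_sum, hterm, Finset.sum_add_distrib, Finset.sum_mul,
    Finset.smul_sum, sum_sum_up_mul_low_smul]

theorem right_mul_contract (h : E.IsOscPair x y) (d : Idx N M) :
    y d * E.contract x y = (-E.eps) • (E.contract x y * y d) + E.eps • x d := by
  have hsymm : E.contract x y = E.eps • E.contract y x := h.symm.contract_swap
  rw [hsymm, mul_smul_comm, h.symm.left_mul_contract, smul_add, smul_mul_assoc,
    smul_comm E.eps (-E.eps)]

theorem twistedComm_left_invPoly (h : E.IsOscPair x y) (k : ℕ) (b : Idx N M) :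
    twistedComm ((-E.eps) ^ k) (x b) (invPoly E.eps E.omega (E.contract x y) k) =
      (k : ℂ) • symMul ((-E.eps) ^ (k - 1)) (y b)
        (invPoly E.eps E.omega (E.contract x y) (k - 1)) :=
  twistedComm_invPoly E.eps_mul_self (h.left_mul_contract b) (h.right_mul_contract b) E.omega k

theorem invPoly_contract_swap (h : E.IsOscPair x y) (k : ℕ) :
    invPoly E.eps E.omega (E.contract y x) k =
      E.eps ^ k • invPoly E.eps E.omega (E.contract x y) k := by
  rw [h.contract_swap, invPoly_smul E.eps E.omega E.eps_mul_self]

theorem twistedComm_right_invPoly (h : E.IsOscPair x y) (k : ℕ) (b : Idx N M) :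
    twistedComm ((-E.eps) ^ k) (y b) (invPoly E.eps E.omega (E.contract x y) k) =
      (k * E.eps) • symMul ((-E.eps) ^ (k - 1)) (x b)
        (invPoly E.eps E.omega (E.contract x y) (k - 1)) := by
  rw [mul_smul, ← symMul_smul_left]
  refine twistedComm_invPoly E.eps_mul_self (h.right_mul_contract b) ?_ E.omega k
  rw [smul_mul_assoc, h.left_mul_contract, mul_smul_comm, smul_add, smul_comm]

theorem smul_sandwich_invPoly (h : E.IsOscPair x y) (k : ℕ) :
    (-E.eps) ^ k • E.sandwich x y (invPoly E.eps E.omega (E.contract x y) k) =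
        invPoly E.eps E.omega (E.contract x y) (k + 1) -
          recCoeff E.eps E.omega k • invPoly E.eps E.omega (E.contract x y) (k - 1) ∧
      (-E.eps) ^ k • E.sandwich x x (invPoly E.eps E.omega (E.contract x y) k) =
        (E.omega / 2 - k) • invPoly E.eps E.omega (E.contract x y) k := by
  set s := E.contract x y with hs
  set J := invPoly E.eps E.omega s with hJ
  have hy : ∀ k, _ := fun k => E.smul_sandwich_of_twistedComm
    (fun b => (h.twistedComm_right_invPoly k b).trans (map_smul _ _ _).symm) x
  have hx : ∀ k, _ := fun k => E.smul_sandwich_of_twistedComm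
    (fun b => (h.twistedComm_left_invPoly k b).trans (map_smul _ _ _).symm) x
  simp only [← hs, ← hJ, map_smul, h.left.contract_self, smul_mul_assoc, one_mul] at hx hy
  have hmul : ∀ k, s * J k = J (k + 1) + recCoeff E.eps E.omega k • J (k - 1) := fun k => by
    rw [hJ, invPoly_succ, sub_add_cancel]
  rw [hy, hx]
  induction k with
  | zero =>
    simp only [hmul, recCoeff_zero, Nat.cast_zero, zero_mul, zero_smul, mul_zero, smul_zero,
      add_zero, sub_zero, true_and]
  | succ k ih =>
    rw [← hy, ← hx] at ih
    simp only [Nat.add_sub_cancel, smul_comm ((-E.eps) ^ k), ih, hmul, mul_smul_comm, recCoeff]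
    push_cast
    constructor <;> module

theorem smul_sandwich_swap_invPoly (h : E.IsOscPair x y) (k : ℕ) :
    (-E.eps) ^ k • E.sandwich y x (invPoly E.eps E.omega (E.contract x y) k) =
      E.eps • (invPoly E.eps E.omega (E.contract x y) (k + 1) -
        recCoeff E.eps E.omega k • invPoly E.eps E.omega (E.contract x y) (k - 1)) := by
  have hsymm := (h.symm.smul_sandwich_invPoly k).1
  have hκ := recCoeff_mul_pow_succ E.eps_mul_self E.eps E.omega k
  have hpow : E.eps ^ k * E.eps ^ k = 1 := by rw [← mul_pow, eps_mul_self, one_pow]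
  simp only [h.invPoly_contract_swap, map_smul, smul_smul, ← hκ] at hsymm
  have hmul := congrArg (E.eps ^ k • ·) hsymm
  simp only [smul_sub, smul_smul] at hmul ⊢
  rw [mul_left_comm, hpow, mul_one] at hmul
  rw [hmul]
  match_scalars
  · linear_combination E.eps * hpow
  · linear_combination (-recCoeff E.eps E.omega k * E.eps) * hpow

end IsOscPair

/-! ### Twice symmetrised multiplication of the invariants -/

/-- The polynomial `J_k(s)` multiplied from both sides by two super-oscillators in such a way that
the result is super-symmetrised in all of its indices. -/
def symInvPoly₂ (x : Idx N M → R) (s : R) (k : ℕ) (a b : Idx N M) : R :=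
  symMul (E.swapSign a b * (-E.eps) ^ k) (x a)
    (symMul ((-E.eps) ^ k) (x b) (invPoly E.eps E.omega s k))

theorem map_symInvPoly₂ {S : Type*} [Ring S] [Algebra ℂ S] (φ : R →ₐ[ℂ] S) (x : Idx N M → R)
    (s : R) (k : ℕ) (a b : Idx N M) :
    φ (E.symInvPoly₂ x s k a b) = E.symInvPoly₂ (fun a => φ (x a)) (φ s) k a b := by
  rw [symInvPoly₂, symInvPoly₂, map_symMul, map_symMul, map_invPoly]

theorem symInvPoly₂_smul {m : ℂ} (hm : m * m = 1) (x : Idx N M → R) (s : R) (k : ℕ)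
    (a b : Idx N M) : E.symInvPoly₂ x (m • s) k a b = m ^ k • E.symInvPoly₂ x s k a b := by
  rw [symInvPoly₂, invPoly_smul E.eps E.omega hm, map_smul, map_smul, symInvPoly₂]

namespace IsOscPair

variable {E} {x y : Idx N M → R}

theorem twistedComm_twistedComm_invPoly (h : E.IsOscPair x y) (k : ℕ) (a b : Idx N M) :
    twistedComm (E.swapSign a b * (-E.eps) ^ k) (x a)
        (twistedComm ((-E.eps) ^ k) (x b) (invPoly E.eps E.omega (E.contract x y) k)) =
      (k * (k - 1) * koszulSign a b : ℂ) • E.symInvPoly₂ y (E.contract x y) (k - 2) b a := by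
  rw [h.twistedComm_left_invPoly, map_smul]
  rcases k with _ | k
  · simp
  have hsign : E.swapSign a b * (-E.eps) ^ (k + 1) = koszulSign a b * (-E.eps) ^ k := by
    rw [swapSign, pow_succ]
    linear_combination (koszulSign a b * (-E.eps) ^ k) * E.eps_mul_self
  have hcross : x a * y b = koszulSign a b • (y b * x a) + 0 := by rw [h.left_mul_right, add_zero]
  rw [hsign, Nat.add_sub_cancel, twistedComm_symMul (koszulSign_mul_self a b) hcross,
    h.twistedComm_left_invPoly, map_smul]
  rcases k with _ | k
  · simp [symMul_apply]
  have hsign' : koszulSign a b * (-E.eps) ^ (k + 1) = E.swapSign b a * (-E.eps) ^ k := by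
    rw [swapSign, pow_succ, koszulSign_comm b a]
    ring
  rw [hsign', Nat.add_sub_cancel, show k + 1 + 1 - 2 = k from rfl, symInvPoly₂, symMul_apply _ 0,
    zero_mul, mul_zero]
  push_cast
  module

theorem mul_invPoly_add_invPoly_mul (h : E.IsOscPair x y) (k : ℕ) (a b : Idx N M) :
    x a * x b * invPoly E.eps E.omega (E.contract x y) k +
        E.swapSign a b • (invPoly E.eps E.omega (E.contract x y) k * (x b * x a)) =
      (2 : ℂ) • E.symInvPoly₂ x (E.contract x y) k a b +
        (1 / 2 * k * (k - 1) * koszulSign a b : ℂ) •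
          E.symInvPoly₂ y (E.contract x y) (k - 2) b a := by
  rw [mul_mul_add_smul_mul_mul (E.neg_eps_pow_mul_self k), h.twistedComm_twistedComm_invPoly,
    ← symInvPoly₂]
  module

end IsOscPair

end SuperMetric

/-! ### Generators of the orthosymplectic superalgebra -/

/-- The sign of exchanging two elements of degrees `[a]+[b]` and `[c]+[d]`. -/
def pairSign {N M : ℕ} (a b c d : Idx N M) : ℂ := sgn ((deg a + deg b) * (deg c + deg d))

section PairSign

variable {N M : ℕ} (a b c d : Idx N M)

theorem pairSign_eq :
    pairSign a b c d = koszulSign a c * koszulSign a d * (koszulSign b c * koszulSign b d) := by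
  simp only [pairSign, koszulSign, add_mul, mul_add, sgn_add]
  ring

theorem pairSign_comm : pairSign a b c d = pairSign c d a b := by
  rw [pairSign, pairSign, mul_comm]

theorem pairSign_swap_left : pairSign a b c d = pairSign b a c d := by
  rw [pairSign, pairSign, add_comm (deg a)]

theorem pairSign_of_deg_eq {a b : Idx N M} (h : deg a = deg b) : pairSign a b c d = 1 := by
  rw [pairSign, h, CharTwo.add_self_eq_zero, zero_mul, sgn_zero]

end PairSign

theorem sum_rotate {V ι : Type*} [AddCommMonoid V] [Fintype ι] (f : ι → ι → ι → V) :
    ∑ b, ∑ c, ∑ d, f c d b = ∑ b, ∑ c, ∑ d, f b c d := by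
  rw [Finset.sum_comm]
  exact Finset.sum_congr rfl fun b _ => Finset.sum_comm

theorem sum_add_swap {V ι : Type*} [AddCommGroup V] [Module ℂ V] [Fintype ι] (f : ι → ι → V) :
    ∑ a, ∑ b, (f a b + f b a) = (2 : ℂ) • ∑ a, ∑ b, f a b := by
  simp only [Finset.sum_add_distrib]
  rw [Finset.sum_comm (f := fun a b => f b a), two_smul]

theorem sum_eq_zero_of_swap {V ι : Type*} [AddCommGroup V] [Module ℂ V] [Fintype ι]
    {f : ι → ι → V} (h : ∀ a b, f a b + f b a = 0) : ∑ a, ∑ b, f a b = 0 := by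
  have hsum := sum_add_swap f
  simp only [h, Finset.sum_const_zero] at hsum
  exact (smul_eq_zero.1 hsum.symm).resolve_left two_ne_zero

theorem sum_eq_zero_of_rotate {V ι : Type*} [AddCommGroup V] [Module ℂ V] [Fintype ι]
    {f : ι → ι → ι → V} (h : ∀ b c d, f b c d + f c d b + f d b c = 0) :
    ∑ b, ∑ c, ∑ d, f b c d = 0 := by
  have hsum : (3 : ℂ) • ∑ b, ∑ c, ∑ d, f b c d = ∑ b, ∑ c, ∑ d, (f b c d + f c d b + f d b c) := by
    simp only [Finset.sum_add_distrib]
    rw [sum_rotate f, ← sum_rotate fun b c d => f d b c]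
    module
  simp only [h, Finset.sum_const_zero] at hsum
  exact (smul_eq_zero.1 hsum).resolve_left three_ne_zero

namespace SuperMetric

variable {N M : ℕ} {ϵ : ℤˣ} (E : SuperMetric N M ϵ)

variable {R : Type*} [Ring R] [Algebra ℂ R]

theorem up_mul_swapSign (a b : Idx N M) : E.up a b * E.swapSign a b = -E.up b a := by
  rw [E.up_symm a b, swapSign]
  linear_combination (-E.eps * E.eps * E.up b a) * koszulSign_mul_self a b -
    E.up b a * E.eps_mul_self

theorem sum_sum_low_mul_up_smul {V : Type*} [AddCommGroup V] [Module ℂ V] (d : Idx N M)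
    (v : Idx N M → V) : ∑ a, ∑ b, (E.low d a * E.up a b) • v b = v d := by
  rw [Finset.sum_comm]
  simp only [← Finset.sum_smul, sum_low_up, ite_smul, one_smul, zero_smul, Finset.sum_ite_eq,
    Finset.mem_univ, if_true]

/-- The supercommutator of `g_{ab}` and `g_{cd}`. -/
def superComm (g : Idx N M → Idx N M → R) (a b c d : Idx N M) : R :=
  g a b * g c d - pairSign a b c d • (g c d * g a b)

/-- The generators of `osp`, with the index-dependent signs absorbed, together with the
constraint on the symmetrised super-anticommutators. -/
structure IsOspFamily (g : Idx N M → Idx N M → R) : Prop where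
  symm : ∀ a b, g a b = E.swapSign a b • g b a
  comm : ∀ a b c d, superComm g a b c d = E.eps • (
    E.low c b • g a d + (E.swapSign a b * E.low c a) • g b d +
      E.swapSign c d • (E.low d b • g a c + (E.swapSign a b * E.low d a) • g b c))
  cyclic : ∀ a b c d, superAnticomm g b c d a +
    (E.swapSign d b * E.swapSign d c) • superAnticomm g d b c a +
    (E.swapSign b c * E.swapSign b d) • superAnticomm g c d b a = 0

/-- The family `w^a` supercommutes with the elements `g_{bc}` of degree `[b]+[c]`. -/
def SuperCommutes (g : Idx N M → Idx N M → R) (w : Idx N M → R) : Prop :=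
  ∀ a b c, g b c * w a = (koszulSign a b * koszulSign a c) • (w a * g b c)

/-- The contraction `w^b g_{ba}`. -/
def row (w : Idx N M → R) (g : Idx N M → Idx N M → R) (a : Idx N M) : R := ∑ b, w b * g b a

/-- The bilinear contraction `u^a v^b g_{ba}`. -/
def bil (u v : Idx N M → R) (g : Idx N M → Idx N M → R) : R := ∑ a, ∑ b, u a * v b * g b a

/-- The super-symmetrised product of two super-oscillators. -/
def symPair (w : Idx N M → R) (a b : Idx N M) : R := w a * w b - (1 / 2 * E.up a b) • (1 : R)

/-- The super-symmetrised product of three super-oscillators. -/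
def symTriple (w : Idx N M → R) (b c d : Idx N M) : R :=
  w b * E.symPair w c d -
    (1 / 2 : ℂ) • (E.up b c • w d + (E.swapSign b c * E.up b d) • w c)

variable {E} {g : Idx N M → Idx N M → R} {w : Idx N M → R}

theorem IsOsc.symPair_swap (hw : E.IsOsc w) (a b : Idx N M) :
    E.symPair w a b = E.swapSign a b • E.symPair w b a := by
  have hup : E.up b a * E.swapSign a b = -E.up a b := by rw [swapSign_comm, up_mul_swapSign]
  rw [symPair, symPair, hw a b]
  match_scalars
  · ring
  · linear_combination (1 / 2 : ℂ) * hup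

theorem IsOsc.symTriple_swap_right (hw : E.IsOsc w) (b c d : Idx N M) :
    E.symTriple w b d c = E.swapSign c d • E.symTriple w b c d := by
  have hbc : E.swapSign b d * E.up b c = E.swapSign c d * E.up b c := by
    rcases E.up_eq_zero_or b c with h | h
    · rw [h, mul_zero, mul_zero]
    · rw [E.swapSign_congr_left h]
  have hbd : E.swapSign b c * E.up b d = E.swapSign c d * E.up b d := by
    rcases E.up_eq_zero_or b d with h | h
    · rw [h, mul_zero, mul_zero]
    · rw [E.swapSign_congr_left h, E.swapSign_comm]
  rw [symTriple, symTriple, hw.symPair_swap d c, E.swapSign_comm d c, mul_smul_comm, hbc, hbd]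
  match_scalars
  · ring
  · linear_combination (E.up b d / 2) * E.swapSign_mul_self c d
  · ring

theorem IsOsc.symTriple_swap_left (hw : E.IsOsc w) (b c d : Idx N M) :
    E.symTriple w c b d = E.swapSign b c • E.symTriple w b c d := by
  have hup : E.up b c * E.swapSign b c = -E.up c b := E.up_mul_swapSign b c
  rw [symTriple, symTriple, symPair, symPair, mul_sub, mul_sub, ← mul_assoc, ← mul_assoc, hw c b,
    add_mul, smul_mul_assoc, smul_mul_assoc, one_mul, mul_smul_comm, mul_smul_comm, mul_one,
    mul_one, E.swapSign_comm c b]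
  match_scalars
  · ring
  · linear_combination (1 / 2 : ℂ) * hup
  · linear_combination (E.up b d / 2) * E.swapSign_mul_self b c
  · ring

theorem IsOsc.smul_symPair_mul (hw : E.IsOsc w) (b c d : Idx N M) :
    (koszulSign b c * koszulSign b d) • (E.symPair w c d * w b) = E.symTriple w b c d -
      (1 / 2 : ℂ) • (E.up b c • w d + (E.swapSign b c * E.up b d) • w c) := by
  have hsign : koszulSign b c * koszulSign b d = E.swapSign b c * E.swapSign b d := by
    rw [swapSign, swapSign]
    linear_combination (-koszulSign b c * koszulSign b d) * E.eps_mul_self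
  have hcd : E.swapSign b c * E.swapSign b d * E.up c d = E.up c d := by
    rcases E.up_eq_zero_or c d with h | h
    · rw [h, mul_zero]
    · rw [E.swapSign_congr_right h, swapSign_mul_self, one_mul]
  have hmove : w b * (w c * w d) = (E.swapSign b c * E.swapSign b d) • (w c * w d * w b) +
      (E.swapSign b c * E.up b d) • w c + E.up b c • w d := by
    rw [← mul_assoc, hw b c, add_mul, smul_mul_assoc, smul_mul_assoc, one_mul, mul_assoc, hw b d,
      mul_add, mul_smul_comm, mul_smul_comm, mul_one, smul_add, smul_smul, smul_smul, mul_assoc]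
  rw [hsign, symTriple, symPair, sub_mul, mul_sub, hmove, smul_mul_assoc, mul_smul_comm, one_mul,
    mul_one]
  match_scalars
  · ring
  · linear_combination (-1 / 2 : ℂ) * hcd
  · ring
  · ring

theorem SuperCommutes.mul_mul (hgw : SuperCommutes g w) (a b c d : Idx N M) :
    g a b * (w c * w d) = pairSign a b c d • (w c * w d * g a b) := by
  rw [← mul_assoc, hgw, smul_mul_assoc, mul_assoc, hgw, mul_smul_comm, smul_smul, mul_assoc,
    mul_assoc, pairSign_comm, pairSign_eq, mul_assoc]

theorem SuperCommutes.mul_symPair (hgw : SuperCommutes g w) (a b c d : Idx N M) :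
    g a b * E.symPair w c d = pairSign a b c d • (E.symPair w c d * g a b) := by
  have hcd : E.up c d * pairSign a b c d = E.up c d := by
    rcases E.up_eq_zero_or c d with h | h
    · rw [h, zero_mul]
    · rw [pairSign_comm, pairSign_of_deg_eq _ _ h, mul_one]
  rw [symPair, mul_sub, sub_mul, hgw.mul_mul, mul_smul_comm, smul_mul_assoc, mul_one, one_mul]
  match_scalars
  · ring
  · linear_combination (1 / 2 : ℂ) * hcd

namespace IsOspFamily

theorem map {S : Type*} [Ring S] [Algebra ℂ S] (hg : E.IsOspFamily g) (φ : R →ₐ[ℂ] S) :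
    E.IsOspFamily fun a b => φ (g a b) where
  symm a b := by
    rw [← map_smul, ← hg.symm]
  comm a b c d := by
    simpa only [superComm, map_sub, map_mul, map_smul, map_add] using congrArg φ (hg.comm a b c d)
  cyclic a b c d := by
    simpa only [superAnticomm, map_add, map_mul, map_smul, map_zero] using
      congrArg φ (hg.cyclic a b c d)

theorem trace (hg : E.IsOspFamily g) : ∑ c, ∑ d, E.up c d • g d c = 0 := by
  refine sum_eq_zero_of_swap fun c d => ?_
  rw [hg.symm d c, E.swapSign_comm d c, smul_smul, up_mul_swapSign]
  module

theorem bil_self (hg : E.IsOspFamily g) (w : Idx N M → R) :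
    bil w w g = ∑ a, ∑ b, E.symPair w a b * g b a := by
  have htrace : ∑ a, ∑ b, (1 / 2 * E.up a b) • g b a = 0 := by
    simp only [mul_smul, ← Finset.smul_sum, hg.trace, smul_zero]
  simp only [symPair, sub_mul, smul_mul_assoc, one_mul, Finset.sum_sub_distrib, htrace, sub_zero,
    bil]

theorem superComm_swap_left (hg : E.IsOspFamily g) (a b c d : Idx N M) :
    superComm g a b c d = E.swapSign a b • superComm g b a c d := by
  rw [superComm, superComm, hg.symm a b, pairSign_swap_left, smul_mul_assoc, mul_smul_comm]
  module

theorem up_smul_superComm (hg : E.IsOspFamily g) (a b c d : Idx N M) :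
    E.up b c • superComm g d c b a = E.eps • ((E.low b c * E.up b c) • g d a -
      (E.low d b * E.up b c) • g c a - (E.up b c * E.low c a) • g d b +
      E.low a d • E.up b c • g c b) := by
  rcases E.up_eq_zero_or b c with h | hbc
  · simp only [h, mul_zero, zero_mul, zero_smul, smul_zero, sub_zero, add_zero]
  have hdb : E.swapSign d c * E.low b d = -E.low d b := by
    rw [← E.swapSign_congr_right hbc, E.swapSign_comm, mul_comm, low_mul_swapSign]
  have hca : E.swapSign b a * E.low a c = -E.low c a := by
    rw [E.swapSign_congr_left hbc, E.swapSign_comm, mul_comm, low_mul_swapSign]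
  have hda : E.swapSign b a * (E.swapSign d c * E.low a d) = E.low a d := by
    rcases E.low_eq_zero_or a d with h | h
    · rw [h, mul_zero, mul_zero]
    · rw [E.swapSign_congr_left hbc, E.swapSign_congr_right h, E.swapSign_comm d c, ← mul_assoc,
        swapSign_mul_self, one_mul]
  rw [hg.comm]
  match_scalars
  · ring
  · linear_combination E.up b c * E.eps * hdb
  · linear_combination E.up b c * E.eps * hca
  · linear_combination E.up b c * E.eps * hda

theorem sum_up_smul_superComm (hg : E.IsOspFamily g) (a d : Idx N M) :
    ∑ b, ∑ c, E.up b c • superComm g d c b a = (E.eps * (E.omega - 2)) • g d a := by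
  have hlast : ∑ b, ∑ c, (E.up b c * E.low c a) • g d b = g d a := by
    simp only [← Finset.sum_smul, sum_up_low, ite_smul, one_smul, zero_smul, Finset.sum_ite_eq',
      Finset.mem_univ, if_true]
  simp only [hg.up_smul_superComm, ← Finset.smul_sum, Finset.sum_add_distrib,
    Finset.sum_sub_distrib, hg.trace, sum_sum_low_mul_up_smul, hlast]
  simp only [← Finset.sum_smul, sum_low_mul_up]
  module

theorem sum_symTriple_mul (hg : E.IsOspFamily g) (hw : E.IsOsc w) (a : Idx N M) :
    ∑ b, ∑ c, ∑ d, E.symTriple w b c d * superAnticomm g d c b a = 0 := by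
  refine sum_eq_zero_of_rotate fun b c d => ?_
  have h := congrArg (E.symTriple w b c d * ·) (hg.cyclic a d c b)
  simp only [mul_zero] at h
  rw [← h, hw.symTriple_swap_right c b d, hw.symTriple_swap_left b c d,
    hw.symTriple_swap_left b d c, hw.symTriple_swap_right b c d, E.swapSign_comm d b,
    E.swapSign_comm d c]
  simp only [mul_add, mul_smul_comm, smul_mul_assoc]
  module

end IsOspFamily

end SuperMetric

/-! ### Commutators of the quadratic invariants -/

theorem mul_sub_mul_eq_of_commutators {𝕜 R : Type*} [Field 𝕜] [CharZero 𝕜] [Ring R] [Algebra 𝕜 R]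
    {s X Z m : R} {e : 𝕜} (hX : s * X - X * s = (-2 : 𝕜) • m) (hZ : s * Z - Z * s = (2 : 𝕜) • m)
    (hm : s * m - m * s = e • (Z - X)) (hXZ : X * Z - Z * X = (2 : 𝕜) • (s * m + m * s))
    (hac : m * X + X * m = m * Z + Z * m) :
    s * (X * Z) - X * Z * s = e • (s * (Z - X) + (Z - X) * s) := by
  have hleibniz : s * (X * Z) - X * Z * s = (2 : 𝕜) • (X * m - m * Z) :=
    calc s * (X * Z) - X * Z * s = (s * X - X * s) * Z + X * (s * Z - Z * s) := by noncomm_ring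
      _ = (2 : 𝕜) • (X * m - m * Z) := by
        rw [hX, hZ, smul_mul_assoc, mul_smul_comm]
        module
  have hjacobi : (2 : 𝕜) • (s * (s * m - m * s) + (s * m - m * s) * s) =
      (2 : 𝕜) • (X * m - m * X - m * Z + Z * m) :=
    calc (2 : 𝕜) • (s * (s * m - m * s) + (s * m - m * s) * s)
        = s * ((2 : 𝕜) • (s * m + m * s)) - ((2 : 𝕜) • (s * m + m * s)) * s := by
          rw [mul_smul_comm, smul_mul_assoc, ← smul_sub]
          congr 1
          noncomm_ring
      _ = (s * X - X * s) * Z - Z * (s * X - X * s) +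
          (X * (s * Z - Z * s) - (s * Z - Z * s) * X) := by
          rw [← hXZ]
          noncomm_ring
      _ = (2 : 𝕜) • (X * m - m * X - m * Z + Z * m) := by
          rw [hX, hZ]
          simp only [smul_mul_assoc, mul_smul_comm]
          module
  have hjacobi' := smul_right_injective R (two_ne_zero (α := 𝕜)) hjacobi
  rw [hm, mul_smul_comm, smul_mul_assoc, ← smul_add] at hjacobi'
  rw [hleibniz, hjacobi']
  linear_combination (norm := module) hac

theorem sum_add_swap_swap {V ι : Type*} [AddCommGroup V] [Module ℂ V] [Fintype ι]
    (f : ι → ι → ι → ι → V) :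
    ∑ a, ∑ b, ∑ c, ∑ d, (f a b c d + f a b d c + (f b a c d + f b a d c)) =
      (4 : ℂ) • ∑ a, ∑ b, ∑ c, ∑ d, f a b c d := by
  have hswap : ∀ a b, ∑ c, ∑ d, (f a b c d + f a b d c + (f b a c d + f b a d c)) =
      (2 : ℂ) • (∑ c, ∑ d, f a b c d + ∑ c, ∑ d, f b a c d) := by
    intro a b
    rw [smul_add, ← sum_add_swap (f a b), ← sum_add_swap (f b a)]
    simp only [Finset.sum_add_distrib]
  simp only [hswap, ← Finset.smul_sum, sum_add_swap fun a b => ∑ c, ∑ d, f a b c d]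
  module

namespace SuperMetric

variable {N M : ℕ} {ϵ : ℤˣ} {E : SuperMetric N M ϵ} {R : Type*} [Ring R] [Algebra ℂ R]
  {g : Idx N M → Idx N M → R}

section Row

variable {w : Idx N M → R}

theorem row_mul_bil_term (hw : E.IsOsc w) (hgw : SuperCommutes g w) (a b c d : Idx N M) :
    w b * g b a * (E.symPair w c d * g d c) + E.symPair w c d * g d c * (w b * g b a) =
      E.symTriple w b c d * superAnticomm g d c b a -
        ((1 / 2 : ℂ) • (E.up b c • w d + (E.swapSign b c * E.up b d) • w c)) *
          superComm g d c b a := by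
  have hleft : w b * g b a * (E.symPair w c d * g d c) =
      w b * E.symPair w c d * (pairSign d c b a • (g b a * g d c)) := by
    rw [mul_assoc, ← mul_assoc (g b a), hgw.mul_symPair, pairSign_comm, pairSign_swap_left]
    simp only [smul_mul_assoc, mul_smul_comm, mul_assoc]
  have hright : E.symPair w c d * g d c * (w b * g b a) =
      (koszulSign b c * koszulSign b d) • (E.symPair w c d * w b) * (g d c * g b a) := by
    rw [mul_assoc, ← mul_assoc (g d c), hgw, mul_comm (koszulSign b d)]
    simp only [smul_mul_assoc, mul_smul_comm, mul_assoc]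
  have htriple : w b * E.symPair w c d = E.symTriple w b c d +
      (1 / 2 : ℂ) • (E.up b c • w d + (E.swapSign b c * E.up b d) • w c) := by
    rw [symTriple, sub_add_cancel]
  rw [hleft, hright, hw.smul_symPair_mul, htriple, superAnticomm, superComm, ← pairSign]
  simp only [add_mul, sub_mul, mul_add, mul_sub, mul_smul_comm]
  module

theorem IsOspFamily.sum_up_smul_mul_superComm (hg : E.IsOspFamily g) (w : Idx N M → R)
    (a : Idx N M) : ∑ b, ∑ c, ∑ d, E.up b c • (w d * superComm g d c b a) =
      (E.eps * (E.omega - 2)) • row w g a := by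
  rw [← sum_rotate, row, Finset.smul_sum]
  refine Finset.sum_congr rfl fun d _ => ?_
  simp only [← mul_smul_comm, ← Finset.mul_sum, hg.sum_up_smul_superComm]

theorem IsOspFamily.row_mul_bil_add_bil_mul_row (hg : E.IsOspFamily g) (hw : E.IsOsc w)
    (hgw : SuperCommutes g w) (a : Idx N M) :
    row w g a * bil w w g + bil w w g * row w g a = (E.eps * (2 - E.omega)) • row w g a := by
  have hswap : ∀ b c d, (E.swapSign b c * E.up b d) • (w c * superComm g d c b a) =
      E.up b d • (w c * superComm g c d b a) := by
    intro b c d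
    rcases E.up_eq_zero_or b d with h | h
    · rw [h, mul_zero, zero_smul, zero_smul]
    · rw [hg.superComm_swap_left d c, E.swapSign_congr_left h, mul_smul_comm, smul_smul,
        mul_right_comm, swapSign_mul_self, one_mul]
  calc row w g a * bil w w g + bil w w g * row w g a
      = ∑ b, ∑ c, ∑ d, (w b * g b a * (E.symPair w c d * g d c) +
          E.symPair w c d * g d c * (w b * g b a)) := by
        simp only [hg.bil_self, row, Finset.sum_mul, Finset.mul_sum, Finset.sum_add_distrib]
        congr 1
        exact (sum_rotate fun c d b => w b * g b a * (E.symPair w c d * g d c)).symm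
    _ = -((1 / 2 : ℂ) • ∑ b, ∑ c, ∑ d, (E.up b c • (w d * superComm g d c b a) +
          E.up b d • (w c * superComm g c d b a))) := by
        simp only [row_mul_bil_term hw hgw, Finset.sum_sub_distrib, hg.sum_symTriple_mul hw,
          zero_sub, smul_mul_assoc, add_mul, hswap, Finset.smul_sum]
    _ = (E.eps * (2 - E.omega)) • row w g a := by
        simp only [fun b => sum_add_swap fun c d => E.up b c • (w d * superComm g d c b a)]
        rw [← Finset.smul_sum, hg.sum_up_smul_mul_superComm]
        module

end Row

theorem mul_bil_sub_bil_mul {s : R} (hs : ∀ a b, Commute (g a b) s) {u v u' v' : Idx N M → R}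
    {α β α' β' : ℂ} (hu : ∀ f, s * u f = α • (u f * s) + β • u' f)
    (hv : ∀ f, s * v f = α' • (v f * s) + β' • v' f) :
    s * bil u v g - (α * α') • (bil u v g * s) = β • bil u' v g + (α * β') • bil u v' g := by
  simp only [bil, Finset.mul_sum, Finset.sum_mul, Finset.smul_sum, ← Finset.sum_sub_distrib,
    ← Finset.sum_add_distrib]
  refine Finset.sum_congr rfl fun a _ => Finset.sum_congr rfl fun b _ => ?_
  have hmove : s * (u a * v b * g b a) = (α * α') • (u a * v b * (s * g b a)) +
      (α * β') • (u a * v' b * g b a) + β • (u' a * v b * g b a) := by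
    rw [← mul_assoc, ← mul_assoc, hu, add_mul, add_mul, smul_mul_assoc, smul_mul_assoc,
      mul_assoc (u a), hv]
    simp only [mul_add, add_mul, smul_mul_assoc, mul_smul_comm, mul_assoc, smul_add, smul_smul]
  rw [hmove, ← (hs b a).eq]
  simp only [mul_assoc]
  module

theorem bil_mul_add_mul_bil_of_row {u v : Idx N M → R} {β : ℂ} {X : R}
    (hrow : ∀ a, row v g a * X + X * row v g a = β • row v g a) (hu : ∀ a, Commute X (u a)) :
    bil u v g * X + X * bil u v g = β • bil u v g := by
  have hbil : bil u v g = ∑ a, u a * row v g a := by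
    simp only [bil, row, Finset.mul_sum, mul_assoc]
  simp only [hbil, Finset.sum_mul, Finset.mul_sum, Finset.smul_sum, ← Finset.sum_add_distrib]
  refine Finset.sum_congr rfl fun a _ => ?_
  rw [← mul_assoc X, (hu a).eq, mul_assoc, mul_assoc, ← mul_add, hrow, mul_smul_comm]

variable {x y : Idx N M → R}

theorem SuperCommutes.commute_contract (hx : SuperCommutes g x) (hy : SuperCommutes g y)
    (c d : Idx N M) : Commute (g c d) (E.contract x y) := by
  refine Commute.sum_right _ _ _ fun a _ => Commute.sum_right _ _ _ fun b _ => ?_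
  rcases E.low_eq_zero_or a b with h | h
  · rw [h, zero_smul]
    exact Commute.zero_right _
  · refine Commute.smul_right ?_ _
    have hsign : koszulSign b c * koszulSign b d * (koszulSign b c * koszulSign b d) = 1 := by
      rw [mul_mul_mul_comm, koszulSign_mul_self, koszulSign_mul_self, one_mul]
    rw [Commute, SemiconjBy, ← mul_assoc, hx, smul_mul_assoc, mul_assoc, hy, mul_smul_comm,
      smul_smul, ← mul_assoc (x a), koszulSign_congr_left h, koszulSign_congr_left h, hsign,
      one_smul]

theorem sum_low_smul_symPair_mul (x y : Idx N M → R) (a d : Idx N M) :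
    ∑ b, ∑ c, E.low b c • (E.symPair x a b * E.symPair y c d) =
      x a * E.contract x y * y d - (1 / 2 : ℂ) • (x a * x d) - (1 / 2 : ℂ) • (y a * y d) +
        (1 / 4 * E.up a d) • (1 : R) := by
  have hterm : ∀ b c, E.low b c • (E.symPair x a b * E.symPair y c d) =
      x a * E.low b c • (x b * y c) * y d - (1 / 2 : ℂ) • (E.low b c * E.up c d) • (x a * x b) -
        (1 / 2 : ℂ) • (E.up a b * E.low b c) • (y c * y d) +
        (1 / 4 : ℂ) • (E.up a b * E.low b c) • E.up c d • (1 : R) := by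
    intro b c
    simp only [symPair, mul_sub, sub_mul, mul_smul_comm, smul_mul_assoc, mul_one, one_mul,
      mul_assoc]
    module
  have hlow : ∑ b, ∑ c, (E.low b c * E.up c d) • (x a * x b) = x a * x d := by
    simp only [← Finset.sum_smul, sum_low_up, ite_smul, one_smul, zero_smul, Finset.sum_ite_eq',
      Finset.mem_univ, if_true]
  simp only [hterm, Finset.sum_add_distrib, Finset.sum_sub_distrib, ← Finset.smul_sum, hlow,
    sum_sum_up_mul_low_smul, ← Finset.sum_mul, ← Finset.mul_sum, contract]
  module

namespace IsOscPair

theorem commute_mul_mul (h : E.IsOscPair x y) (hx : SuperCommutes g x) (a b f : Idx N M) :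
    Commute (y a * y b * g b a) (x f) := by
  have hsign : koszulSign f b * koszulSign f a * (koszulSign f b * koszulSign f a) = 1 := by
    rw [mul_mul_mul_comm, koszulSign_mul_self, koszulSign_mul_self, one_mul]
  rw [Commute, SemiconjBy, mul_assoc, hx, mul_smul_comm, ← mul_assoc, mul_assoc (y a), h.cross,
    mul_smul_comm, smul_mul_assoc, ← mul_assoc, h.cross]
  simp only [smul_mul_assoc, smul_smul, mul_assoc]
  rw [← mul_assoc (koszulSign f b), hsign, one_smul]

theorem commute_bil (h : E.IsOscPair x y) (hx : SuperCommutes g x) (f : Idx N M) :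
    Commute (bil y y g) (x f) :=
  Commute.sum_left _ _ _ fun a _ => Commute.sum_left _ _ _ fun b _ => h.commute_mul_mul hx a b f

theorem commute_symPair_mul (h : E.IsOscPair x y) (hx : SuperCommutes g x) (a b c d : Idx N M) :
    Commute (E.symPair y c d * g d c) (E.symPair x a b) := by
  have hx' : ∀ f, Commute (E.symPair y c d * g d c) (x f) := by
    intro f
    rw [symPair, sub_mul, smul_mul_assoc, one_mul]
    refine (h.commute_mul_mul hx c d f).sub_left ?_
    rcases E.up_eq_zero_or c d with hcd | hcd
    · rw [hcd, mul_zero, zero_smul]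
      exact Commute.zero_left _
    · refine Commute.smul_left ?_ _
      rw [Commute, SemiconjBy, hx, koszulSign_congr_right hcd, koszulSign_mul_self, one_smul]
  exact ((hx' a).mul_right (hx' b)).sub_right ((Commute.one_right _).smul_right _)

theorem bil_swap (h : E.IsOscPair x y) (hg : E.IsOspFamily g) :
    bil y x g = (-E.eps) • bil x y g := by
  rw [bil, Finset.sum_comm]
  simp only [bil, Finset.smul_sum]
  refine Finset.sum_congr rfl fun a _ => Finset.sum_congr rfl fun b _ => ?_
  rw [h.cross, hg.symm a b, swapSign, smul_mul_smul_comm]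
  match_scalars
  linear_combination (-E.eps) * koszulSign_mul_self a b

theorem contract_mul_left (h : E.IsOscPair x y) (f : Idx N M) :
    E.contract x y * x f = (-E.eps) • (x f * E.contract x y) + E.eps • y f := by
  rw [h.left_mul_contract]
  match_scalars
  · linear_combination -E.eps_mul_self
  · ring

theorem contract_mul_right (h : E.IsOscPair x y) (f : Idx N M) :
    E.contract x y * y f = (-E.eps) • (y f * E.contract x y) + (1 : ℂ) • x f := by
  rw [h.right_mul_contract]
  match_scalars
  · linear_combination -E.eps_mul_self
  · linear_combination E.eps_mul_self

theorem contract_mul_bil_left (h : E.IsOscPair x y) (hg : E.IsOspFamily g)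
    (hx : SuperCommutes g x) (hy : SuperCommutes g y) :
    E.contract x y * bil x x g - bil x x g * E.contract x y = (-2 : ℂ) • bil x y g := by
  have hcomm := mul_bil_sub_bil_mul (hx.commute_contract (E := E) hy) h.contract_mul_left
    h.contract_mul_left
  rw [neg_mul_neg, E.eps_mul_self, one_smul, h.bil_swap hg] at hcomm
  rw [hcomm]
  match_scalars
  linear_combination (-2 : ℂ) * E.eps_mul_self

theorem contract_mul_bil_right (h : E.IsOscPair x y) (hg : E.IsOspFamily g)
    (hx : SuperCommutes g x) (hy : SuperCommutes g y) :
    E.contract x y * bil y y g - bil y y g * E.contract x y = (2 : ℂ) • bil x y g := by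
  have hcomm := mul_bil_sub_bil_mul (hx.commute_contract (E := E) hy) h.contract_mul_right
    h.contract_mul_right
  rw [neg_mul_neg, E.eps_mul_self, one_smul, h.bil_swap hg] at hcomm
  rw [hcomm]
  match_scalars
  linear_combination E.eps_mul_self

theorem contract_mul_bil_mixed (h : E.IsOscPair x y) (hx : SuperCommutes g x)
    (hy : SuperCommutes g y) :
    E.contract x y * bil x y g - bil x y g * E.contract x y = E.eps • (bil y y g - bil x x g) := by
  have hcomm := mul_bil_sub_bil_mul (hx.commute_contract (E := E) hy) h.contract_mul_left
    h.contract_mul_right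
  rw [neg_mul_neg, E.eps_mul_self, one_smul] at hcomm
  rw [hcomm]
  module

theorem bil_mixed_mul_add_right (h : E.IsOscPair x y) (hg : E.IsOspFamily g)
    (hx : SuperCommutes g x) (hy : SuperCommutes g y) :
    bil x y g * bil y y g + bil y y g * bil x y g = (E.eps * (2 - E.omega)) • bil x y g :=
  bil_mul_add_mul_bil_of_row (hg.row_mul_bil_add_bil_mul_row h.right hy) (h.commute_bil hx)

theorem bil_mixed_mul_add_left (h : E.IsOscPair x y) (hg : E.IsOspFamily g)
    (hx : SuperCommutes g x) (hy : SuperCommutes g y) :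
    bil x y g * bil x x g + bil x x g * bil x y g = (E.eps * (2 - E.omega)) • bil x y g := by
  have hswap := h.symm.bil_mixed_mul_add_right hg hy hx
  rw [h.bil_swap hg, smul_mul_assoc, mul_smul_comm, ← smul_add, smul_comm _ (-E.eps)] at hswap
  exact smul_right_injective R (neg_ne_zero.2 (left_ne_zero_of_mul_eq_one E.eps_mul_self)) hswap

theorem symPair_mul_sub (h : E.IsOscPair x y) (hg : E.IsOspFamily g)
    (hx : SuperCommutes g x) (hy : SuperCommutes g y) (a b c d : Idx N M) :
    E.symPair x a b * g b a * (E.symPair y c d * g d c) -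
        E.symPair y c d * g d c * (E.symPair x a b * g b a) =
      (-E.eps) • (E.low b c • (E.symPair x a b * E.symPair y c d * g d a) +
        E.low b d • (E.symPair x a b * E.symPair y d c * g c a) +
        (E.low a c • (E.symPair x b a * E.symPair y c d * g d b) +
          E.low a d • (E.symPair x b a * E.symPair y d c * g c b))) := by
  have hleft : E.symPair x a b * g b a * (E.symPair y c d * g d c) =
      E.symPair x a b * E.symPair y c d * (pairSign d c b a • (g b a * g d c)) := by
    rw [mul_assoc, ← mul_assoc (g b a), hy.mul_symPair, pairSign_comm, pairSign_swap_left]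
    simp only [smul_mul_assoc, mul_smul_comm, mul_assoc]
  have hright : E.symPair y c d * g d c * (E.symPair x a b * g b a) =
      E.symPair x a b * E.symPair y c d * (g d c * g b a) := by
    rw [← mul_assoc, (h.commute_symPair_mul hx a b c d).eq]
    simp only [mul_assoc]
  rw [hleft, hright, ← neg_sub, ← mul_sub, ← superComm, hg.comm, h.left.symPair_swap b a,
    h.right.symPair_swap d c]
  simp only [mul_add, mul_smul_comm, smul_mul_assoc]
  module

theorem bil_mul_sub_bil_mul (h : E.IsOscPair x y) (hg : E.IsOspFamily g)
    (hx : SuperCommutes g x) (hy : SuperCommutes g y) :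
    bil x x g * bil y y g - bil y y g * bil x x g =
      (-4 * E.eps) • (∑ a, ∑ d, x a * E.contract x y * y d * g d a -
        (1 / 2 : ℂ) • bil x x g - (1 / 2 : ℂ) • bil y y g) := by
  set f : Idx N M → Idx N M → Idx N M → Idx N M → R := fun a b c d =>
    E.low b c • (E.symPair x a b * E.symPair y c d * g d a) with hf
  have hsum : ∑ a, ∑ b, ∑ c, ∑ d, f a b c d = ∑ a, ∑ d, x a * E.contract x y * y d * g d a -
      (1 / 2 : ℂ) • bil x x g - (1 / 2 : ℂ) • bil y y g := by
    have hrow : ∀ a, ∑ b, ∑ c, ∑ d, f a b c d =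
        ∑ d, (∑ b, ∑ c, E.low b c • (E.symPair x a b * E.symPair y c d)) * g d a := by
      intro a
      rw [← sum_rotate (f a)]
      simp only [Finset.sum_mul, smul_mul_assoc, hf]
    simp only [hrow, sum_low_smul_symPair_mul, sub_mul, add_mul, smul_mul_assoc,
      one_mul, Finset.sum_add_distrib, Finset.sum_sub_distrib, ← Finset.smul_sum, mul_smul,
      hg.trace, bil, smul_zero, add_zero]
  have hbil : ∀ Z : R, bil x x g * Z - Z * bil x x g =
      ∑ a, ∑ b, (E.symPair x a b * g b a * Z - Z * (E.symPair x a b * g b a)) := by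
    intro Z
    simp only [hg.bil_self, Finset.sum_mul, Finset.mul_sum, Finset.sum_sub_distrib]
  calc bil x x g * bil y y g - bil y y g * bil x x g
      = ∑ a, ∑ b, ∑ c, ∑ d, (-E.eps) • (f a b c d + f a b d c + (f b a c d + f b a d c)) := by
        rw [hbil]
        refine Finset.sum_congr rfl fun a _ => Finset.sum_congr rfl fun b _ => ?_
        simp only [hg.bil_self, Finset.sum_mul, Finset.mul_sum, ← Finset.sum_sub_distrib,
          h.symPair_mul_sub hg hx hy, hf]
    _ = (-4 * E.eps) • ∑ a, ∑ b, ∑ c, ∑ d, f a b c d := by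
        simp only [← Finset.smul_sum, sum_add_swap_swap]
        module
    _ = _ := by rw [hsum]

theorem sum_mul_contract_mul_eq_sub_contract_mul (h : E.IsOscPair x y) :
    ∑ a, ∑ d, x a * E.contract x y * y d * g d a =
      bil y y g - E.eps • (E.contract x y * bil x y g) := by
  simp only [bil, Finset.smul_sum, Finset.mul_sum, ← Finset.sum_sub_distrib]
  refine Finset.sum_congr rfl fun a _ => Finset.sum_congr rfl fun b _ => ?_
  rw [h.left_mul_contract]
  simp only [add_mul, smul_mul_assoc, mul_assoc]
  module

theorem sum_mul_contract_mul_eq_sub_mul_contract (h : E.IsOscPair x y)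
    (hx : SuperCommutes g x) (hy : SuperCommutes g y) :
    ∑ a, ∑ d, x a * E.contract x y * y d * g d a =
      bil x x g - E.eps • (bil x y g * E.contract x y) := by
  simp only [bil, Finset.smul_sum, Finset.sum_mul, ← Finset.sum_sub_distrib]
  refine Finset.sum_congr rfl fun a _ => Finset.sum_congr rfl fun b _ => ?_
  rw [mul_assoc (x a), h.contract_mul_right, mul_assoc _ (g b a),
    (hx.commute_contract (E := E) hy b a).eq]
  simp only [mul_add, add_mul, smul_mul_assoc, mul_smul_comm, mul_assoc]
  module

theorem contract_mul_bil_mul_bil (h : E.IsOscPair x y) (hg : E.IsOspFamily g)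
    (hx : SuperCommutes g x) (hy : SuperCommutes g y) :
    E.contract x y * (bil x x g * bil y y g) - bil x x g * bil y y g * E.contract x y =
      E.eps • (E.contract x y * (bil y y g - bil x x g) +
        (bil y y g - bil x x g) * E.contract x y) := by
  refine mul_sub_mul_eq_of_commutators (h.contract_mul_bil_left hg hx hy)
    (h.contract_mul_bil_right hg hx hy) (h.contract_mul_bil_mixed hx hy) ?_
    ((h.bil_mixed_mul_add_left hg hx hy).trans (h.bil_mixed_mul_add_right hg hx hy).symm)
  rw [h.bil_mul_sub_bil_mul hg hx hy]
  have hl := h.sum_mul_contract_mul_eq_sub_contract_mul (g := g)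
  have hr := h.sum_mul_contract_mul_eq_sub_mul_contract hx hy
  have heps : ∀ z : R, (E.eps * E.eps) • z = z := fun z => by rw [E.eps_mul_self, one_smul]
  linear_combination (norm := module) (-2 * E.eps) • hl + (-2 * E.eps) • hr +
    (2 : ℂ) • heps (E.contract x y * bil x y g + bil x y g * E.contract x y)

end IsOscPair

end SuperMetric

/-! ### The defect of the invariants -/

section Defect

variable {𝕜 R : Type*} [Field 𝕜] [Ring R] [Algebra 𝕜 R]

theorem symMul_one_comm (x z : R) : symMul (1 : 𝕜) x z = symMul (1 : 𝕜) z x := by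
  simp only [symMul_apply, one_smul, add_comm]

variable [CharZero 𝕜]

theorem symMul_one_left_comm {x y : R} (h : Commute x y) (z : R) :
    symMul (1 : 𝕜) x (symMul (1 : 𝕜) y z) = symMul (1 : 𝕜) y (symMul (1 : 𝕜) x z) := by
  have hxy : x * y = (1 : 𝕜) • (y * x) + 0 := by rw [one_smul, add_zero, h.eq]
  have hsymm := symMul_symMul (χ := 1) (χ' := 1) (mul_one _) hxy z
  simpa [twistedComm_apply] using hsymm

variable (e ω : 𝕜) (s W : R) (k : ℕ)

theorem commutator_invPoly_succ :
    invPoly e ω s (k + 1) * W - W * invPoly e ω s (k + 1) =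
      symMul (1 : 𝕜) s (invPoly e ω s k * W - W * invPoly e ω s k) +
        symMul (1 : 𝕜) (invPoly e ω s k) (s * W - W * s) -
        recCoeff e ω k • (invPoly e ω s (k - 1) * W - W * invPoly e ω s (k - 1)) := by
  have hs := (commute_invPoly e ω (Commute.refl s) k).eq
  have hleft : s * (invPoly e ω s k * W) = invPoly e ω s k * (s * W) := by
    rw [← mul_assoc, hs, mul_assoc]
  simp only [invPoly_succ, symMul_apply, sub_mul, mul_sub, smul_mul_assoc, mul_smul_comm,
    mul_assoc, hs, hleft]
  module

theorem symMul_one_invPoly_succ :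
    symMul (1 : 𝕜) (invPoly e ω s (k + 1)) W =
      symMul (1 : 𝕜) s (symMul (1 : 𝕜) (invPoly e ω s k) W) +
        (1 / 4 : 𝕜) • (invPoly e ω s k * (s * W - W * s) - (s * W - W * s) * invPoly e ω s k) -
        recCoeff e ω k • symMul (1 : 𝕜) (invPoly e ω s (k - 1)) W := by
  have hs := (commute_invPoly e ω (Commute.refl s) k).eq
  have hleft : s * (invPoly e ω s k * W) = invPoly e ω s k * (s * W) := by
    rw [← mul_assoc, hs, mul_assoc]
  simp only [invPoly_succ, symMul_apply, sub_mul, mul_sub, mul_add, add_mul, smul_mul_assoc,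
    mul_smul_comm, mul_assoc, hs, hleft]
  module

variable {e ω s W k} {H X : R}

theorem commutator_invPoly_eq (he : e * e = 1) (hH : s * W - W * s = (4 * e) • H)
    (hX : s * X - X * s = (2 : 𝕜) • symMul (1 : 𝕜) s H) (k : ℕ) :
    invPoly e ω s k * X - X * invPoly e ω s k =
      (e / 2) • symMul (1 : 𝕜) s (invPoly e ω s k * W - W * invPoly e ω s k) := by
  induction k using Nat.strong_induction_on with | _ k ih
  rcases k with _ | k
  · simp [invPoly_zero]
  · rw [commutator_invPoly_succ, commutator_invPoly_succ, ih k (by lia), ih (k - 1) (by lia), hX,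
      hH, map_smul, map_smul,
      symMul_one_left_comm (commute_invPoly e ω (Commute.refl s) k).symm H]
    simp only [map_add, map_sub, map_smul]
    match_scalars
    · ring
    · ring
    · linear_combination (-2 : 𝕜) * he
    · ring
    · ring

theorem defect_invPoly (he : e * e = 1) (hW : W = s * H - H * s)
    (hH : s * W - W * s = (4 * e) • H) (hX : s * X - X * s = (2 : 𝕜) • symMul (1 : 𝕜) s H)
    {T : ℕ → R} (hT : ∀ k, symMul (1 : 𝕜) (invPoly e ω s k) H =
      T k + (1 / 4 * e * k * (k - 1)) • T (k - 2)) (u : 𝕜) (k : ℕ) :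
    invPoly e ω s k * X - X * invPoly e ω s k - (2 * u) • symMul (1 : 𝕜) (invPoly e ω s k) H =
      (-2 * (u - k)) • T k - (1 / 2 * e * k * (k - 1) * (k + u - ω)) • T (k - 2) := by
  have hrec := smul_pred_and_map_of_recurrence (e := e) (ω := ω) (σ := symMul (1 : 𝕜) s)
    (D := fun k => invPoly e ω s k * W - W * invPoly e ω s k) (T := T)
    (by simp [invPoly_zero])
    (fun k => by rw [commutator_invPoly_succ, hH, map_smul])
    (fun k => by rw [symMul_one_invPoly_succ, ← hW]) hT
  rw [commutator_invPoly_eq he hH hX, hT]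
  rcases k with _ | k
  · simp [invPoly_zero]
  · rw [(hrec (k + 1)).1, map_smul, Nat.add_sub_cancel, (hrec k).2,
      show k + 1 - 2 = k - 1 by lia]
    push_cast
    match_scalars
    · linear_combination (2 * (k + 1) : 𝕜) * he
    · linear_combination (1 / 2 * e * k * (k + 1) * (ω - 1 - k)) * he

end Defect

/-- The defect of the `RLL`-relation for the operators `L_i(u) = u - ½ X_i`, up to a factor `4`. -/
def rllDefect {R : Type*} [Ring R] [Algebra ℂ R] (u : ℂ) (X₁ X₂ : R) : R →ₗ[ℂ] R :=
  LinearMap.mulRight ℂ (X₁ * X₂) - LinearMap.mulLeft ℂ (X₁ * X₂) -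
    (2 * u) • symMul (1 : ℂ) (X₂ - X₁)

namespace SuperMetric

variable {N M : ℕ} {ϵ : ℤˣ} (E : SuperMetric N M ϵ) {R : Type*} [Ring R] [Algebra ℂ R]
  {g : Idx N M → Idx N M → R} {x y : Idx N M → R}

/-- The contraction of the twice symmetrised products `symInvPoly₂` with `g`. -/
def symBil (x : Idx N M → R) (s : R) (g : Idx N M → Idx N M → R) (k : ℕ) : R :=
  ∑ a, ∑ b, E.symInvPoly₂ x s k a b * g b a

theorem symBil_smul {m : ℂ} (hm : m * m = 1) (x : Idx N M → R) (s : R) (k : ℕ) :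
    E.symBil x (m • s) g k = m ^ k • E.symBil x s g k := by
  simp only [symBil, E.symInvPoly₂_smul hm, smul_mul_assoc, ← Finset.smul_sum]

/-- The quadratic expression to which the defects of the invariants reduce. -/
def symBilDiff (x y : Idx N M → R) (g : Idx N M → Idx N M → R) (k : ℕ) : R :=
  E.eps • (E.symBil y (E.contract x y) g k - E.symBil x (E.contract x y) g k)

namespace IsOscPair

variable {E}

theorem symMul_one_invPoly_bil (h : E.IsOscPair x y) (hg : E.IsOspFamily g)
    (hx : SuperCommutes g x) (hy : SuperCommutes g y) (k : ℕ) :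
    symMul (1 : ℂ) (invPoly E.eps E.omega (E.contract x y) k) (bil x x g) =
      E.symBil x (E.contract x y) g k -
        (1 / 4 * E.eps * k * (k - 1)) • E.symBil y (E.contract x y) g (k - 2) := by
  set J := invPoly E.eps E.omega (E.contract x y) k
  have hswap : ∀ v : Idx N M → Idx N M → R,
      ∑ a, ∑ b, v a b * g b a = ∑ a, ∑ b, E.swapSign a b • (v b a * g b a) := by
    intro v
    rw [Finset.sum_comm]
    refine Finset.sum_congr rfl fun a _ => Finset.sum_congr rfl fun b _ => ?_
    rw [hg.symm a b, mul_smul_comm]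
  have hleft : J * bil x x g =
      ∑ a, ∑ b, E.swapSign a b • (J * (x b * x a)) * g b a := by
    rw [bil, hswap fun a b => x a * x b]
    simp only [Finset.mul_sum, mul_smul_comm, smul_mul_assoc, mul_assoc]
  have hright : bil x x g * J = ∑ a, ∑ b, x a * x b * J * g b a := by
    simp only [bil, Finset.sum_mul]
    refine Finset.sum_congr rfl fun a _ => Finset.sum_congr rfl fun b _ => ?_
    rw [mul_assoc, (commute_invPoly E.eps E.omega (hx.commute_contract hy b a) k).eq, ← mul_assoc]
  rw [symMul_apply, one_smul, add_comm, hleft, hright, symBil, symBil,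
    hswap (E.symInvPoly₂ y _ _)]
  simp only [Finset.smul_sum, ← Finset.sum_add_distrib, ← Finset.sum_sub_distrib]
  refine Finset.sum_congr rfl fun a _ => Finset.sum_congr rfl fun b _ => ?_
  rw [← add_mul, h.mul_invPoly_add_invPoly_mul, add_mul, smul_mul_assoc, smul_mul_assoc, swapSign]
  match_scalars
  · ring
  · linear_combination (-(1 / 4 * (k : ℂ) * (k - 1) * koszulSign a b)) * E.eps_mul_self

theorem symMul_one_invPoly_bil_right (h : E.IsOscPair x y) (hg : E.IsOspFamily g)
    (hx : SuperCommutes g x) (hy : SuperCommutes g y) (k : ℕ) :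
    symMul (1 : ℂ) (invPoly E.eps E.omega (E.contract x y) k) (bil y y g) =
      E.symBil y (E.contract x y) g k -
        (1 / 4 * E.eps * k * (k - 1)) • E.symBil x (E.contract x y) g (k - 2) := by
  have hpow : (1 / 4 * E.eps * k * (k - 1)) * E.eps ^ (k - 2) =
      E.eps ^ k * (1 / 4 * E.eps * k * (k - 1)) := by
    rcases k with _ | _ | k
    · simp
    · simp
    · rw [show k + 1 + 1 - 2 = k from rfl, pow_succ, pow_succ, mul_assoc (E.eps ^ k),
        E.eps_mul_self, mul_one, mul_comm]
  have hswap := h.symm.symMul_one_invPoly_bil hg hy hx k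
  rw [h.invPoly_contract_swap, symMul_smul_left, h.contract_swap, E.symBil_smul E.eps_mul_self,
    E.symBil_smul E.eps_mul_self, smul_smul, hpow, mul_smul, ← smul_sub] at hswap
  exact smul_right_injective R (pow_ne_zero k (left_ne_zero_of_mul_eq_one E.eps_mul_self)) hswap

theorem rllDefect_invPoly (h : E.IsOscPair x y) (hg : E.IsOspFamily g)
    (hx : SuperCommutes g x) (hy : SuperCommutes g y) (u : ℂ) (k : ℕ) :
    rllDefect u (E.eps • bil x x g) (E.eps • bil y y g)
        (invPoly E.eps E.omega (E.contract x y) k) =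
      (-2 * (u - k)) • E.symBilDiff x y g k -
        (1 / 2 * E.eps * k * (k - 1) * (k + u - E.omega)) • E.symBilDiff x y g (k - 2) := by
  have he := E.eps_mul_self
  have hdefect := defect_invPoly (H := E.eps • (bil y y g - bil x x g))
    (W := (4 * E.eps) • bil x y g) (ω := E.omega) (s := E.contract x y)
    (X := bil x x g * bil y y g) (T := E.symBilDiff x y g) he ?_ ?_ ?_ ?_ u k
  · rw [rllDefect, LinearMap.sub_apply, LinearMap.sub_apply, LinearMap.smul_apply,
      symMul_one_comm, ← smul_sub, smul_mul_smul_comm, he, one_smul]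
    exact hdefect
  · have hx' := h.contract_mul_bil_left hg hx hy
    have hy' := h.contract_mul_bil_right hg hx hy
    simp only [mul_sub, sub_mul, mul_smul_comm, smul_mul_assoc]
    linear_combination (norm := module) E.eps • hx' - E.eps • hy'
  · rw [mul_smul_comm, smul_mul_assoc, ← smul_sub, h.contract_mul_bil_mixed hx hy]
  · rw [h.contract_mul_bil_mul_bil hg hx hy, map_smul, symMul_apply]
    module
  · intro k
    rw [map_smul, map_sub, h.symMul_one_invPoly_bil hg hx hy,
      h.symMul_one_invPoly_bil_right hg hx hy, symBilDiff, symBilDiff]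
    module

theorem commute_bil_add_bil (h : E.IsOscPair x y) (hg : E.IsOspFamily g)
    (hx : SuperCommutes g x) (hy : SuperCommutes g y) :
    Commute (bil x x g + bil y y g) (E.contract x y) := by
  have hx' := h.contract_mul_bil_left hg hx hy
  have hy' := h.contract_mul_bil_right hg hx hy
  rw [Commute, SemiconjBy, mul_add, add_mul]
  linear_combination (norm := module) -hx' - hy'

end IsOscPair

end SuperMetric

/-! ### The graded tensor product of two oscillator algebras -/

theorem neg_one_pow_smul {V : Type*} [AddCommGroup V] [Module ℂ V] (z : ZMod 2) (v : V) :
    ((-1 : ℤˣ) ^ z) • v = sgn z • v := by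
  rcases zmod_two_cases z with rfl | rfl
  · rw [uzpow_zero, sgn_zero, one_smul, one_smul]
  · have h : (-1 : ℤˣ) ^ (1 : ZMod 2) = -1 := uzpow_one _
    rw [h, sgn_one, Units.neg_smul, one_smul, neg_one_smul]

theorem tmul_mul_tmul {A B : Type*} [Ring A] [Algebra ℂ A] [Ring B] [Algebra ℂ B]
    (𝒜 : ZMod 2 → Submodule ℂ A) (ℬ : ZMod 2 → Submodule ℂ B) [GradedAlgebra 𝒜] [GradedAlgebra ℬ]
    {i j : ZMod 2} {a' : A} {b : B} (ha : a' ∈ 𝒜 i) (hb : b ∈ ℬ j) (a : A) (b' : B) :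
    (a ᵍ⊗ₜ[ℂ] b * a' ᵍ⊗ₜ[ℂ] b' : 𝒜 ᵍ⊗[ℂ] ℬ) = sgn (j * i) • ((a * a') ᵍ⊗ₜ[ℂ] (b * b')) := by
  rw [← neg_one_pow_smul]
  exact GradedTensorProduct.tmul_coe_mul_coe_tmul 𝒜 ℬ a ⟨b, hb⟩ ⟨a', ha⟩ b'

/-- The total degree of a family of indices. -/
def degSum {N M k : ℕ} (a : Fin k → Idx N M) : ZMod 2 := ∑ i, deg (a i)

theorem degSum_cons {N M k : ℕ} (e : Idx N M) (a : Fin k → Idx N M) :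
    degSum (Fin.cons e a : Fin (k + 1) → Idx N M) = deg e + degSum a := by
  simp only [degSum, Fin.sum_univ_succ, Fin.cons_zero, Fin.cons_succ]

theorem degSum_snoc {N M k : ℕ} (e : Idx N M) (a : Fin k → Idx N M) :
    degSum (Fin.snoc a e : Fin (k + 1) → Idx N M) = deg e + degSum a := by
  simp only [degSum, Fin.sum_univ_castSucc, Fin.snoc_castSucc, Fin.snoc_last, add_comm]

theorem degSum_rev {N M k : ℕ} (a : Fin k → Idx N M) : degSum (fun i => a (Fin.rev i)) = degSum a :=
  Equiv.sum_comp Fin.revPerm fun i => deg (a i)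

namespace SuperMetric

variable {N M : ℕ} {ϵ : ℤˣ} (E : SuperMetric N M ϵ)

theorem moveSign_eq (e : Idx N M) {k : ℕ} (a : Fin k → Idx N M) :
    E.moveSign e a = (-E.eps) ^ k * sgn (deg e * degSum a) := by
  induction k with
  | zero => rw [moveSign_fin_zero, pow_zero, degSum, Fin.sum_univ_zero, mul_zero, sgn_zero, one_mul]
  | succ k ih =>
    induction a using Fin.consCases with
    | _ f b =>
    rw [moveSign_cons, ih, degSum_cons, mul_add, sgn_add, pow_succ, swapSign, koszulSign]
    ring

theorem degSum_eq_of_prod_low_ne_zero {k : ℕ} {a b : Fin k → Idx N M}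
    (h : ∏ i, E.low (a i) (b i) ≠ 0) : degSum a = degSum b :=
  Finset.sum_congr rfl fun i hi =>
    (E.low_eq_zero_or _ _).resolve_left (Finset.prod_ne_zero_iff.1 h i hi)

theorem c_mem (a : Idx N M) : E.c a ∈ E.oscGrading (deg a) :=
  (mem_parityGrading _ _ _).2 (E.oscParity_c a)

theorem symProd_mem {k : ℕ} (a : Fin k → Idx N M) : E.symProd a ∈ E.oscGrading (degSum a) := by
  induction k with
  | zero =>
    rw [symProd_fin_zero]
    exact SetLike.GradedOne.one_mem
  | succ k ih =>
    induction a using Fin.consCases with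
    | _ e b =>
    rw [symProd_cons, degSum_cons]
    refine Submodule.smul_mem _ _ (Submodule.add_mem _ ?_ (Submodule.smul_mem _ _ ?_))
    · exact SetLike.GradedMul.mul_mem (E.c_mem e) (ih b)
    · rw [add_comm]
      exact SetLike.GradedMul.mul_mem (ih b) (E.c_mem e)

theorem leg_one_mul_leg_zero {i j : ZMod 2} {z w : E.Osc} (hz : z ∈ E.oscGrading i)
    (hw : w ∈ E.oscGrading j) :
    E.leg 1 w * E.leg 0 z = sgn (j * i) • (E.leg 0 z * E.leg 1 w) := by
  change ((1 : E.Osc) ᵍ⊗ₜ[ℂ] w * z ᵍ⊗ₜ[ℂ] (1 : E.Osc) : E.Osc2) =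
    sgn (j * i) • (z ᵍ⊗ₜ[ℂ] (1 : E.Osc) * (1 : E.Osc) ᵍ⊗ₜ[ℂ] w)
  rw [tmul_mul_tmul _ _ hz hw, one_mul, mul_one, GradedTensorProduct.tmul_one_mul_one_tmul]

/-- The super-oscillators `c_1^a` and `c_2^a` of the two factors of `𝒜 ⊗ 𝒜`. -/
def osc (i : Fin 2) (a : Idx N M) : E.Osc2 := E.leg i (E.c a)

theorem isOscPair_osc : E.IsOscPair (E.osc 0) (E.osc 1) where
  left a b := by
    rw [osc, osc, ← map_mul, c_mul_c, map_add, map_smul, map_smul, map_mul, map_one]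
  right a b := by
    rw [osc, osc, ← map_mul, c_mul_c, map_add, map_smul, map_smul, map_mul, map_one]
  cross a b := by
    rw [osc, osc, E.leg_one_mul_leg_zero (E.c_mem a) (E.c_mem b), mul_comm (deg b), koszulSign]

/-- The super-symmetrised monomials `c_1^{(a_1} ⋯ c_1^{a_k)} c_2^{(b_1} ⋯ c_2^{b_l)}`. -/
def symMonomial {k l : ℕ} (a : Fin k → Idx N M) (b : Fin l → Idx N M) : E.Osc2 :=
  E.leg 0 (E.symProd a) * E.leg 1 (E.symProd b)

theorem symMul_osc_zero_symMonomial (e : Idx N M) {k l : ℕ} (a : Fin k → Idx N M)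
    (b : Fin l → Idx N M) :
    symMul ((-E.eps) ^ k * sgn (deg e * (degSum a + degSum b))) (E.osc 0 e) (E.symMonomial a b) =
      E.symMonomial (Fin.cons e a : Fin (k + 1) → Idx N M) b := by
  have hs := sgn_mul_self (deg e * degSum b)
  rw [symMonomial, symMonomial, symProd_cons, map_symMul, symMul_apply, symMul_apply, moveSign_eq,
    mul_add, sgn_add, osc, mul_assoc (E.leg 0 (E.symProd a)),
    E.leg_one_mul_leg_zero (E.c_mem e) (E.symProd_mem b), mul_comm (degSum b)]
  simp only [add_mul, mul_smul_comm, smul_mul_assoc, mul_assoc]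
  match_scalars
  · ring
  · linear_combination ((-E.eps) ^ k * sgn (deg e * degSum a) / 2) * hs

theorem symMul_osc_one_symMonomial (e : Idx N M) {k l : ℕ} (a : Fin k → Idx N M)
    (b : Fin l → Idx N M) :
    symMul ((-E.eps) ^ l * sgn (deg e * (degSum a + degSum b))) (E.osc 1 e) (E.symMonomial a b) =
      sgn (deg e * degSum a) •
        E.symMonomial a (Fin.cons e b : Fin (l + 1) → Idx N M) := by
  rw [symMonomial, symMonomial, symProd_cons, map_symMul, symMul_apply, symMul_apply, moveSign_eq,
    mul_add, sgn_add, osc, ← mul_assoc, E.leg_one_mul_leg_zero (E.symProd_mem a) (E.c_mem e)]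
  simp only [mul_add, mul_smul_comm, smul_mul_assoc, mul_assoc]
  module

theorem symMonomial_cons_snoc (e f : Idx N M) {k : ℕ} {a b : Fin k → Idx N M}
    (hab : degSum a = degSum b) :
    E.symMonomial (Fin.cons e a : Fin (k + 1) → Idx N M)
        (Fin.snoc b f : Fin (k + 1) → Idx N M) =
      (-E.eps) ^ k • symMul ((-E.eps) ^ k * koszulSign e f) (E.osc 0 e)
        (symMul ((-E.eps) ^ k) (E.osc 1 f) (E.symMonomial a b)) := by
  have hdeg : degSum b + (deg f + degSum b) = deg f := by
    rw [add_left_comm, CharTwo.add_self_eq_zero, add_zero]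
  have hone := E.symMul_osc_one_symMonomial f a b
  rw [hab, CharTwo.add_self_eq_zero, mul_zero, sgn_zero, mul_one] at hone
  rw [hone, ← symMul_osc_zero_symMonomial, degSum_snoc, hab, hdeg, ← koszulSign, map_smul,
    smul_smul]
  rw [symMonomial, symMonomial, symProd_snoc, ← symProd_cons, moveSign_eq, map_smul, mul_smul_comm,
    map_smul]

/-! ### The invariants -/

theorem sum_fin_succ {α V : Type*} [Fintype α] [AddCommMonoid V] {k : ℕ}
    (φ : (Fin (k + 1) → α) → V) : ∑ a, φ a = ∑ e, ∑ a : Fin k → α, φ (Fin.cons e a) := by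
  rw [← (Fin.consEquiv fun _ => α).sum_comp, Fintype.sum_prod_type]
  rfl

theorem cons_comp_rev {α : Type*} {k : ℕ} (e : α) (a : Fin k → α) :
    (fun i => (Fin.cons e a : Fin (k + 1) → α) (Fin.rev i)) =
      (Fin.snoc (fun i => a (Fin.rev i)) e : Fin (k + 1) → α) := by
  funext i
  refine Fin.lastCases ?_ (fun i => ?_) i
  · rw [Fin.rev_last, Fin.cons_zero, Fin.snoc_last]
  · rw [Fin.rev_castSucc, Fin.cons_succ, Fin.snoc_castSucc]

theorem invariant_eq_sum (k : ℕ) :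
    E.invariant k = ∑ a : Fin k → Idx N M, ∑ b : Fin k → Idx N M,
      (∏ i, E.low (a i) (b i)) • E.symMonomial a fun i => b (Fin.rev i) := rfl

theorem prod_low_smul_symMonomial_cons_snoc (e f : Idx N M) {k : ℕ} (a b : Fin k → Idx N M) :
    (∏ i, E.low (a i) (b i)) •
        E.symMonomial (Fin.cons e a : Fin (k + 1) → Idx N M)
          (Fin.snoc (fun i => b (Fin.rev i)) f : Fin (k + 1) → Idx N M) =
      (-E.eps) ^ k • symMul ((-E.eps) ^ k * koszulSign e f) (E.osc 0 e)
        (symMul ((-E.eps) ^ k) (E.osc 1 f)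
          ((∏ i, E.low (a i) (b i)) • E.symMonomial a fun i => b (Fin.rev i))) := by
  rcases eq_or_ne (∏ i, E.low (a i) (b i)) 0 with h | h
  · simp only [h, zero_smul, map_zero, smul_zero]
  · have hdeg := (E.degSum_eq_of_prod_low_ne_zero h).trans (degSum_rev b).symm
    rw [E.symMonomial_cons_snoc e f hdeg, map_smul, map_smul, smul_comm]

theorem invariant_succ (k : ℕ) :
    E.invariant (k + 1) = (-E.eps) ^ k • ∑ e, ∑ f, E.low e f •
      symMul ((-E.eps) ^ k * koszulSign e f) (E.osc 0 e)
        (symMul ((-E.eps) ^ k) (E.osc 1 f) (E.invariant k)) := by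
  simp only [invariant_eq_sum, sum_fin_succ (k := k), Fin.prod_univ_succ, Fin.cons_zero,
    Fin.cons_succ, cons_comp_rev, mul_smul, prod_low_smul_symMonomial_cons_snoc, map_sum,
    Finset.smul_sum]
  refine Finset.sum_congr rfl fun e _ => Finset.sum_comm.trans ?_
  exact Finset.sum_congr rfl fun f _ => Finset.sum_congr rfl fun a _ =>
    Finset.sum_congr rfl fun b _ => smul_comm _ _ _

theorem IsOscPair.sum_symMul_symMul {E : SuperMetric N M ϵ} {R : Type*} [Ring R] [Algebra ℂ R]
    {x y : Idx N M → R} (h : E.IsOscPair x y) {p : ℂ} (hp : p * p = 1) (z : R) :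
    ∑ a, ∑ b, E.low a b • symMul (p * koszulSign a b) (x a) (symMul p (y b) z) =
      (1 / 4 : ℂ) • (E.contract x y * z + z * E.contract x y +
        p • (E.sandwich x y z + E.eps • E.sandwich y x z)) := by
  have hterm : ∀ a b, E.low a b • symMul (p * koszulSign a b) (x a) (symMul p (y b) z) =
      (1 / 4 : ℂ) • (E.low a b • (x a * y b) * z + z * E.low a b • (x a * y b) +
        p • (E.low a b • (x a * z * y b) + E.eps • (E.low b a • (y b * z * x a)))) := by
    intro a b
    simp only [symMul_apply, mul_add, add_mul, mul_smul_comm, smul_mul_assoc, mul_assoc, h.cross]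
    match_scalars
    · ring
    · ring
    · linear_combination (p / 4) * E.low_mul_koszulSign a b
    · linear_combination (E.low a b / 4) * (koszulSign a b * koszulSign a b * hp +
        koszulSign_mul_self a b)
  simp only [hterm, ← Finset.smul_sum, Finset.sum_add_distrib, ← Finset.sum_mul, ← Finset.mul_sum,
    contract, sandwich_apply]
  rw [Finset.sum_comm (f := fun a b => E.low b a • (y b * z * x a))]

theorem IsOscPair.sum_symMul_symMul_invPoly {E : SuperMetric N M ϵ} {R : Type*} [Ring R]
    [Algebra ℂ R] {x y : Idx N M → R} (h : E.IsOscPair x y) (k : ℕ) :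
    ∑ a, ∑ b, E.low a b • symMul ((-E.eps) ^ k * koszulSign a b) (x a)
        (symMul ((-E.eps) ^ k) (y b) (invPoly E.eps E.omega (E.contract x y) k)) =
      invPoly E.eps E.omega (E.contract x y) (k + 1) := by
  have hcomm := (commute_invPoly E.eps E.omega (Commute.refl (E.contract x y)) k).eq
  rw [h.sum_symMul_symMul (E.neg_eps_pow_mul_self k), smul_add ((-E.eps) ^ k),
    smul_comm _ E.eps, (h.smul_sandwich_invPoly k).1, h.smul_sandwich_swap_invPoly, ← hcomm,
    invPoly_succ]
  match_scalars
  · linear_combination (1 / 4) * E.eps_mul_self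
  · linear_combination (-recCoeff E.eps E.omega k / 2) * E.eps_mul_self

/-- The sign relating the invariants to polynomials in the first one. -/
def invSign (E : SuperMetric N M ϵ) (k : ℕ) : ℂ := ∏ i ∈ Finset.range k, (-E.eps) ^ i

theorem invSign_mul_self (k : ℕ) : E.invSign k * E.invSign k = 1 := by
  rw [invSign, ← Finset.prod_mul_distrib]
  exact Finset.prod_eq_one fun i _ => E.neg_eps_pow_mul_self i

theorem invSign_add_two (k : ℕ) : E.invSign (k + 2) = -E.eps * E.invSign k := by
  rw [invSign, Finset.prod_range_succ, Finset.prod_range_succ, ← invSign, pow_succ]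
  linear_combination (-E.eps * E.invSign k) * E.neg_eps_pow_mul_self k

/-- The contraction `ε_{ab} c_1^a c_2^b`. -/
def firstInv : E.Osc2 := E.contract (E.osc 0) (E.osc 1)

theorem invariant_eq (k : ℕ) :
    E.invariant k = E.invSign k • invPoly E.eps E.omega E.firstInv k := by
  induction k with
  | zero => simp [invariant, invSign, invPoly_zero, symProd_fin_zero]
  | succ k ih =>
    rw [invariant_succ, ih]
    simp only [map_smul, smul_comm _ (E.invSign k), ← Finset.smul_sum, firstInv,
      E.isOscPair_osc.sum_symMul_symMul_invPoly]
    rw [smul_smul, invSign, invSign, Finset.prod_range_succ]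

/-! ### Spans of super-symmetrised monomials -/

/-- The span of the super-symmetrised monomials of bidegree `(k, l)` and parity `d`. -/
def monomialSpan (k l : ℕ) (d : ZMod 2) : Submodule ℂ E.Osc2 :=
  Submodule.span ℂ {z | ∃ (a : Fin k → Idx N M) (b : Fin l → Idx N M),
    degSum a + degSum b = d ∧ E.symMonomial a b = z}

theorem symMonomial_mem {k l : ℕ} (a : Fin k → Idx N M) (b : Fin l → Idx N M) :
    E.symMonomial a b ∈ E.monomialSpan k l (degSum a + degSum b) :=
  Submodule.subset_span ⟨a, b, rfl, rfl⟩

theorem symMul_osc_zero_mem {k l : ℕ} {d : ZMod 2} (e : Idx N M) {w : E.Osc2}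
    (hw : w ∈ E.monomialSpan k l d) :
    symMul ((-E.eps) ^ k * sgn (deg e * d)) (E.osc 0 e) w ∈
      E.monomialSpan (k + 1) l (deg e + d) := by
  refine Submodule.span_le (p := (E.monomialSpan (k + 1) l (deg e + d)).comap (symMul _ _)).2 ?_ hw
  rintro _ ⟨a, b, rfl, rfl⟩
  rw [SetLike.mem_coe, Submodule.mem_comap, symMul_osc_zero_symMonomial, ← add_assoc,
    ← degSum_cons]
  exact E.symMonomial_mem _ _

theorem symMul_osc_one_mem {k l : ℕ} {d : ZMod 2} (e : Idx N M) {w : E.Osc2}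
    (hw : w ∈ E.monomialSpan k l d) :
    symMul ((-E.eps) ^ l * sgn (deg e * d)) (E.osc 1 e) w ∈
      E.monomialSpan k (l + 1) (deg e + d) := by
  refine Submodule.span_le (p := (E.monomialSpan k (l + 1) (deg e + d)).comap (symMul _ _)).2 ?_ hw
  rintro _ ⟨a, b, rfl, rfl⟩
  rw [SetLike.mem_coe, Submodule.mem_comap, symMul_osc_one_symMonomial, add_left_comm,
    ← degSum_cons]
  exact Submodule.smul_mem _ _ (E.symMonomial_mem _ _)

theorem invPoly_mem (k : ℕ) :
    invPoly E.eps E.omega E.firstInv k ∈ E.monomialSpan k k 0 := by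
  rw [← one_smul ℂ (invPoly _ _ _ _), ← E.invSign_mul_self k, mul_smul, ← invariant_eq,
    invariant_eq_sum]
  refine Submodule.smul_mem _ _ (Submodule.sum_mem _ fun a _ => Submodule.sum_mem _ fun b _ => ?_)
  rcases eq_or_ne (∏ i, E.low (a i) (b i)) 0 with h | h
  · rw [h, zero_smul]
    exact Submodule.zero_mem _
  · have hdeg : degSum a + degSum (fun i => b (Fin.rev i)) = 0 := by
      rw [degSum_rev, E.degSum_eq_of_prod_low_ne_zero h, CharTwo.add_self_eq_zero]
    rw [← hdeg]
    exact Submodule.smul_mem _ _ (E.symMonomial_mem _ _)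

theorem swapSign_mul_neg_eps_pow (a b : Idx N M) (k : ℕ) :
    E.swapSign a b * (-E.eps) ^ k = (-E.eps) ^ (k + 1) * sgn (deg a * (deg b + 0)) := by
  rw [swapSign, koszulSign, add_zero, pow_succ]
  ring

theorem symInvPoly₂_osc_zero_mem (k : ℕ) (a b : Idx N M) :
    E.symInvPoly₂ (E.osc 0) E.firstInv k a b ∈
      E.monomialSpan (k + 2) k (deg a + (deg b + 0)) := by
  have hb := E.symMul_osc_zero_mem b (E.invPoly_mem k)
  rw [mul_zero, sgn_zero, mul_one] at hb
  rw [symInvPoly₂, swapSign_mul_neg_eps_pow]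
  exact E.symMul_osc_zero_mem a hb

theorem symInvPoly₂_osc_one_mem (k : ℕ) (a b : Idx N M) :
    E.symInvPoly₂ (E.osc 1) E.firstInv k a b ∈
      E.monomialSpan k (k + 2) (deg a + (deg b + 0)) := by
  have hb := E.symMul_osc_one_mem b (E.invPoly_mem k)
  rw [mul_zero, sgn_zero, mul_one] at hb
  rw [symInvPoly₂, swapSign_mul_neg_eps_pow]
  exact E.symMul_osc_one_mem a hb

end SuperMetric

/-! ### The constrained generators of `osp` -/

/-- The generators `G_{ab}` rescaled by `(-1)^{[a]}`, which turns the symmetry and the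
supercommutators of `osp` into those of `IsOspFamily`. -/
def twistG {N M : ℕ} {R : Type*} [Ring R] [Algebra ℂ R] (G : Idx N M → Idx N M → R)
    (a b : Idx N M) : R := sgn (deg a) • G a b

theorem smul_twistG {N M : ℕ} {R : Type*} [Ring R] [Algebra ℂ R] (G : Idx N M → Idx N M → R)
    (a b : Idx N M) : sgn (deg a) • twistG G a b = G a b := by
  rw [twistG, smul_smul, sgn_mul_self, one_smul]

theorem sum_perm_fin_three {V : Type*} [AddCommMonoid V] (f : Equiv.Perm (Fin 3) → V) :
    ∑ σ, f σ = f 1 + f (Equiv.swap 0 1) + f (Equiv.swap 1 2) + f (Equiv.swap 0 2) +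
      f (Equiv.swap 0 1 * Equiv.swap 1 2) + f (Equiv.swap 1 2 * Equiv.swap 0 1) := by
  have h : (Finset.univ : Finset (Equiv.Perm (Fin 3))) = {1, Equiv.swap 0 1, Equiv.swap 1 2,
      Equiv.swap 0 2, Equiv.swap 0 1 * Equiv.swap 1 2, Equiv.swap 1 2 * Equiv.swap 0 1} := by
    decide
  rw [h, Finset.sum_insert (by decide), Finset.sum_insert (by decide),
    Finset.sum_insert (by decide), Finset.sum_insert (by decide), Finset.sum_insert (by decide),
    Finset.sum_singleton]
  simp only [add_assoc]

namespace SuperMetric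

variable {N M : ℕ} {ϵ : ℤˣ} {E : SuperMetric N M ϵ} {R : Type*} [Ring R] [Algebra ℂ R]
  {𝒴 : ZMod 2 → Submodule ℂ R} {G : Idx N M → Idx N M → R}

section Lowering

variable (E) (G)

theorem sum_low_smul_raiseFst (d c : Idx N M) : ∑ a, E.low d a • E.raiseFst G a c = G d c := by
  simp only [raiseFst, Finset.smul_sum, smul_smul, sum_sum_low_mul_up_smul]

theorem sum_low_smul_raiseBoth (a d : Idx N M) :
    ∑ b, E.low d b • E.raiseBoth G a b = E.raiseFst G a d := by
  simp only [raiseBoth, Finset.smul_sum, smul_smul, sum_sum_low_mul_up_smul]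

variable (d₁ c₁ d₂ c₂ : Idx N M)

theorem sum_low_mul_low_smul_supercomm :
    ∑ a₁, ∑ a₂, (E.low d₁ a₁ * E.low d₂ a₂) • (sgn (deg c₁ * (deg a₂ + deg c₂)) •
        (E.raiseFst G a₁ c₁ * E.raiseFst G a₂ c₂ -
          sgn ((deg a₁ + deg c₁) * (deg a₂ + deg c₂)) •
            (E.raiseFst G a₂ c₂ * E.raiseFst G a₁ c₁))) =
      sgn (deg c₁ * (deg d₂ + deg c₂)) • (G d₁ c₁ * G d₂ c₂ -
        pairSign d₁ c₁ d₂ c₂ • (G d₂ c₂ * G d₁ c₁)) := by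
  have hterm : ∀ a₁ a₂, (E.low d₁ a₁ * E.low d₂ a₂) • (sgn (deg c₁ * (deg a₂ + deg c₂)) •
        (E.raiseFst G a₁ c₁ * E.raiseFst G a₂ c₂ -
          sgn ((deg a₁ + deg c₁) * (deg a₂ + deg c₂)) •
            (E.raiseFst G a₂ c₂ * E.raiseFst G a₁ c₁))) =
      sgn (deg c₁ * (deg d₂ + deg c₂)) •
        ((E.low d₁ a₁ • E.raiseFst G a₁ c₁) * (E.low d₂ a₂ • E.raiseFst G a₂ c₂) -
          pairSign d₁ c₁ d₂ c₂ •
            ((E.low d₂ a₂ • E.raiseFst G a₂ c₂) * (E.low d₁ a₁ • E.raiseFst G a₁ c₁))) := by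
    intro a₁ a₂
    rcases E.low_eq_zero_or d₁ a₁ with h₁ | h₁
    · simp only [h₁, zero_mul, zero_smul, mul_zero, smul_zero, sub_zero]
    rcases E.low_eq_zero_or d₂ a₂ with h₂ | h₂
    · simp only [h₂, zero_mul, zero_smul, mul_zero, smul_zero, sub_zero]
    rw [pairSign, h₁, h₂]
    simp only [smul_mul_assoc, mul_smul_comm]
    module
  simp only [hterm, Finset.sum_sub_distrib, ← Finset.smul_sum, ← Finset.mul_sum,
    ← Finset.sum_mul, sum_low_smul_raiseFst]

theorem sum_low_mul_low_smul_structure :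
    ∑ a₁, ∑ a₂, (E.low d₁ a₁ * E.low d₂ a₂) • (
      (E.eps * sgn (deg c₁ * deg c₂) * (if a₂ = c₁ then 1 else 0)) • E.raiseFst G a₁ c₂ -
      (E.eps * sgn (deg a₁ * deg a₂) * (if a₁ = c₂ then 1 else 0)) • E.raiseFst G a₂ c₁ +
      (E.eps * sgn (deg c₂) * E.up a₁ a₂) • G c₂ c₁ -
      (E.eps * sgn (deg a₂) * E.low c₁ c₂) • E.raiseBoth G a₁ a₂) =
      (E.eps * sgn (deg c₁ * deg c₂) * E.low d₂ c₁) • G d₁ c₂ -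
      (E.eps * sgn (deg d₁ * deg d₂) * E.low d₁ c₂) • G d₂ c₁ +
      (E.eps * sgn (deg c₂) * E.low d₂ d₁) • G c₂ c₁ -
      (E.eps * sgn (deg d₂) * E.low c₁ c₂) • G d₁ d₂ := by
  have hterm : ∀ a₁ a₂, (E.low d₁ a₁ * E.low d₂ a₂) • (
      (E.eps * sgn (deg c₁ * deg c₂) * (if a₂ = c₁ then 1 else 0)) • E.raiseFst G a₁ c₂ -
      (E.eps * sgn (deg a₁ * deg a₂) * (if a₁ = c₂ then 1 else 0)) • E.raiseFst G a₂ c₁ +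
      (E.eps * sgn (deg c₂) * E.up a₁ a₂) • G c₂ c₁ -
      (E.eps * sgn (deg a₂) * E.low c₁ c₂) • E.raiseBoth G a₁ a₂) =
      (E.eps * sgn (deg c₁ * deg c₂) * (E.low d₂ a₂ * if a₂ = c₁ then 1 else 0)) •
        (E.low d₁ a₁ • E.raiseFst G a₁ c₂) -
      (E.eps * sgn (deg d₁ * deg d₂) * (E.low d₁ a₁ * if a₁ = c₂ then 1 else 0)) •
        (E.low d₂ a₂ • E.raiseFst G a₂ c₁) +
      (E.eps * sgn (deg c₂)) • ((E.low d₁ a₁ * E.up a₁ a₂) • (E.low d₂ a₂ • G c₂ c₁)) -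
      (E.eps * sgn (deg d₂) * E.low c₁ c₂) •
        E.low d₁ a₁ • E.low d₂ a₂ • E.raiseBoth G a₁ a₂ := by
    intro a₁ a₂
    rcases E.low_eq_zero_or d₁ a₁ with h₁ | h₁
    · simp only [h₁, zero_mul, zero_smul, mul_zero, smul_zero, sub_zero, add_zero]
    rcases E.low_eq_zero_or d₂ a₂ with h₂ | h₂
    · simp only [h₂, zero_mul, zero_smul, mul_zero, smul_zero, sub_zero, add_zero]
    rw [h₁, h₂]
    module
  simp only [hterm, Finset.sum_sub_distrib, Finset.sum_add_distrib, ← Finset.smul_sum,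
    ← Finset.mul_sum, ← Finset.sum_smul, sum_low_smul_raiseFst, sum_low_smul_raiseBoth,
    sum_sum_low_mul_up_smul]
  simp only [mul_ite, mul_one, mul_zero, Finset.sum_ite_eq', Finset.mem_univ, if_true, smul_smul]

end Lowering

section Generators

theorem superComm_twistG (G : Idx N M → Idx N M → R) (a b c d : Idx N M) :
    superComm (twistG G) a b c d = (sgn (deg a) * sgn (deg c)) •
      (G a b * G c d - pairSign a b c d • (G c d * G a b)) := by
  simp only [superComm, twistG, smul_mul_smul_comm]
  module

theorem superAnticomm_twistG (G : Idx N M → Idx N M → R) (a b c d : Idx N M) :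
    superAnticomm (twistG G) a b c d = (sgn (deg a) * sgn (deg c)) • superAnticomm G a b c d := by
  simp only [superAnticomm, twistG, smul_mul_smul_comm]
  module

theorem IsOspGenerators.superComm_twistG (hG : E.IsOspGenerators 𝒴 G) (a b c d : Idx N M) :
    superComm (twistG G) a b c d =
      (sgn (deg a) * sgn (deg c) * sgn (deg b * (deg c + deg d))) •
        ((E.eps * sgn (deg b * deg d) * E.low c b) • G a d -
          (E.eps * sgn (deg a * deg c) * E.low a d) • G c b +
          (E.eps * sgn (deg d) * E.low c a) • G d b -
          (E.eps * sgn (deg c) * E.low b d) • G a c) := by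
  rw [SuperMetric.superComm_twistG, ← sum_low_mul_low_smul_structure]
  simp only [← hG.supercomm]
  rw [sum_low_mul_low_smul_supercomm, smul_smul, mul_assoc, sgn_mul_self, mul_one]

theorem IsOspGenerators.twistG_symm (hG : E.IsOspGenerators 𝒴 G) (a b : Idx N M) :
    twistG G a b = E.swapSign a b • twistG G b a := by
  have h := eq_neg_of_add_eq_zero_left (hG.symmetry a b)
  rw [twistG, twistG, h, sgn_add, sgn_add, ← koszulSign, swapSign]
  match_scalars
  linear_combination (-E.eps * koszulSign a b * sgn (deg b)) * sgn_mul_self (deg a)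

theorem IsOspGenerators.twistG_comm (hG : E.IsOspGenerators 𝒴 G) (a b c d : Idx N M) :
    superComm (twistG G) a b c d = E.eps • (
      E.low c b • twistG G a d + (E.swapSign a b * E.low c a) • twistG G b d +
        E.swapSign c d • (E.low d b • twistG G a c +
          (E.swapSign a b * E.low d a) • twistG G b c)) := by
  rw [hG.superComm_twistG, ← smul_twistG G a d, ← smul_twistG G c b, ← smul_twistG G d b,
    ← smul_twistG G a c, hG.twistG_symm c b, hG.twistG_symm d b, mul_add (deg b), sgn_add,
    ← koszulSign, ← koszulSign, ← koszulSign]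
  simp only [swapSign]
  have ha := sgn_mul_self (deg a)
  have hb := sgn_mul_self (deg b)
  have hc := sgn_mul_self (deg c)
  have hd := sgn_mul_self (deg d)
  have hbc := koszulSign_mul_self b c
  have hbd := koszulSign_mul_self b d
  match_scalars
  · rcases E.low_eq_zero_or c b with h | h
    · rw [h]; ring
    · rw [koszulSign_congr_right h b, koszulSign_self]
      grind
  · rcases E.low_eq_zero_or d a with h | h
    · rw [E.low_symm a d, h]
      ring
    · rw [E.low_symm a d, koszulSign_congr_right h b, koszulSign_congr_right h a,
        koszulSign_congr_right h c, koszulSign_self, koszulSign_comm c b, koszulSign_comm c a,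
        koszulSign_comm b a]
      grind
  · rcases E.low_eq_zero_or c a with h | h
    · rw [h]; ring
    · rw [h, koszulSign_congr_right h b, koszulSign_comm d b, koszulSign_comm b a]
      grind
  · rcases E.low_eq_zero_or d b with h | h
    · rw [E.low_symm b d, h]
      ring
    · rw [E.low_symm b d, koszulSign_congr_right h b, koszulSign_congr_right h c,
        koszulSign_self, koszulSign_comm c b]
      grind

theorem IsOspGenerators.superAnticomm_twistG_swap (hG : E.IsOspGenerators 𝒴 G)
    (p q r a : Idx N M) : superAnticomm (twistG G) q p r a =
      E.swapSign p q • superAnticomm (twistG G) p q r a := by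
  have hsign : sgn ((deg q + deg p) * (deg r + deg a)) =
      sgn ((deg p + deg q) * (deg r + deg a)) := by rw [add_comm (deg q)]
  rw [superAnticomm, superAnticomm, hsign, hG.twistG_symm q p, E.swapSign_comm q p,
    smul_mul_assoc, mul_smul_comm]
  module

theorem eps_mul_sgn (E : SuperMetric N M ϵ) (p r : Idx N M) :
    E.eps * sgn (deg p * deg r + deg p + deg r) =
      -(E.swapSign p r * (sgn (deg p) * sgn (deg r))) := by
  rw [sgn_add, sgn_add, swapSign, koszulSign]
  ring

theorem sum_reorderSignG_fin_three {V : Type*} [AddCommGroup V] [Module ℂ V]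
    (E : SuperMetric N M ϵ) (f : Idx N M → Idx N M → Idx N M → V) (x : Fin 3 → Idx N M) :
    ∑ σ, E.reorderSignG x σ • ((sgn (deg (x (σ 0))) * sgn (deg (x (σ 2)))) •
      f (x (σ 0)) (x (σ 1)) (x (σ 2))) = (sgn (deg (x 0)) * sgn (deg (x 2))) • (
        f (x 0) (x 1) (x 2) + E.swapSign (x 0) (x 1) • f (x 1) (x 0) (x 2) +
        E.swapSign (x 1) (x 2) • f (x 0) (x 2) (x 1) +
        (E.swapSign (x 0) (x 1) * E.swapSign (x 0) (x 2) * E.swapSign (x 1) (x 2)) •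
          f (x 2) (x 1) (x 0) +
        (E.swapSign (x 0) (x 1) * E.swapSign (x 0) (x 2)) • f (x 1) (x 2) (x 0) +
        (E.swapSign (x 0) (x 2) * E.swapSign (x 1) (x 2)) • f (x 2) (x 0) (x 1)) := by
  have h₀ := sgn_mul_self (deg (x 0))
  have h₁ := sgn_mul_self (deg (x 1))
  have h₂ := sgn_mul_self (deg (x 2))
  rw [sum_perm_fin_three]
  simp only [reorderSignG, Equiv.Perm.coe_one, id_eq, neg_mul, eps_mul_sgn, neg_neg,
    Fin.prod_univ_three, Fin.isValue, not_lt_zero, false_and, ↓reduceIte, Fin.lt_one_iff,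
    Nat.reduceAdd, mul_ite, one_mul, mul_one, ite_mul, Fin.reduceLT, and_false, Fin.reduceEq,
    one_ne_zero, lt_self_iff_false, and_self, and_true, one_smul, Equiv.swap_apply_def,
    zero_lt_one, zero_ne_one, Equiv.Perm.coe_mul, Function.comp_apply, ite_eq_left_iff,
    not_true_eq_false, imp_self, not_false_eq_true, imp_false, smul_add]
  rw [E.swapSign_comm (x 2) (x 1), E.swapSign_comm (x 2) (x 0), E.swapSign_comm (x 1) (x 0)]
  match_scalars <;> grind

theorem IsOspGenerators.superAnticomm_twistG_cyclic (hG : E.IsOspGenerators 𝒴 G)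
    (hGG : E.SymAnticommVanishes G) (a b c d : Idx N M) :
    superAnticomm (twistG G) b c d a +
      (E.swapSign d b * E.swapSign d c) • superAnticomm (twistG G) d b c a +
      (E.swapSign b c * E.swapSign b d) • superAnticomm (twistG G) c d b a = 0 := by
  have hsgn : sgn (deg b) * sgn (deg d) ≠ 0 :=
    mul_ne_zero (left_ne_zero_of_mul_eq_one (sgn_mul_self _))
      (left_ne_zero_of_mul_eq_one (sgn_mul_self _))
  have hsum := hGG ![b, c, d] a
  have hG' : ∀ p q r, superAnticomm G p q r a =
      (sgn (deg p) * sgn (deg r)) • superAnticomm (twistG G) p q r a := fun p q r => by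
    have hp := sgn_mul_self (deg p)
    have hr := sgn_mul_self (deg r)
    rw [superAnticomm_twistG]
    match_scalars
    grind
  simp only [hG'] at hsum
  rw [sum_reorderSignG_fin_three _ fun p q r => superAnticomm (twistG G) p q r a,
    smul_smul] at hsum
  replace hsum := (smul_eq_zero.1 hsum).resolve_left
    (mul_ne_zero (by norm_num [Nat.factorial]) hsgn)
  simp only [Matrix.cons_val_zero, Matrix.cons_val_one, Matrix.cons_val] at hsum
  rw [hG.superAnticomm_twistG_swap b c, hG.superAnticomm_twistG_swap d b,
    hG.superAnticomm_twistG_swap c d, E.swapSign_comm d b] at hsum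
  have hbc := E.swapSign_mul_self b c
  have hcd := E.swapSign_mul_self c d
  refine (smul_eq_zero.1 (Eq.trans ?_ hsum)).resolve_left (two_ne_zero (α := ℂ))
  rw [E.swapSign_comm d b, E.swapSign_comm d c]
  match_scalars <;> grind

theorem IsOspGenerators.isOspFamily (hG : E.IsOspGenerators 𝒴 G)
    (hGG : E.SymAnticommVanishes G) : E.IsOspFamily (twistG G) where
  symm := hG.twistG_symm
  comm := hG.twistG_comm
  cyclic := hG.superAnticomm_twistG_cyclic hGG

end Generators
end SuperMetric

/-! ### The spinorial relation -/

theorem mul_sub_mul_eq_rllDefect {R : Type*} [Ring R] [Algebra ℂ R] {Z X₁ X₂ : R}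
    (h : Commute Z (X₁ + X₂)) (u v : ℂ) :
    Z * ((u + v) • (1 : R) - (1 / 2 : ℂ) • X₁) * (v • (1 : R) - (1 / 2 : ℂ) • X₂) -
      (v • (1 : R) - (1 / 2 : ℂ) • X₁) * ((u + v) • (1 : R) - (1 / 2 : ℂ) • X₂) * Z =
    (1 / 4 : ℂ) • rllDefect u X₁ X₂ Z := by
  have hcomm := h.eq
  simp only [rllDefect, LinearMap.sub_apply, LinearMap.smul_apply, LinearMap.mulRight_apply,
    LinearMap.mulLeft_apply, symMul_apply, mul_add, add_mul, mul_sub, sub_mul, mul_smul_comm,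
    smul_mul_assoc, mul_one, one_mul, smul_sub, smul_add, smul_smul, mul_assoc] at hcomm ⊢
  linear_combination (norm := module) (-(1 / 2 * v + 1 / 4 * u)) • hcomm

namespace SuperMetric

variable {N M : ℕ} {ϵ : ℤˣ} {E : SuperMetric N M ϵ}

/-- The coefficients of the `R`-operator with respect to the normalised invariants `invPoly`. -/
def rCoeff (E : SuperMetric N M ϵ) (r : ℕ → ℂ) (k : ℕ) : ℂ :=
  r k / (k.factorial : ℂ) * E.invSign k

theorem rCoeff_add_two {r : ℕ → ℂ} {u : ℂ} (hr : Recurrence E.omega u r) (k : ℕ) :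
    E.rCoeff r (k + 2) * (1 / 2 * E.eps * (k + 2 : ℕ) * ((k + 2 : ℕ) - 1) *
      ((k + 2 : ℕ) + u - E.omega)) = E.rCoeff r k * (-2 * (u - k)) := by
  have hfac : (k.factorial : ℂ) ≠ 0 := Nat.cast_ne_zero.2 k.factorial_ne_zero
  have hone : (k : ℂ) + 1 ≠ 0 := Nat.cast_add_one_ne_zero k
  have htwo : (k : ℂ) + 2 ≠ 0 := by exact_mod_cast (k + 1).succ_ne_zero
  rw [rCoeff, rCoeff, invSign_add_two, Nat.factorial_succ, Nat.factorial_succ]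
  push_cast
  rw [show (k : ℂ) + 2 - 1 = k + 1 by ring, show (k : ℂ) + 1 + 1 = k + 2 by ring]
  field_simp
  linear_combination (-E.invSign k * E.eps ^ 2) * hr k -
    4 * E.invSign k * r k * (u - k) * E.eps_mul_self

theorem sum_rCoeff_smul_sub {V : Type*} [AddCommGroup V] [Module ℂ V] {r : ℕ → ℂ} {u : ℂ}
    (hr : Recurrence E.omega u r) (T : ℕ → V) (K : ℕ) :
    ∑ k ∈ Finset.range (K + 2), E.rCoeff r k • ((-2 * (u - k)) • T k -
        (1 / 2 * E.eps * k * (k - 1) * (k + u - E.omega)) • T (k - 2)) =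
      (E.rCoeff r (K + 1) * (-2 * (u - (K + 1 : ℕ)))) • T (K + 1) +
        (E.rCoeff r K * (-2 * (u - K))) • T K := by
  induction K with
  | zero =>
    simp only [Finset.sum_range_succ, Finset.sum_range_zero, Nat.cast_zero, Nat.cast_one]
    module
  | succ K ih =>
    rw [Finset.sum_range_succ, ih, Nat.add_sub_cancel (m := 2), smul_sub, smul_smul, smul_smul,
      rCoeff_add_two hr]
    module

section Embeddings

variable {Y : Type*} [Ring Y] [Algebra ℂ Y] {𝒴 : ZMod 2 → Submodule ℂ Y} [GradedAlgebra 𝒴]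
  {G : Idx N M → Idx N M → Y}

/-- The embedding `z ↦ z ⊗ 1` of the two oscillator algebras. -/
abbrev inOsc (E : SuperMetric N M ϵ) (𝒴 : ZMod 2 → Submodule ℂ Y) [GradedAlgebra 𝒴] :
    E.Osc2 →ₐ[ℂ] E.Osc2Y 𝒴 :=
  GradedTensorProduct.includeLeft E.osc2Grading 𝒴

/-- The embedding `w ↦ 1 ⊗ w` of the algebra containing the generators of `osp`. -/
abbrev inGen (E : SuperMetric N M ϵ) (𝒴 : ZMod 2 → Submodule ℂ Y) [GradedAlgebra 𝒴] :
    Y →ₐ[ℂ] E.Osc2Y 𝒴 :=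
  GradedTensorProduct.includeRight E.osc2Grading 𝒴

theorem inOsc_mul_inGen (z : E.Osc2) (w : Y) :
    E.inOsc 𝒴 z * E.inGen 𝒴 w = (z ᵍ⊗ₜ[ℂ] w : E.Osc2Y 𝒴) :=
  GradedTensorProduct.tmul_one_mul_one_tmul ..

/-- The oscillators `c_1^a` and `c_2^a` in the triple tensor product. -/
def oscY (E : SuperMetric N M ϵ) (𝒴 : ZMod 2 → Submodule ℂ Y) [GradedAlgebra 𝒴] (i : Fin 2)
    (a : Idx N M) : E.Osc2Y 𝒴 :=
  E.inOsc 𝒴 (E.osc i a)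

/-- The twisted generators `(-1)^{[a]} G_{ab}` in the triple tensor product. -/
def genY (E : SuperMetric N M ϵ) (𝒴 : ZMod 2 → Submodule ℂ Y) [GradedAlgebra 𝒴]
    (G : Idx N M → Idx N M → Y) (a b : Idx N M) : E.Osc2Y 𝒴 :=
  E.inGen 𝒴 (twistG G a b)

theorem isOscPair_oscY : E.IsOscPair (E.oscY 𝒴 0) (E.oscY 𝒴 1) :=
  E.isOscPair_osc.map (E.inOsc 𝒴)

theorem osc_mem (i : Fin 2) (a : Idx N M) : E.osc i a ∈ E.osc2Grading (deg a) := by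
  rw [mem_parityGrading, osc, ← map_smul, ← oscParity_c]
  fin_cases i
  · exact (tensorParity_tmul _ _ (E.c a) 1).trans (by rw [map_one]; rfl)
  · exact (tensorParity_tmul _ _ 1 (E.c a)).trans (by rw [map_one]; rfl)

theorem IsOspGenerators.superCommutes (hG : E.IsOspGenerators 𝒴 G) (i : Fin 2) :
    SuperCommutes (E.genY 𝒴 G) (E.oscY 𝒴 i) := by
  intro a b c
  have hmem : twistG G b c ∈ 𝒴 (deg b + deg c) := Submodule.smul_mem _ _ (hG.homogeneous b c)
  have hmul := tmul_mul_tmul E.osc2Grading 𝒴 (osc_mem i a) hmem 1 1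
  rw [one_mul, mul_one, mul_comm (deg b + deg c), mul_add, sgn_add,
    ← inOsc_mul_inGen (E.osc i a) (twistG G b c)] at hmul
  exact hmul

theorem symProd_pair (a b : Idx N M) : E.symProd ![a, b] = E.symPair E.c a b := by
  change E.symProd (Fin.cons a (Fin.cons b ![])) = _
  simp only [symProd_cons, symProd_fin_zero, moveSign_cons, moveSign_fin_zero, symMul_apply,
    symPair, mul_one, one_mul, one_smul, mul_smul_comm, smul_mul_assoc, mul_add, add_mul]
  linear_combination (norm := module) (-(1 / 2 : ℂ)) • E.c_mul_c a b

theorem L_eq (hg : E.IsOspFamily (twistG G)) (i : Fin 2) (u : ℂ) :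
    E.L 𝒴 G i u = u • (1 : E.Osc2Y 𝒴) -
      (1 / 2 : ℂ) • E.eps • bil (E.oscY 𝒴 i) (E.oscY 𝒴 i) (E.genY 𝒴 G) := by
  have hterm : ∀ a b, ((E.leg i (E.F a b)) ᵍ⊗ₜ[ℂ] (G b a) : E.Osc2Y 𝒴) =
      E.eps • (E.oscY 𝒴 i a * E.oscY 𝒴 i b * E.genY 𝒴 G b a) -
        (1 / 2 * E.eps) • E.inGen 𝒴 (E.up a b • twistG G b a) := by
    intro a b
    rw [← inOsc_mul_inGen, F, symProd_pair, symPair, oscY, oscY, osc, osc, genY, twistG]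
    simp only [map_smul, map_sub, map_mul, map_one, smul_mul_assoc, mul_smul_comm, sub_mul, one_mul]
    module
  have htrace := congrArg (E.inGen 𝒴) hg.trace
  simp only [map_zero, map_sum] at htrace
  rw [L, bil]
  simp only [hterm, Finset.sum_sub_distrib, ← Finset.smul_sum, htrace, smul_zero, sub_zero]

theorem inOsc_mul_inGen_mem_filtration {k l d : ℕ} {j : ZMod 2} (hd : d ≤ k + l) {z : E.Osc2}
    (hz : z ∈ E.monomialSpan k l j) (w : Y) : E.inOsc 𝒴 z * E.inGen 𝒴 w ∈ E.filtration 𝒴 d := by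
  refine Submodule.span_le (p := (E.filtration 𝒴 d).comap
    (LinearMap.mulRight ℂ (E.inGen 𝒴 w) ∘ₗ (E.inOsc 𝒴).toLinearMap)).2 ?_ hz
  rintro _ ⟨a, b, -, rfl⟩
  exact Submodule.subset_span ⟨k, l, a, b, w, hd, inOsc_mul_inGen _ _⟩

theorem symBilDiff_mem_filtration {k d : ℕ} (hd : d ≤ k) :
    E.symBilDiff (E.oscY 𝒴 0) (E.oscY 𝒴 1) (E.genY 𝒴 G) k ∈ E.filtration 𝒴 d := by
  have hmap : ∀ i a b, E.symInvPoly₂ (E.oscY 𝒴 i) (E.contract (E.oscY 𝒴 0) (E.oscY 𝒴 1)) k a b =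
      E.inOsc 𝒴 (E.symInvPoly₂ (E.osc i) E.firstInv k a b) := by
    intro i a b
    rw [map_symInvPoly₂, firstInv, map_contract]
    rfl
  simp only [symBilDiff, symBil, hmap]
  refine Submodule.smul_mem _ _ (Submodule.sub_mem _ ?_ ?_) <;>
    refine Submodule.sum_mem _ fun a _ => Submodule.sum_mem _ fun b _ => ?_
  · exact inOsc_mul_inGen_mem_filtration (by lia) (E.symInvPoly₂_osc_one_mem k a b) _
  · exact inOsc_mul_inGen_mem_filtration (by lia) (E.symInvPoly₂_osc_zero_mem k a b) _

theorem inOsc_Rsum (r : ℕ → ℂ) (K : ℕ) :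
    E.inOsc 𝒴 (E.Rsum r K) = ∑ k ∈ Finset.range K, E.rCoeff r k •
      invPoly E.eps E.omega (E.contract (E.oscY 𝒴 0) (E.oscY 𝒴 1)) k := by
  simp only [Rsum, map_sum, invariant_eq, smul_smul, map_smul, map_invPoly, firstInv, map_contract]
  rfl

theorem rllDefect_inOsc_Rsum (hG : E.IsOspGenerators 𝒴 G) (hGG : E.SymAnticommVanishes G) {u : ℂ}
    {r : ℕ → ℂ} (hr : Recurrence E.omega u r) (K : ℕ) :
    rllDefect u (E.eps • bil (E.oscY 𝒴 0) (E.oscY 𝒴 0) (E.genY 𝒴 G))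
        (E.eps • bil (E.oscY 𝒴 1) (E.oscY 𝒴 1) (E.genY 𝒴 G)) (E.inOsc 𝒴 (E.Rsum r (K + 2))) =
      (E.rCoeff r (K + 1) * (-2 * (u - (K + 1 : ℕ)))) •
          E.symBilDiff (E.oscY 𝒴 0) (E.oscY 𝒴 1) (E.genY 𝒴 G) (K + 1) +
        (E.rCoeff r K * (-2 * (u - K))) •
          E.symBilDiff (E.oscY 𝒴 0) (E.oscY 𝒴 1) (E.genY 𝒴 G) K := by
  have hg : E.IsOspFamily (E.genY 𝒴 G) := (hG.isOspFamily hGG).map (E.inGen 𝒴)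
  simp only [inOsc_Rsum, map_sum, map_smul,
    isOscPair_oscY.rllDefect_invPoly hg (hG.superCommutes 0) (hG.superCommutes 1)]
  exact sum_rCoeff_smul_sub hr _ K

theorem commute_inOsc_Rsum (hG : E.IsOspGenerators 𝒴 G) (hGG : E.SymAnticommVanishes G)
    (r : ℕ → ℂ) (K : ℕ) :
    Commute (E.inOsc 𝒴 (E.Rsum r K)) (E.eps • bil (E.oscY 𝒴 0) (E.oscY 𝒴 0) (E.genY 𝒴 G) +
      E.eps • bil (E.oscY 𝒴 1) (E.oscY 𝒴 1) (E.genY 𝒴 G)) := by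
  have hg : E.IsOspFamily (E.genY 𝒴 G) := (hG.isOspFamily hGG).map (E.inGen 𝒴)
  have hcomm := isOscPair_oscY.commute_bil_add_bil hg (hG.superCommutes 0) (hG.superCommutes 1)
  rw [inOsc_Rsum, ← smul_add]
  exact Commute.sum_left _ _ _ fun k _ =>
    ((commute_invPoly E.eps E.omega hcomm k).symm.smul_left _).smul_right _

theorem spinorialRLL (hG : E.IsOspGenerators 𝒴 G) (hGG : E.SymAnticommVanishes G) {u : ℂ}
    {r : ℕ → ℂ} (hr : Recurrence E.omega u r) (v : ℂ) : E.SpinorialRLL 𝒴 G r u v := by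
  intro d
  refine ⟨d + 2, fun K hK => ?_⟩
  obtain ⟨K, rfl⟩ := Nat.exists_eq_add_of_le' (le_trans (Nat.le_add_left 2 d) hK)
  have hg := hG.isOspFamily hGG
  change E.inOsc 𝒴 (E.Rsum r (K + 2)) * _ * _ - _ * E.inOsc 𝒴 (E.Rsum r (K + 2)) ∈ _
  rw [L_eq hg, L_eq hg, L_eq hg, L_eq hg,
    mul_sub_mul_eq_rllDefect (commute_inOsc_Rsum hG hGG r (K + 2)), rllDefect_inOsc_Rsum hG hGG hr]
  exact Submodule.smul_mem _ _ (Submodule.add_mem _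
    (Submodule.smul_mem _ _ (symBilDiff_mem_filtration (by lia)))
    (Submodule.smul_mem _ _ (symBilDiff_mem_filtration (by lia))))

end Embeddings

end SuperMetric

/-! ### Solutions of the recurrence -/

/-- The sequence `(-4)^m Γ(m - x) / Γ(m + 1 + y)`, the common shape of the even and the odd
coefficients in `gammaCoeff`. -/
def gammaSeq (x y : ℂ) (m : ℕ) : ℂ :=
  (-4) ^ m * (Complex.Gamma (m - x) / Complex.Gamma (m + 1 + y))

theorem gammaSeq_succ {x : ℂ} (y : ℂ) {m : ℕ} (hx : x ≠ m) :
    (m + 1 + y) * gammaSeq x y (m + 1) = -4 * (m - x) * gammaSeq x y m := by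
  have hnum : Complex.Gamma ((m + 1 : ℕ) - x) = (m - x) * Complex.Gamma (m - x) := by
    rw [← Complex.Gamma_add_one _ (sub_ne_zero.2 hx.symm)]
    congr 1
    push_cast
    ring
  have hden := Complex.one_div_Gamma_eq_self_mul_one_div_Gamma_add_one ((m : ℂ) + 1 + y)
  have hcast : ((m + 1 : ℕ) : ℂ) + 1 + y = (m : ℂ) + 1 + y + 1 := by
    push_cast
    ring
  rw [gammaSeq, gammaSeq, hnum, hcast, pow_succ]
  linear_combination ((-4) ^ m * 4 * (m - x) * Complex.Gamma (m - x)) * hden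

theorem gammaSeq_ne_zero {x y : ℂ} (hx : ∀ m : ℕ, x ≠ m) {n : ℕ}
    (hn : 0 < ((n : ℂ) + 1 + y).re) : gammaSeq x y n ≠ 0 := by
  refine mul_ne_zero (pow_ne_zero _ (by norm_num)) (div_ne_zero ?_ ?_)
  · refine Complex.Gamma_ne_zero fun m hm => hx (n + m) ?_
    push_cast
    linear_combination -hm
  · exact Complex.Gamma_ne_zero_of_re_pos hn

theorem eq_zero_of_two_term_recurrence {R : Type*} [MulZeroClass R] [NoZeroDivisors R]
    {p q D : ℕ → R} (hD : ∀ m, p m * D (m + 1) = q m * D m) (hq : ∀ m, q m ≠ 0) {n : ℕ}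
    (hp : ∀ m ≥ n, p m ≠ 0) (hn : D n = 0) (m : ℕ) : D m = 0 := by
  rcases le_total n m with hm | hm
  · induction m, hm using Nat.le_induction with
    | base => exact hn
    | succ m hm ih =>
      have h := hD m
      rw [ih, mul_zero] at h
      exact (mul_eq_zero.1 h).resolve_left (hp m hm)
  · induction hm using Nat.decreasingInduction with
    | self => exact hn
    | of_succ m _ ih =>
      have h := hD m
      rw [ih, mul_zero] at h
      exact (mul_eq_zero.1 h.symm).resolve_left (hq m)

theorem eq_gammaSeq_mul {x y : ℂ} (hx : ∀ m : ℕ, x ≠ m) {R : ℕ → ℂ}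
    (hR : ∀ m : ℕ, (m + 1 + y) * R (m + 1) = -4 * (m - x) * R m) :
    ∃ α : ℂ, ∀ m, R m = gammaSeq x y m * α := by
  obtain ⟨n, hn⟩ := exists_nat_gt (-y.re)
  have hre : ∀ m ≥ n, 0 < ((m : ℂ) + 1 + y).re := by
    intro m hm
    have hcast : (n : ℝ) ≤ m := Nat.cast_le.2 hm
    simp only [Complex.add_re, Complex.natCast_re, Complex.one_re]
    linarith
  have hne : gammaSeq x y n ≠ 0 := gammaSeq_ne_zero hx (hre n le_rfl)
  set D : ℕ → ℂ := fun m => R m - gammaSeq x y m * (R n / gammaSeq x y n) with hD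
  have hrec : ∀ m : ℕ, (m + 1 + y) * D (m + 1) = -4 * (m - x) * D m := by
    intro m
    simp only [hD]
    linear_combination hR m - (R n / gammaSeq x y n) * gammaSeq_succ y (hx m)
  have hDn : D n = 0 := by
    simp only [hD]
    rw [mul_div_cancel₀ _ hne, sub_self]
  have hD_zero := eq_zero_of_two_term_recurrence hrec
    (fun m => mul_ne_zero (by norm_num) (sub_ne_zero.2 (hx m).symm))
    (fun m hm h => (hre m hm).ne' (by rw [h, Complex.zero_re])) hDn
  exact ⟨R n / gammaSeq x y n, fun m => sub_eq_zero.1 (hD_zero m)⟩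

theorem gammaCoeff_even (ω u α β : ℂ) (m : ℕ) :
    gammaCoeff ω u α β (2 * m) = gammaSeq (u / 2) ((u - ω) / 2) m * α := by
  rw [gammaCoeff, if_pos (even_two_mul m), Nat.mul_div_cancel_left m two_pos, gammaSeq]

theorem gammaCoeff_odd (ω u α β : ℂ) (m : ℕ) :
    gammaCoeff ω u α β (2 * m + 1) = gammaSeq ((u - 1) / 2) ((u - ω + 1) / 2) m * β := by
  rw [gammaCoeff, if_neg (Nat.not_even_two_mul_add_one m), show (2 * m + 1) / 2 = m by omega,
    gammaSeq]

theorem recurrence_iff_even_odd (ω u : ℂ) (r : ℕ → ℂ) :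
    Recurrence ω u r ↔
      (∀ m : ℕ, (m + 1 + (u - ω) / 2) * r (2 * (m + 1)) = -4 * (m - u / 2) * r (2 * m)) ∧
      ∀ m : ℕ, (m + 1 + (u - ω + 1) / 2) * r (2 * (m + 1) + 1) =
        -4 * (m - (u - 1) / 2) * r (2 * m + 1) := by
  constructor
  · intro h
    refine ⟨fun m => ?_, fun m => ?_⟩
    · have hk := h (2 * m)
      rw [show 2 * m + 2 = 2 * (m + 1) by ring] at hk
      push_cast at hk
      linear_combination (1 / 2 : ℂ) * hk
    · have hk := h (2 * m + 1)
      rw [show 2 * m + 1 + 2 = 2 * (m + 1) + 1 by ring] at hk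
      push_cast at hk
      linear_combination (1 / 2 : ℂ) * hk
  · rintro ⟨he, ho⟩ k
    obtain ⟨m, rfl | rfl⟩ := Nat.even_or_odd' k
    · rw [show 2 * m + 2 = 2 * (m + 1) by ring]
      push_cast
      linear_combination 2 * he m
    · rw [show 2 * m + 1 + 2 = 2 * (m + 1) + 1 by ring]
      push_cast
      linear_combination 2 * ho m

theorem recurrence_gammaCoeff (ω : ℂ) {u α β : ℂ} (hα : α ≠ 0 → ∀ m : ℕ, u ≠ 2 * (m : ℂ))
    (hβ : β ≠ 0 → ∀ m : ℕ, u ≠ 2 * (m : ℂ) + 1) : Recurrence ω u (gammaCoeff ω u α β) := by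
  rw [recurrence_iff_even_odd]
  simp only [gammaCoeff_even, gammaCoeff_odd]
  refine ⟨fun m => ?_, fun m => ?_⟩
  · rcases eq_or_ne α 0 with h | h
    · simp [h]
    · have hx : u / 2 ≠ m := fun hm => hα h m (by linear_combination 2 * hm)
      linear_combination α * gammaSeq_succ ((u - ω) / 2) hx
  · rcases eq_or_ne β 0 with h | h
    · simp [h]
    · have hx : (u - 1) / 2 ≠ m := fun hm => hβ h m (by linear_combination 2 * hm)
      linear_combination β * gammaSeq_succ ((u - ω + 1) / 2) hx

theorem recurrence_iff_gammaCoeff (ω : ℂ) {u : ℂ} (hu : ∀ n : ℕ, u ≠ (n : ℂ)) (r : ℕ → ℂ) :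
    Recurrence ω u r ↔ ∃ α β : ℂ, r = gammaCoeff ω u α β := by
  have heven : ∀ m : ℕ, u ≠ 2 * (m : ℂ) := fun m h => hu (2 * m) (by push_cast; exact h)
  have hodd : ∀ m : ℕ, u ≠ 2 * (m : ℂ) + 1 := fun m h => hu (2 * m + 1) (by push_cast; exact h)
  constructor
  · intro hr
    obtain ⟨hre, hro⟩ := (recurrence_iff_even_odd ω u r).1 hr
    obtain ⟨α, hα⟩ := eq_gammaSeq_mul (R := fun m => r (2 * m))
      (fun m hm => heven m (by linear_combination 2 * hm)) hre
    obtain ⟨β, hβ⟩ := eq_gammaSeq_mul (R := fun m => r (2 * m + 1))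
      (fun m hm => hodd m (by linear_combination 2 * hm)) hro
    refine ⟨α, β, funext fun k => ?_⟩
    obtain ⟨m, rfl | rfl⟩ := Nat.even_or_odd' k
    · rw [gammaCoeff_even, ← hα]
    · rw [gammaCoeff_odd, ← hβ]
  · rintro ⟨α, β, rfl⟩
    exact recurrence_gammaCoeff ω (fun _ => heven) fun _ => hodd

end OSp

end

theorem proposition6 {N M : ℕ} {ϵ : ℤˣ} (E : OSp.SuperMetric N M ϵ)
    {Y : Type*} [Ring Y] [Algebra ℂ Y] (𝒴 : ZMod 2 → Submodule ℂ Y) [GradedAlgebra 𝒴]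
    (G : OSp.Idx N M → OSp.Idx N M → Y)
    (hG : E.IsOspGenerators 𝒴 G) (hGG : E.SymAnticommVanishes G) :
    (∀ (A B : ℂ → ℂ) (u : ℂ),
      (A u ≠ 0 → ∀ m : ℕ, u ≠ 2 * (m : ℂ)) → (B u ≠ 0 → ∀ m : ℕ, u ≠ 2 * (m : ℂ) + 1) →
        OSp.Recurrence E.omega u (OSp.gammaCoeff E.omega u (A u) (B u)) ∧
        ∀ v : ℂ, E.SpinorialRLL 𝒴 G (OSp.gammaCoeff E.omega u (A u) (B u)) u v) ∧
    (∀ (u : ℂ) (r : ℕ → ℂ), OSp.Recurrence E.omega u r →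
      ∀ v : ℂ, E.SpinorialRLL 𝒴 G r u v) ∧
    (∀ u : ℂ, (∀ n : ℕ, u ≠ (n : ℂ)) → ∀ r : ℕ → ℂ,
      OSp.Recurrence E.omega u r ↔ ∃ α β : ℂ, r = OSp.gammaCoeff E.omega u α β) := by
  refine ⟨fun A B u hA hB => ?_, fun u r hr v => OSp.SuperMetric.spinorialRLL hG hGG hr v,
    fun u hu r => OSp.recurrence_iff_gammaCoeff E.omega hu r⟩
  have hr := OSp.recurrence_gammaCoeff E.omega hA hB
  exact ⟨hr, fun v => OSp.SuperMetric.spinorialRLL hG hGG hr v⟩
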